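/- Let $P\subset\mathbb R^3$ be a plane, $\alpha\in S^2$ a unit vector transversal to $P$, and $n$ the unit normal of $P$ with $n_\alpha=n\cdot\alpha<0$. Let $M\subset P$ be a non-empty (relatively open) convex domain bounded by a polygon $\partial M$, let $\lambda\in\mathbb C$ with $\Im\lambda\ge0$, and put $$A=\frac{i n_\alpha+\lambda}{i n_\alpha-\lambda},\qquad \alpha^*=\alpha-2(\alpha\cdot n)n,\qquad t_0=2(\alpha\cdot n)(n\cdot r)\ \ (r\in M),$$ where $t_0$ does not depend on $r\in M$. Let $S=\{r_0+t\alpha: r_0\in M,\ t>0\}$ be the shadow zone and $R=\{r_0+t\alpha^*: r_0\in M,\ t>0\}$ the reflected zone. Fix $\delta\in(0,1/2)$ and, for $k>1$, let $\eta=\eta(k,\cdot)$ be a real $C^\infty$ function on $M$ that vanishes in the $k^{-\delta}$-neighbourhood of $\partial M$, equals $1$ outside the $2k^{-\delta}$-neighbourhood of $\partial M$, and satisfies $|D^m\eta|\le C_mk^{\delta m}$ for every partial derivative of order $m$, with $C_m$ independent of $k$. Define $$D(r)=\int_M\eta\,e^{ik(\alpha\cdot q)}\frac{e^{ik|r-q|}}{|r-q|}\,dS(q),\qquad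 N(r)=\int_M\eta\,e^{ik(\alpha\cdot q)}\frac{\partial}{\partial n_q}\frac{e^{ik|r-q|}}{|r-q|}\,dS(q),$$ the Kirchhoff approximation $$\Phi=\frac{ik}{4\pi}(A-1)n_\alpha D+\frac{A+1}{4\pi}N,$$ and the eikonal approximation $$\psi^{eik}(r)=\begin{cases}-e^{ik\,\alpha\cdot r}, & r\in S,\\ A\,e^{ik(\alpha^*\cdot r+t_0)}, & r\in R,\\ 0, & r\in\mathbb R^3\setminus(R\cup S).\end{cases}$$ For $k>1$, both functions are differentiable outside $\partial R\cup\partial S$. On $\partial R\cup\partial S$ (in particular on $M$, where the two sides are approached from $R$ and from $S$), values and gradients of $\Phi$ and $\psi^{eik}$ are understood as one-sided limits from any of the open regions $R$, $S$, $\mathbb R^3\setminus\overline{R\cup S}$ that has the point in its closure; these limits exist for all large $k$. Then, as $k\to\infty$: (1) uniformly on every compact subset of $M$ (from either side of $M$), and uniformly on every compact subset of $\mathbb R^3\setminus(\partial R\cup\partial S)$, $$\Phi(r)=\psi^{eik}(r)+O(k^{-1/2}),\qquad |\nabla\Phi(r)-\nabla\psi^{eik}(r)|=O(\sqrt k);$$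 (2) for every $\rho>0$ there are constants $C_1,C_2$ such that, for all sufficiently large $k$ and all $|r|<\rho$, $$|\Phi(r)-\psi^{eik}(r)|\le C_1,\qquad |\nabla\Phi(r)-\nabla\psi^{eik}(r)|\le C_2k.$$ -/

import Mathlib

open Filter Topology MeasureTheory
open scoped ContDiff

noncomputable section

namespace KirchhoffPolygon

/-- The Euclidean plane, used as Cartesian coordinates on the plane of the polygon. -/
abbrev E2 := EuclideanSpace ℝ (Fin 2)

/-- The Euclidean space. -/
abbrev E3 := EuclideanSpace ℝ (Fin 3)

/-- The open convex polygonal domain with vertices among `V`, in Cartesian coordinates. -/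
def polygon (V : Finset E2) : Set E2 := interior (convexHull ℝ (V : Set E2))

/-- `η = η(k, q)` is an admissible cut-off function on the planar domain `M₀`: for `k > 1` it is
smooth on `M₀`, vanishes in the `k^{-δ}`-neighbourhood of the edges, equals one outside the
`2k^{-δ}`-neighbourhood of the edges, and its derivatives of order `m` are `O(k^{δ m})`. -/
structure IsCutoff (δ : ℝ) (M₀ : Set E2) (η : ℝ → E2 → ℝ) : Prop where
  smooth : ∀ k : ℝ, 1 < k → ContDiffOn ℝ ∞ (η k) M₀
  eq_zero : ∀ k : ℝ, 1 < k → ∀ q ∈ M₀,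
    Metric.infDist q (frontier M₀) < k ^ (-δ) → η k q = 0
  eq_one : ∀ k : ℝ, 1 < k → ∀ q ∈ M₀,
    2 * k ^ (-δ) < Metric.infDist q (frontier M₀) → η k q = 1
  deriv_bound : ∀ m : ℕ, ∃ C : ℝ, ∀ k : ℝ, 1 < k → ∀ q ∈ M₀,
    ‖iteratedFDeriv ℝ m (η k) q‖ ≤ C * k ^ (δ * m)

/-- The plane wave `e^{ik (α · r)}`. -/
def planeWave (k : ℝ) (α r : E3) : ℂ :=
  Complex.exp (Complex.I * (k * inner ℝ α r : ℝ))

/-- The outgoing spherical wave `e^{ik|r-q|} / |r-q|`. -/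
def sphericalWave (k : ℝ) (r q : E3) : ℂ :=
  Complex.exp (Complex.I * (k * ‖r - q‖ : ℝ)) / (‖r - q‖ : ℝ)

/-- Single layer potential with density `η e^{ik (α · q)}` on `M = τ(M₀)`. Since `τ` is an
isometry of the coordinate plane onto the plane of `M`, the surface element is `dq`. -/
def singleLayer (τ : E2 →ᵃⁱ[ℝ] E3) (M₀ : Set E2) (η : ℝ → E2 → ℝ) (α : E3)
    (k : ℝ) (r : E3) : ℂ :=
  ∫ q in M₀, (η k q : ℂ) * planeWave k α (τ q) * sphericalWave k r (τ q)

/-- Double layer potential with density `η e^{ik (α · q)}` on `M = τ(M₀)`; the kernel is the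
derivative of the spherical wave in the variable `q` in the direction `n`. -/
def doubleLayer (τ : E2 →ᵃⁱ[ℝ] E3) (M₀ : Set E2) (η : ℝ → E2 → ℝ) (α n : E3)
    (k : ℝ) (r : E3) : ℂ :=
  ∫ q in M₀, (η k q : ℂ) * planeWave k α (τ q) *
    fderiv ℝ (fun p : E3 => sphericalWave k r p) (τ q) n

/-- The reflection coefficient `(i n_α + Λ) / (i n_α - Λ)`, where `Λ` is the impedance. -/
def reflCoeff (α n : E3) (Λ : ℂ) : ℂ :=
  (Complex.I * (inner ℝ n α : ℝ) + Λ) / (Complex.I * (inner ℝ n α : ℝ) - Λ)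

/-- The Kirchhoff approximation for the polygon `M = τ(M₀)`. -/
def kirchhoff (τ : E2 →ᵃⁱ[ℝ] E3) (M₀ : Set E2) (η : ℝ → E2 → ℝ) (α n : E3) (Λ : ℂ)
    (k : ℝ) (r : E3) : ℂ :=
  Complex.I * k / (4 * Real.pi) * (reflCoeff α n Λ - 1) * (inner ℝ n α : ℝ) *
      singleLayer τ M₀ η α k r
    + (reflCoeff α n Λ + 1) / (4 * Real.pi) * doubleLayer τ M₀ η α n k r

/-- The direction `α* = α - 2 (α · n) n` of the reflected rays. -/
def reflDir (α n : E3) : E3 := α - (2 * inner ℝ α n : ℝ) • n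

/-- The region covered by the open rays that start on `M` in the direction `β`. -/
def rayZone (M : Set E3) (β : E3) : Set E3 :=
  {r | ∃ r₀ ∈ M, ∃ t : ℝ, 0 < t ∧ r = r₀ + t • β}

/-- The shadow zone. -/
def shadowZone (M : Set E3) (α : E3) : Set E3 := rayZone M α

/-- The reflected zone. -/
def reflectedZone (M : Set E3) (α n : E3) : Set E3 := rayZone M (reflDir α n)

/-- The region outside of the closure of the shadow and reflected zones. -/
def outerZone (M : Set E3) (α n : E3) : Set E3 :=
  (closure (reflectedZone M α n ∪ shadowZone M α))ᶜ

/-- The constant `t₀ = 2 (α · n) (n · r)`, the same for all points `r` of the plane of `M`. -/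
def phaseShift (τ : E2 →ᵃⁱ[ℝ] E3) (α n : E3) : ℝ := 2 * inner ℝ α n * inner ℝ n (τ 0)

open Classical in
/-- The eikonal approximation of the scattered field. -/
def eikonal (τ : E2 →ᵃⁱ[ℝ] E3) (M₀ : Set E2) (α n : E3) (Λ : ℂ) (k : ℝ) (r : E3) : ℂ :=
  if r ∈ shadowZone (τ '' M₀) α then -planeWave k α r
  else if r ∈ reflectedZone (τ '' M₀) α n then
    reflCoeff α n Λ *
      Complex.exp (Complex.I * (k * (inner ℝ (reflDir α n) r + phaseShift τ α n) : ℝ))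
  else 0

/-- The functions `f`, `g` and their gradients have limits at `r` from within the region `Z`;
the limits of `f`, `g` differ by at most `a` and those of the gradients by at most `b`.
At a point of an open `Z` where the functions are `C¹` the limits are just the values. -/
def OneSidedClose (Z : Set E3) (f g : E3 → ℂ) (r : E3) (a b : ℝ) : Prop :=
  ∃ (u v : ℂ) (U V : E3 →L[ℝ] ℂ),
    Tendsto f (𝓝[Z] r) (𝓝 u) ∧ Tendsto g (𝓝[Z] r) (𝓝 v) ∧
    Tendsto (fderiv ℝ f) (𝓝[Z] r) (𝓝 U) ∧ Tendsto (fderiv ℝ g) (𝓝[Z] r) (𝓝 V) ∧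
    ‖u - v‖ ≤ a ∧ ‖U - V‖ ≤ b

end KirchhoffPolygon

end

/-! On the side of the plane towards a unit normal ν = ±n, write a point as `τ x + z • ν` with z >
0. Let a be the tangential part of α and c = -n·α, so |a|² + c² = 1. Up to the factor e^{ik a·x},
the single layer integrates the cut-off against e^{ik(a·y + s)}/s, where s = √(|y|² + z²). A Lorentz
boost of the hyperboloid s² - |y|² = z² preserves dy/s and turns the phase s + a·y into cs
(`integral_boost`). In polar coordinates the layer then becomes exactly a one-dimensional integral
of e^{ikc(z+σ)} p over σ ≥ 0, where p is the mean of the cut-off over an ellipse centred at x -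
(z+σ)a/c with size w = √(σ(σ+2z)) (`integral_wave_eq_ringIntegral`).

The mean p is even in w, so w⁻¹∂p/∂w is smooth and the derivative of p along the curve has no
singularity, uniformly as z tends to 0. Each integration by parts in σ gains k⁻¹ and costs at most
two derivatives of the cut-off, that is k^{2δ}; since δ < 1/2 the expansion improves at every step.
Its boundary terms sit at σ = 0, where the ellipse shrinks to x - za/c, the base of the ray through
the observation point. This gives the bound `IsRaySymbol.ringIntegral_bound` everywhere. Where the
cut-off is constant near the base, every boundary term but the first vanishes, and the error is
smaller than any power of k (`IsRaySymbol.ringIntegral_asymp`).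

Gradients reduce to the same estimates. The normal derivative of the one-dimensional integral is a
boundary term plus an integral of the same type (`hasDerivAt_ringIntegral`). A tangential derivative
moves onto the density, where it either differentiates the cut-off or produces the factor ik a·e
(`layer_dirDeriv_tangent`, `fderiv_field_tangent`).

For kβ times the single layer plus γ times the layer of the normal derivative of the kernel, the
leading term is 2π(iβ/c - γ) times the plane wave that continues the incident phase off the plane.
The Kirchhoff coefficients give the amplitude A on the side of n and -1 on the other side
(`reflected_amplitude`, `shadow_amplitude`). Away from the boundaries of the zones the ray bases
keep a positive distance from ∂M, so for large k the cut-off is constantly 0 or 1 near them. The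
one-dimensional formulas are continuous down to z = 0, which yields the one-sided limits. -/

noncomputable section

namespace KirchhoffPolygon

/-! ### Smooth dependence of interval integrals on a parameter -/

section Parametric

variable {E F : Type} [NormedAddCommGroup E] [NormedSpace ℝ E] [ProperSpace E]
  [NormedAddCommGroup F] [NormedSpace ℝ F]

theorem hasFDerivAt_integral_of_contDiff {f : E × ℝ → F} (hf : ContDiff ℝ 1 f) (a b : ℝ) (x : E) :
    HasFDerivAt (fun x => ∫ t in a..b, f (x, t))
      (∫ t in a..b, (fderiv ℝ f (x, t)).comp (ContinuousLinearMap.inl ℝ E ℝ)) x := by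
  have hc : Continuous fun v : E × ℝ => (fderiv ℝ f v).comp (ContinuousLinearMap.inl ℝ E ℝ) :=
    (hf.continuous_fderiv one_ne_zero).clm_comp continuous_const
  obtain ⟨B, hB⟩ := ((isCompact_closedBall x 1).prod (isCompact_uIcc (a := a) (b := b))).exists_bound_of_continuousOn
    hc.continuousOn
  have hfc := hf.continuous
  refine intervalIntegral.hasFDerivAt_integral_of_dominated_of_fderiv_le (s := Metric.ball x 1)
    (F := fun x t => f (x, t))
    (F' := fun x t => (fderiv ℝ f (x, t)).comp (ContinuousLinearMap.inl ℝ E ℝ))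
    (bound := fun _ => B) (Metric.ball_mem_nhds x one_pos) ?_ ?_ ?_ ?_ ?_ ?_
  · exact Eventually.of_forall fun y =>
      (by fun_prop : Continuous fun t => f (y, t)).aestronglyMeasurable
  · exact (by fun_prop : Continuous fun t => f (x, t)).intervalIntegrable _ _
  · exact (hc.comp (by fun_prop : Continuous fun t : ℝ => (x, t))).aestronglyMeasurable
  · refine Eventually.of_forall fun t ht y hy => hB (y, t) ⟨Metric.ball_subset_closedBall hy, ?_⟩
    exact Set.uIoc_subset_uIcc ht
  · exact intervalIntegrable_const
  · refine Eventually.of_forall fun t _ y _ => ?_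
    have h1 : HasFDerivAt f (fderiv ℝ f (y, t)) (y, t) :=
      (hf.differentiable one_ne_zero _).hasFDerivAt
    exact h1.comp y (hasFDerivAt_prodMk_left y t)

/-- The derivative is again an integral of a smooth integrand, now with values in a space of
operators; the target space therefore has to vary within the induction. -/
theorem contDiff_integral_of_contDiff_nat (n : ℕ) : ∀ {F : Type} [NormedAddCommGroup F]
    [NormedSpace ℝ F] {f : E × ℝ → F}, ContDiff ℝ ∞ f → ∀ a b : ℝ,
    ContDiff ℝ n (fun x => ∫ t in a..b, f (x, t)) := by
  induction n with
  | zero =>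
    intro F _ _ f hf a b
    refine contDiff_zero.2 ?_
    have h := hf.continuous
    exact intervalIntegral.continuous_parametric_intervalIntegral_of_continuous' (f := fun x t => f (x, t)) h a b
  | succ n ih =>
    intro F _ _ f hf a b
    have hd := hasFDerivAt_integral_of_contDiff (hf.of_le (by norm_cast)) a b
    push_cast
    rw [contDiff_succ_iff_fderiv]
    refine ⟨fun x => (hd x).differentiableAt, by simp, ?_⟩
    rw [show fderiv ℝ (fun x => ∫ t in a..b, f (x, t)) = _ from funext fun x => (hd x).fderiv]
    exact ih (f := fun v => (fderiv ℝ f v).comp (ContinuousLinearMap.inl ℝ E ℝ))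
      ((hf.fderiv_right (m := ∞) (by simp)).clm_comp contDiff_const) a b

theorem contDiff_integral_of_contDiff {f : E × ℝ → F} (hf : ContDiff ℝ ∞ f) (a b : ℝ) :
    ContDiff ℝ ∞ (fun x => ∫ t in a..b, f (x, t)) :=
  contDiff_infty.2 fun n => contDiff_integral_of_contDiff_nat n hf a b

theorem norm_iteratedFDeriv_integral_le (m : ℕ) : ∀ {F : Type} [NormedAddCommGroup F]
    [NormedSpace ℝ F] {f : E × ℝ → F}, ContDiff ℝ ∞ f → ∀ (a b : ℝ) (x : E) (B : ℝ),
    (∀ t ∈ Set.uIoc a b, ‖iteratedFDeriv ℝ m (fun x => f (x, t)) x‖ ≤ B) →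
    ‖iteratedFDeriv ℝ m (fun x => ∫ t in a..b, f (x, t)) x‖ ≤ B * |b - a| := by
  induction m with
  | zero =>
    intro F _ _ f hf a b x B h
    simp only [norm_iteratedFDeriv_zero] at h ⊢
    exact intervalIntegral.norm_integral_le_of_norm_le_const h
  | succ m ih =>
    intro F _ _ f hf a b x B h
    have hd := hasFDerivAt_integral_of_contDiff (hf.of_le (by norm_cast)) a b
    rw [← norm_iteratedFDeriv_fderiv,
      show fderiv ℝ (fun x => ∫ t in a..b, f (x, t)) = _ from funext fun x => (hd x).fderiv]
    refine ih (f := fun v => (fderiv ℝ f v).comp (ContinuousLinearMap.inl ℝ E ℝ))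
      ((hf.fderiv_right (m := ∞) (by simp)).clm_comp contDiff_const) a b x B fun t ht => ?_
    have h1 : (fun x => (fderiv ℝ f (x, t)).comp (ContinuousLinearMap.inl ℝ E ℝ))
        = fderiv ℝ (fun x => f (x, t)) := by
      ext1 y
      have h1 : HasFDerivAt f (fderiv ℝ f (y, t)) (y, t) :=
        (hf.differentiable (by simp) _).hasFDerivAt
      exact (h1.comp y (hasFDerivAt_prodMk_left y t)).fderiv.symm
    rw [h1, norm_iteratedFDeriv_fderiv]
    exact h t ht

end Parametric

/-! ### Calculus of symbols whose derivatives grow by powers of k^δ -/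

section Symbol

variable {E E' : Type} [NormedAddCommGroup E] [NormedSpace ℝ E]
  [NormedAddCommGroup E'] [NormedSpace ℝ E']

/-- A family `p k`, `k > 1`, of smooth functions whose derivatives of order `m` are
`O(k^{δ(N+m)})` on `Ω`. -/
structure IsSymbol (δ : ℝ) (Ω : Set E) (N : ℝ) (p : ℝ → E → ℂ) : Prop where
  smooth : ∀ k : ℝ, 1 < k → ContDiff ℝ ∞ (p k)
  bound : ∀ m : ℕ, ∃ C : ℝ, ∀ k : ℝ, 1 < k → ∀ v ∈ Ω,
    ‖iteratedFDeriv ℝ m (p k) v‖ ≤ C * k ^ (δ * (N + m))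

/-- The derivative of `p` in the direction `e`. -/
def dirDeriv (e : E) (p : E → ℂ) : E → ℂ := fun v => fderiv ℝ p v e

theorem ContDiff.dirDeriv {p : E → ℂ} (hp : ContDiff ℝ ∞ p) (e : E) :
    ContDiff ℝ ∞ (dirDeriv e p) :=
  (hp.fderiv_right (m := ∞) (by simp)).clm_apply contDiff_const

theorem norm_iteratedFDeriv_dirDeriv_le {p : E → ℂ} (hp : ContDiff ℝ ∞ p) (e : E) (m : ℕ) (v : E) :
    ‖iteratedFDeriv ℝ m (dirDeriv e p) v‖ ≤ ‖e‖ * ‖iteratedFDeriv ℝ (m + 1) p v‖ := by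
  rw [← norm_iteratedFDeriv_fderiv]
  exact norm_iteratedFDeriv_clm_apply_const
    (hp.fderiv_right (m := ∞) (by simp)).contDiffAt (by norm_cast; exact le_top)

theorem norm_iteratedFDeriv_comp_affine_le {p : E → ℂ} (hp : ContDiff ℝ ∞ p) (y : E)
    (l : E' →L[ℝ] E) (m : ℕ) (v : E') :
    ‖iteratedFDeriv ℝ m (fun v => p (y + l v)) v‖ ≤
      ‖iteratedFDeriv ℝ m p (y + l v)‖ * ‖l‖ ^ m := by
  have h := l.iteratedFDeriv_comp_right (f := fun u => p (y + u))
    (hp.comp (contDiff_const.add contDiff_id)) v (i := m) (by norm_cast; exact le_top)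
  have h2 : iteratedFDeriv ℝ m (fun u => p (y + u)) (l v) = iteratedFDeriv ℝ m p (y + l v) := by
    rw [iteratedFDeriv_comp_add_left]
  have h3 : (fun v => p (y + l v)) = (fun u => p (y + u)) ∘ l := rfl
  rw [h3, h, h2]
  refine (ContinuousMultilinearMap.norm_compContinuousLinearMap_le _ _).trans ?_
  simp

variable {δ : ℝ} {Ω : Set E} {N : ℝ}

theorem IsSymbol.exists_nonneg {p : ℝ → E → ℂ} (hp : IsSymbol δ Ω N p) (m : ℕ) :
    ∃ C : ℝ, 0 ≤ C ∧ ∀ k : ℝ, 1 < k → ∀ v ∈ Ω,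
      ‖iteratedFDeriv ℝ m (p k) v‖ ≤ C * k ^ (δ * (N + m)) := by
  obtain ⟨C, hC⟩ := hp.bound m
  refine ⟨max C 0, le_max_right _ _, fun k hk v hv => (hC k hk v hv).trans ?_⟩
  have : 0 < k := by linarith
  gcongr
  exact le_max_left _ _

theorem IsSymbol.add {p q : ℝ → E → ℂ} (hp : IsSymbol δ Ω N p) (hq : IsSymbol δ Ω N q) :
    IsSymbol δ Ω N (fun k v => p k v + q k v) where
  smooth k hk := (hp.smooth k hk).add (hq.smooth k hk)
  bound m := by
    obtain ⟨C, hC⟩ := hp.bound m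
    obtain ⟨C', hC'⟩ := hq.bound m
    refine ⟨C + C', fun k hk v hv => ?_⟩
    have h : iteratedFDeriv ℝ m (fun v => p k v + q k v) v
        = iteratedFDeriv ℝ m (p k) v + iteratedFDeriv ℝ m (q k) v :=
      iteratedFDeriv_add_apply ((hp.smooth k hk).of_le (by norm_cast; exact le_top)).contDiffAt
        ((hq.smooth k hk).of_le (by norm_cast; exact le_top)).contDiffAt
    rw [h, add_mul]
    exact (norm_add_le _ _).trans (add_le_add (hC k hk v hv) (hC' k hk v hv))

theorem IsSymbol.mono_order {p : ℝ → E → ℂ} (hp : IsSymbol δ Ω N p) (hδ : 0 ≤ δ) {N' : ℝ}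
    (h : N ≤ N') : IsSymbol δ Ω N' p where
  smooth := hp.smooth
  bound m := by
    obtain ⟨C, hC0, hC⟩ := hp.exists_nonneg m
    refine ⟨C, fun k hk v hv => (hC k hk v hv).trans ?_⟩
    have := hk.le
    gcongr

theorem IsSymbol.dirDeriv {p : ℝ → E → ℂ} (hp : IsSymbol δ Ω N p) (e : E) :
    IsSymbol δ Ω (N + 1) (fun k => dirDeriv e (p k)) where
  smooth k hk := ContDiff.dirDeriv (hp.smooth k hk) e
  bound m := by
    obtain ⟨C, hC0, hC⟩ := hp.exists_nonneg (m + 1)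
    refine ⟨‖e‖ * C, fun k hk v hv => ?_⟩
    refine (norm_iteratedFDeriv_dirDeriv_le (hp.smooth k hk) e m v).trans ?_
    rw [mul_assoc]
    refine mul_le_mul_of_nonneg_left ((hC k hk v hv).trans_eq ?_) (norm_nonneg _)
    push_cast
    ring_nf

/-- In the Leibniz formula a linear form that is bounded on Ω contributes bounded derivatives of
every order, so multiplication by it does not raise the order of the symbol. -/
theorem IsSymbol.clm_mul {p : ℝ → E → ℂ} (hp : IsSymbol δ Ω N p) (hδ : 0 ≤ δ) (l : E →L[ℝ] ℝ) {S : ℝ}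
    (hl : ∀ v ∈ Ω, |l v| ≤ S) : IsSymbol δ Ω N (fun k v => (l v : ℂ) * p k v) where
  smooth k hk := by
    have := hp.smooth k hk
    have h2 : ContDiff ℝ ∞ fun v => ((l v : ℝ) : ℂ) :=
      Complex.ofRealCLM.contDiff.comp l.contDiff
    exact h2.mul this
  bound m := by
    choose C hC0 hC using fun m => hp.exists_nonneg m
    have hl' : ∀ j : ℕ, ∃ B, 0 ≤ B ∧ ∀ v ∈ Ω, ‖iteratedFDeriv ℝ j l v‖ ≤ B := by
      intro j
      match j with
      | 0 => exact ⟨|S|, abs_nonneg _, fun v hv => by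
          simpa using (hl v hv).trans (le_abs_self S)⟩
      | j + 1 =>
        refine ⟨‖iteratedFDeriv ℝ j (fderiv ℝ l) 0‖, norm_nonneg _, fun v hv => ?_⟩
        have : fderiv ℝ l = fun _ => l := by ext1 v; exact l.fderiv
        rw [← norm_iteratedFDeriv_fderiv, this]
        match j with
        | 0 => simp
        | j + 1 => simp [iteratedFDeriv_succ_const]
    choose B hB0 hB using hl'
    refine ⟨∑ i ∈ Finset.range (m + 1), (m.choose i) * B i * C (m - i), fun k hk v hv => ?_⟩
    have h1 : (fun v => (l v : ℂ) * p k v) = fun v => l v • p k v := by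
      ext1 v; simp
    rw [h1]
    refine (norm_iteratedFDeriv_smul_le (N := ∞) l.contDiff (hp.smooth k hk) v
      (by norm_cast; exact le_top)).trans ?_
    rw [Finset.sum_mul]
    refine Finset.sum_le_sum fun i hi => ?_
    -- Since k > 1 and δ ≥ 0, derivatives of lower order obey the bound with the exponent of order
    -- m.
    have h2 : ‖iteratedFDeriv ℝ (m - i) (p k) v‖ ≤ C (m - i) * k ^ (δ * (N + m)) := by
      refine (hC (m - i) k hk v hv).trans ?_
      have := hC0 (m - i)
      have := hk.le
      have h3 : ((m - i : ℕ) : ℝ) ≤ m := by exact_mod_cast Nat.sub_le m i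
      gcongr
    rw [mul_assoc (_ * B i)]
    refine mul_le_mul ?_ h2 (norm_nonneg _) (by have := hB0 i; positivity)
    exact mul_le_mul_of_nonneg_left (hB i v hv) (by positivity)

/-- Averages over a parameter interval of symbols composed with affine maps. -/
theorem IsSymbol.integral_comp [ProperSpace E'] {p : ℝ → E → ℂ} (hp : IsSymbol δ Ω N p) {Ω' : Set E'}
    (l : ℝ → E' →L[ℝ] E) (hl : ContDiff ℝ ∞ fun v : E' × ℝ => l v.2 v.1) {B : ℝ} (a b : ℝ)
    (hB : ∀ t ∈ Set.uIoc a b, ‖l t‖ ≤ B)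
    (hΩ : ∀ v ∈ Ω', ∀ t ∈ Set.uIoc a b, l t v ∈ Ω) :
    IsSymbol δ Ω' N (fun k v => ∫ t in a..b, p k (l t v)) where
  smooth k hk := contDiff_integral_of_contDiff (f := fun v : E' × ℝ => p k (l v.2 v.1))
    ((hp.smooth k hk).comp hl) a b
  bound m := by
    obtain ⟨C, hC0, hC⟩ := hp.exists_nonneg m
    refine ⟨C * B ^ m * |b - a|, fun k hk v hv => ?_⟩
    refine (norm_iteratedFDeriv_integral_le m (f := fun v : E' × ℝ => p k (l v.2 v.1))
      ((hp.smooth k hk).comp hl) a b v (C * k ^ (δ * (N + m)) * B ^ m) fun t ht => ?_).trans_eq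
        (by ring)
    have h := norm_iteratedFDeriv_comp_affine_le (hp.smooth k hk) 0 (l t) m v
    simp only [zero_add] at h
    refine h.trans ?_
    have := hB t ht
    have := (norm_nonneg _).trans this
    have := hC k hk _ (hΩ v hv t ht)
    gcongr

end Symbol

/-! ### Functions even in the radius and the operator w⁻¹∂/∂w -/

/-- Coordinates `((s, y), w)`: arc parameter, position in the plane and radius. -/
abbrev RaySpace := (ℝ × E2) × ℝ

/-- The unit vector of the radius axis. -/
def radial : RaySpace := ((0, 0), 1)

/-- For a function `p` that is even in the radius `w` this is `w⁻¹ ∂p/∂w`. -/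
def radialQuot (p : RaySpace → ℂ) : RaySpace → ℂ :=
  fun v => ∫ t in (0 : ℝ)..1, dirDeriv radial (dirDeriv radial p) (v.1, t * v.2)

/-- The direction of the rays over the plane. -/
def rayDir (b : E2) : RaySpace := ((1, -b), 0)

/-- The derivative along the curves `ringPoint`, for functions that are even in the radius. -/
def transport (b : E2) (p : RaySpace → ℂ) : RaySpace → ℂ :=
  fun v => dirDeriv (rayDir b) p v + (v.1.1 : ℂ) * radialQuot p v

/-- A function is even in the radius. -/
def IsEven (p : RaySpace → ℂ) : Prop := ∀ v : RaySpace, p (v.1, -v.2) = p v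

/-- The scaling of the radius by `t`. -/
def scaleRadius (t : ℝ) : RaySpace →L[ℝ] RaySpace :=
  (ContinuousLinearMap.fst ℝ (ℝ × E2) ℝ).prod (t • ContinuousLinearMap.snd ℝ (ℝ × E2) ℝ)

theorem scaleRadius_apply (t : ℝ) (v : RaySpace) : scaleRadius t v = (v.1, t * v.2) := rfl

theorem norm_scaleRadius_le {t : ℝ} (ht : |t| ≤ 1) : ‖scaleRadius t‖ ≤ 1 := by
  refine ContinuousLinearMap.opNorm_le_bound _ zero_le_one fun v => ?_
  rw [scaleRadius_apply, one_mul, Prod.norm_def, Prod.norm_def]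
  refine max_le_max le_rfl ?_
  rw [norm_mul]
  exact mul_le_of_le_one_left (norm_nonneg _) ht

theorem contDiff_scaleRadius : ContDiff ℝ ∞ fun v : RaySpace × ℝ => scaleRadius v.2 v.1 := by
  simp only [scaleRadius_apply]
  fun_prop

theorem contDiff_radialQuot {p : RaySpace → ℂ} (hp : ContDiff ℝ ∞ p) :
    ContDiff ℝ ∞ (radialQuot p) :=
  contDiff_integral_of_contDiff
    (f := fun v : RaySpace × ℝ => dirDeriv radial (dirDeriv radial p) (scaleRadius v.2 v.1))
    ((ContDiff.dirDeriv (ContDiff.dirDeriv hp _) _).comp contDiff_scaleRadius) 0 1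

theorem contDiff_transport {p : RaySpace → ℂ} (hp : ContDiff ℝ ∞ p) (b : E2) :
    ContDiff ℝ ∞ (transport b p) := by
  refine (ContDiff.dirDeriv hp _).add (ContDiff.mul ?_ (contDiff_radialQuot hp))
  exact Complex.ofRealCLM.contDiff.comp (contDiff_fst.comp contDiff_fst)

theorem dirDeriv_scaleRadius {p : RaySpace → ℂ} (hp : ContDiff ℝ ∞ p) (t : ℝ) (e v : RaySpace) :
    dirDeriv e (fun v => p (scaleRadius t v)) v = dirDeriv (scaleRadius t e) p (scaleRadius t v) := by
  have h : HasFDerivAt p (fderiv ℝ p (scaleRadius t v)) (scaleRadius t v) :=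
    (hp.differentiable (by simp) _).hasFDerivAt
  have h2 := h.comp v (scaleRadius t).hasFDerivAt
  unfold dirDeriv
  rw [show (fun v => p (scaleRadius t v)) = p ∘ scaleRadius t from rfl, h2.fderiv]
  rfl

theorem isEven_iff {p : RaySpace → ℂ} : IsEven p ↔ (fun v => p (scaleRadius (-1) v)) = p := by
  simp [IsEven, funext_iff, scaleRadius_apply]

theorem scaleRadius_radial (t : ℝ) : scaleRadius t radial = t • radial := by
  simp [scaleRadius_apply, radial]

theorem scaleRadius_rayDir (t : ℝ) (b : E2) : scaleRadius t (rayDir b) = rayDir b := by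
  simp [scaleRadius_apply, rayDir]

theorem dirDeriv_smul (t : ℝ) (e : RaySpace) (p : RaySpace → ℂ) (v : RaySpace) :
    dirDeriv (t • e) p v = t • dirDeriv e p v := by simp [dirDeriv]

theorem IsEven.dirDeriv_radial {p : RaySpace → ℂ} (hp : ContDiff ℝ ∞ p) (he : IsEven p)
    (v : RaySpace) : dirDeriv radial p (scaleRadius (-1) v) = -dirDeriv radial p v := by
  have h := dirDeriv_scaleRadius hp (-1) radial v
  rw [isEven_iff.1 he, scaleRadius_radial, dirDeriv_smul] at h
  rw [h]; simp

theorem IsEven.dirDeriv_radial_radial {p : RaySpace → ℂ} (hp : ContDiff ℝ ∞ p) (he : IsEven p)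
    (v : RaySpace) : dirDeriv radial (dirDeriv radial p) (scaleRadius (-1) v) =
      dirDeriv radial (dirDeriv radial p) v := by
  have h := dirDeriv_scaleRadius (ContDiff.dirDeriv hp radial) (-1) radial v
  have h2 : (fun v => dirDeriv radial p (scaleRadius (-1) v)) = fun v => -dirDeriv radial p v :=
    funext fun v => he.dirDeriv_radial hp v
  rw [h2, scaleRadius_radial, dirDeriv_smul] at h
  have h3 : dirDeriv radial (fun v => -dirDeriv radial p v) v
      = -dirDeriv radial (dirDeriv radial p) v := by
    simp only [dirDeriv]
    rw [show (fun v => -((fderiv ℝ p v) radial)) = -(fun v => (fderiv ℝ p v) radial) from rfl,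
      fderiv_neg]
    rfl
  rw [h3] at h
  simpa using h.symm

theorem IsEven.radialQuot {p : RaySpace → ℂ} (hp : ContDiff ℝ ∞ p) (he : IsEven p) :
    IsEven (radialQuot p) := by
  intro v
  refine intervalIntegral.integral_congr fun t _ => ?_
  have h := he.dirDeriv_radial_radial hp (v.1, t * v.2)
  simp only [scaleRadius_apply] at h
  simpa using h

/-- Evenness survives, which is what allows the integration by parts to be iterated. -/
theorem IsEven.transport {p : RaySpace → ℂ} (hp : ContDiff ℝ ∞ p) (he : IsEven p) (b : E2) :
    IsEven (transport b p) := by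
  intro v
  have h := dirDeriv_scaleRadius hp (-1) (rayDir b) v
  rw [isEven_iff.1 he, scaleRadius_rayDir, scaleRadius_apply] at h
  have h2 := (he.radialQuot hp) v
  simp only [neg_mul, one_mul] at h
  simp only [KirchhoffPolygon.transport, h, h2]

/-- The radial derivative of an even function is odd, so it vanishes at radius zero; the fundamental
theorem of calculus along the segment t ↦ t w then exhibits the factor w. -/
theorem IsEven.dirDeriv_radial_eq {p : RaySpace → ℂ} (hp : ContDiff ℝ ∞ p) (he : IsEven p)
    (v : RaySpace) : dirDeriv radial p v = v.2 * KirchhoffPolygon.radialQuot p v := by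
  set q := dirDeriv radial p with hq
  have hqc : ContDiff ℝ ∞ q := ContDiff.dirDeriv hp radial
  have h0 : q (v.1, 0) = 0 := by
    have h := he.dirDeriv_radial hp (v.1, 0)
    simp only [scaleRadius_apply, mul_zero] at h
    exact self_eq_neg.1 h
  have hd : ∀ t ∈ Set.uIcc (0 : ℝ) 1, HasDerivAt (fun t : ℝ => q (v.1, t * v.2))
      (v.2 * dirDeriv radial q (v.1, t * v.2)) t := by
    intro t _
    have h1 : HasDerivAt (fun t : ℝ => ((v.1, t * v.2) : RaySpace)) (v.2 • radial) t := by
      have h2 : HasDerivAt (fun t : ℝ => t * v.2) v.2 t := by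
        simpa using (hasDerivAt_id t).mul_const v.2
      convert (hasDerivAt_const t v.1).prodMk h2 using 1
      simp [radial]
    have h2 := ((hqc.differentiable (by simp) (v.1, t * v.2)).hasFDerivAt).comp_hasDerivAt t h1
    refine h2.congr_deriv ?_
    simp [dirDeriv]
  have hc : Continuous fun t : ℝ => v.2 * dirDeriv radial q (v.1, t * v.2) := by
    have := (ContDiff.dirDeriv hqc radial).continuous
    fun_prop
  have h := intervalIntegral.integral_eq_sub_of_hasDerivAt hd (hc.intervalIntegrable _ _)
  rw [intervalIntegral.integral_const_mul] at h
  simp only [one_mul, zero_mul, h0, sub_zero] at h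
  exact h.symm

/-! ### Curves of ellipses and the oscillatory integral along them -/

/-- The point with parameter `z + σ` on the curve over `x` at height `z`. -/
def ringPoint (b x : E2) (z σ : ℝ) : RaySpace :=
  ((z + σ, x - (z + σ) • b), √(σ * (σ + 2 * z)))

theorem ringPoint_zero (b x : E2) (z : ℝ) : ringPoint b x z 0 = ((z, x - z • b), 0) := by
  simp [ringPoint]

theorem continuous_ringPoint (b : E2) :
    Continuous fun v : (E2 × ℝ) × ℝ => ringPoint b v.1.1 v.1.2 v.2 := by
  unfold ringPoint
  fun_prop

/-- The chain rule produces the singular factor 1/√f, but the radial derivative of an even function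
carries the factor w = √f, which cancels it. Nothing in the result degenerates as f tends to 0. -/
theorem hasDerivAt_sqrt_mul {f : ℝ → ℝ} {f' t : ℝ} (hf : HasDerivAt f f' t) (h0 : 0 < f t) {p : RaySpace → ℂ}
    (hp : ContDiff ℝ ∞ p) (he : IsEven p) {y : ℝ → ℝ × E2} {y' : ℝ × E2} (hy : HasDerivAt y y' t) :
    HasDerivAt (fun t => p (y t, √(f t)))
      (dirDeriv (y', 0) p (y t, √(f t)) + ((f' / 2 : ℝ) : ℂ) * radialQuot p (y t, √(f t))) t := by
  have h1 := hf.sqrt h0.ne'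
  have h2 := ((hp.differentiable (by simp) (y t, √(f t))).hasFDerivAt).comp_hasDerivAt t
    (hy.prodMk h1)
  refine h2.congr_deriv ?_
  have h3 : ((y', f' / (2 * √(f t))) : RaySpace) = (y', 0) + (f' / (2 * √(f t))) • radial := by
    simp [radial]
  have h4 := he.dirDeriv_radial_eq hp (y t, √(f t))
  rw [h3, map_add, map_smul]
  change _ + _ • dirDeriv radial p _ = _
  rw [h4]
  simp only [Complex.real_smul, ← mul_assoc, ← Complex.ofReal_mul]
  have : √(f t) ≠ 0 := (Real.sqrt_pos.2 h0).ne'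
  congr 3
  field_simp

/-- The squared radius σ(σ+2z) = (z+σ)² - z² has σ-derivative 2(z+σ), twice the arc coordinate. The
derivative is therefore a function on `RaySpace` that does not mention z separately. -/
theorem hasDerivAt_ringPoint_param {p : RaySpace → ℂ} (hp : ContDiff ℝ ∞ p) (he : IsEven p)
    (b x : E2) {z σ : ℝ} (hz : 0 ≤ z) (hσ : 0 < σ) :
    HasDerivAt (fun σ => p (ringPoint b x z σ)) (transport b p (ringPoint b x z σ)) σ := by
  have h1 : HasDerivAt (fun σ => σ * (σ + 2 * z)) (2 * (z + σ)) σ := by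
    refine ((hasDerivAt_id σ).mul ((hasDerivAt_id σ).add_const (2 * z))).congr_deriv ?_
    simp; ring
  have h3 : HasDerivAt (fun σ => z + σ) 1 σ := (hasDerivAt_id σ).const_add z
  have h2 : HasDerivAt (fun σ => ((z + σ, x - (z + σ) • b) : ℝ × E2)) (1, -b) σ := by
    refine h3.prodMk ?_
    simpa using (h3.smul_const b).const_sub x
  refine (hasDerivAt_sqrt_mul h1 (by positivity) hp he h2).congr_deriv ?_
  simp only [transport, ringPoint, rayDir]
  congr 3
  ring

/-- The squared radius now has derivative 2σ instead of 2(z+σ). Hence this derivative differs from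
the one in σ by z times the radial quotient only. -/
theorem hasDerivAt_ringPoint_height {p : RaySpace → ℂ} (hp : ContDiff ℝ ∞ p) (he : IsEven p)
    (b x : E2) {z σ : ℝ} (hz : 0 < z) (hσ : 0 < σ) :
    HasDerivAt (fun z => p (ringPoint b x z σ)) (dirDeriv (rayDir b) p (ringPoint b x z σ) +
      (σ : ℂ) * radialQuot p (ringPoint b x z σ)) z := by
  have h1 : HasDerivAt (fun z => σ * (σ + 2 * z)) (2 * σ) z := by
    refine (((hasDerivAt_id z).const_mul 2).const_add σ |>.const_mul σ).congr_deriv ?_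
    simp; ring
  have h3 : HasDerivAt (fun z => z + σ) 1 z := (hasDerivAt_id z).add_const σ
  have h2 : HasDerivAt (fun z => ((z + σ, x - (z + σ) • b) : ℝ × E2)) (1, -b) z := by
    refine h3.prodMk ?_
    simpa using (h3.smul_const b).const_sub x
  refine (hasDerivAt_sqrt_mul h1 (by positivity) hp he h2).congr_deriv ?_
  simp only [ringPoint, rayDir]
  congr 3
  ring

/-- The oscillatory integral along the curve over `x` at height `z`. -/
def ringIntegral (κ S : ℝ) (b : E2) (p : RaySpace → ℂ) (x : E2) (z : ℝ) : ℂ :=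
  ∫ σ in (0 : ℝ)..S, Complex.exp (Complex.I * (κ * (z + σ) : ℝ)) * p (ringPoint b x z σ)

theorem continuous_ringIntegrand (κ : ℝ) (b : E2) {p : RaySpace → ℂ} (hp : Continuous p) :
    Continuous fun v : (E2 × ℝ) × ℝ =>
      Complex.exp (Complex.I * (κ * (v.1.2 + v.2) : ℝ)) * p (ringPoint b v.1.1 v.1.2 v.2) := by
  have := continuous_ringPoint b
  fun_prop

theorem continuous_ringIntegral (κ S : ℝ) (b : E2) {p : RaySpace → ℂ} (hp : Continuous p) :
    Continuous fun v : E2 × ℝ => ringIntegral κ S b p v.1 v.2 :=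
  intervalIntegral.continuous_parametric_intervalIntegral_of_continuous'
    (f := fun (v : E2 × ℝ) (σ : ℝ) =>
      Complex.exp (Complex.I * (κ * (v.2 + σ) : ℝ)) * p (ringPoint b v.1 v.2 σ))
    (continuous_ringIntegrand κ b hp) 0 S

theorem continuous_ringIntegrand_right (κ : ℝ) (b : E2) {p : RaySpace → ℂ} (hp : Continuous p)
    (x : E2) (z : ℝ) : Continuous fun σ : ℝ =>
      Complex.exp (Complex.I * (κ * (z + σ) : ℝ)) * p (ringPoint b x z σ) :=
  (continuous_ringIntegrand κ b hp).comp (by fun_prop : Continuous fun σ : ℝ => ((x, z), σ))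

theorem hasDerivAt_exp_phase (κ t : ℝ) {f : ℝ → ℝ} (hf : HasDerivAt f 1 t) :
    HasDerivAt (fun t => Complex.exp (Complex.I * (κ * f t : ℝ)))
      (Complex.I * κ * Complex.exp (Complex.I * (κ * f t : ℝ))) t := by
  have h1 := ((hf.const_mul κ).ofReal_comp.const_mul Complex.I).cexp
  refine h1.congr_deriv ?_
  simp; ring

/-- Fundamental theorem of calculus for e^{iκ(z+σ)} p along the curve: the far end contributes
nothing by `h0`, and at σ = 0 the radius is zero. -/
theorem ringIntegral_boundary {κ S : ℝ} {b x : E2} {p : RaySpace → ℂ} {z : ℝ}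
    (hp : ContDiff ℝ ∞ p) (he : IsEven p) (hz : 0 ≤ z) (hS : 0 ≤ S)
    (h0 : p (ringPoint b x z S) = 0) :
    Complex.I * κ * ringIntegral κ S b p x z + ringIntegral κ S b (transport b p) x z =
      -(Complex.exp (Complex.I * (κ * z : ℝ)) * p ((z, x - z • b), 0)) := by
  have hc1 := continuous_ringIntegrand_right κ b hp.continuous x z
  have hc2 := continuous_ringIntegrand_right κ b (contDiff_transport hp b).continuous x z
  have h := intervalIntegral.integral_eq_sub_of_hasDerivAt_of_le hS hc1.continuousOn
    (f' := fun σ => Complex.I * κ * (Complex.exp (Complex.I * (κ * (z + σ) : ℝ)) *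
        p (ringPoint b x z σ)) + Complex.exp (Complex.I * (κ * (z + σ) : ℝ)) *
          transport b p (ringPoint b x z σ)) (fun σ hσ => ?_) ?_
  · rw [intervalIntegral.integral_add ((hc1.const_mul _).intervalIntegrable _ _)
      (hc2.intervalIntegrable _ _), intervalIntegral.integral_const_mul] at h
    rw [ringIntegral, ringIntegral, h, h0, ringPoint_zero]
    simp
  · have h1 := hasDerivAt_exp_phase κ σ ((hasDerivAt_id σ).const_add z)
    have h2 := h1.mul (hasDerivAt_ringPoint_param hp he b x hz hσ.1)
    refine h2.congr_deriv ?_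
    simp only [id]
    ring
  · exact ((hc1.const_mul _).add hc2).intervalIntegrable _ _

theorem ringIntegral_eq_add {κ S : ℝ} {b x : E2} {p : RaySpace → ℂ} {z : ℝ}
    (hp : ContDiff ℝ ∞ p) (he : IsEven p) (hz : 0 ≤ z) (hS : 0 ≤ S) (hκ : κ ≠ 0)
    (h0 : p (ringPoint b x z S) = 0) :
    ringIntegral κ S b p x z = Complex.I / κ *
      (Complex.exp (Complex.I * (κ * z : ℝ)) * p ((z, x - z • b), 0)) +
      Complex.I / κ * ringIntegral κ S b (transport b p) x z := by
  have h := ringIntegral_boundary (κ := κ) hp he hz hS h0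
  have hκ' : (κ : ℂ) ≠ 0 := by exact_mod_cast hκ
  field_simp
  linear_combination (-Complex.I) * h + ringIntegral κ S b p x z * κ * Complex.I_mul_I

/-- The phase depends on z and σ through z + σ alone, so the z-derivative of the integrand is its
σ-derivative minus z times the radial quotient term. The total σ-derivative integrates to a boundary
term, and no integral with a factor κ is left. -/
theorem hasDerivAt_ringIntegral {κ S : ℝ} {b x : E2} {p : RaySpace → ℂ} {z : ℝ}
    (hp : ContDiff ℝ ∞ p) (he : IsEven p) (hz : 0 < z) (hS : 0 ≤ S)
    (h0 : p (ringPoint b x z S) = 0) :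
    HasDerivAt (fun z => ringIntegral κ S b p x z)
      (-(Complex.exp (Complex.I * (κ * z : ℝ)) * p ((z, x - z • b), 0)) -
        z * ringIntegral κ S b (radialQuot p) x z) z := by
  set q : RaySpace → ℂ := dirDeriv (rayDir b) p with hq
  have hqc : ContDiff ℝ ∞ q := ContDiff.dirDeriv hp _
  have hAc := contDiff_radialQuot hp
  have hcp := continuous_ringIntegrand κ b hp.continuous
  have hcq := continuous_ringIntegrand κ b hqc.continuous
  have hcA := continuous_ringIntegrand κ b hAc.continuous
  set D : ℝ → ℝ → ℂ := fun z σ =>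
    Complex.I * κ * (Complex.exp (Complex.I * (κ * (z + σ) : ℝ)) * p (ringPoint b x z σ)) +
      (Complex.exp (Complex.I * (κ * (z + σ) : ℝ)) * q (ringPoint b x z σ) +
      σ * (Complex.exp (Complex.I * (κ * (z + σ) : ℝ)) * radialQuot p (ringPoint b x z σ))) with hD
  have hg : Continuous fun v : ℝ × ℝ => ((x, v.1), v.2) := by fun_prop
  have hDc : Continuous fun v : ℝ × ℝ => D v.1 v.2 :=
    ((hcp.comp hg).const_mul _).add ((hcq.comp hg).add
      ((Complex.continuous_ofReal.comp continuous_snd).mul (hcA.comp hg)))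
  -- The ball of radius z about z keeps the height positive; its closure times the parameter
  -- interval is compact and supplies the dominating constant.
  obtain ⟨B, hB⟩ := ((isCompact_Icc (a := z - z) (b := z + z)).prod
    (isCompact_uIcc (a := 0) (b := S))).exists_bound_of_continuousOn hDc.continuousOn
  have hder := intervalIntegral.hasDerivAt_integral_of_dominated_loc_of_deriv_le
    (μ := volume) (a := 0) (b := S) (x₀ := z) (s := Metric.ball z z) (Metric.ball_mem_nhds z hz)
    (F := fun z σ => Complex.exp (Complex.I * (κ * (z + σ) : ℝ)) * p (ringPoint b x z σ))
    (F' := D) (bound := fun _ => B)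
    (Eventually.of_forall fun y =>
      (continuous_ringIntegrand_right κ b hp.continuous x y).aestronglyMeasurable)
    ((continuous_ringIntegrand_right κ b hp.continuous x z).intervalIntegrable _ _)
    (hDc.comp (by fun_prop : Continuous fun σ : ℝ => (z, σ))).aestronglyMeasurable
    (Eventually.of_forall fun σ hσ y hy => hB (y, σ) ⟨by
      rw [Real.ball_eq_Ioo] at hy; exact Set.Ioo_subset_Icc_self hy, Set.uIoc_subset_uIcc hσ⟩)
    intervalIntegrable_const
    (Eventually.of_forall fun σ hσ y hy => by
      rw [Real.ball_eq_Ioo] at hy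
      rw [Set.uIoc_of_le hS] at hσ
      have h1 := hasDerivAt_exp_phase κ y ((hasDerivAt_id y).add_const σ)
      have h2 := h1.mul (hasDerivAt_ringPoint_height hp he b x (by linarith [hy.1]) hσ.1)
      refine h2.congr_deriv ?_
      simp only [id, hD]
      ring)
  refine hder.2.congr_deriv ?_
  have hb := ringIntegral_boundary (κ := κ) hp he hz.le hS h0
  rw [← hb]
  have c1 := (continuous_ringIntegrand_right κ b hp.continuous x z).const_mul (Complex.I * κ)
  have c2 := continuous_ringIntegrand_right κ b (contDiff_transport hp b).continuous x z
  have c3 := (continuous_ringIntegrand_right κ b hAc.continuous x z).const_mul (z : ℂ)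
  rw [ringIntegral, ringIntegral, ringIntegral, ← intervalIntegral.integral_const_mul,
    ← intervalIntegral.integral_const_mul,
    ← intervalIntegral.integral_add (c1.intervalIntegrable _ _) (c2.intervalIntegrable _ _),
    ← intervalIntegral.integral_sub ((c1.fun_add c2).intervalIntegrable _ _)
      (c3.intervalIntegrable _ _)]
  refine intervalIntegral.integral_congr fun σ _ => ?_
  simp only [hD, transport, ← hq]
  simp only [ringPoint]
  push_cast
  ring

/-! ### Asymptotic expansion by repeated integration by parts -/

/-- The strip in which the arc parameter is bounded by `T`. -/
def strip (T : ℝ) : Set RaySpace := {v | |v.1.1| ≤ T}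

/-- A symbol on `RaySpace` that is even in the radius and that vanishes on the far ends of the
curves over the points of `X` at the heights `z < ρ`. -/
structure IsRaySymbol (δ : ℝ) (b : E2) (T ρ S : ℝ) (X : Set E2) (N : ℝ) (p : ℝ → RaySpace → ℂ) :
    Prop where
  symbol : IsSymbol δ (strip T) N p
  even : ∀ k : ℝ, 1 < k → IsEven (p k)
  vanish : ∀ k : ℝ, 1 < k → ∀ x ∈ X, ∀ z ∈ Set.Ioo 0 ρ, ∀ σ, S < σ → p k (ringPoint b x z σ) = 0

variable {δ : ℝ} {b : E2} {T ρ S : ℝ} {X : Set E2} {N : ℝ} {p : ℝ → RaySpace → ℂ}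

/-- The integral form of the quotient uses two radial derivatives, hence the order grows by 2;
scaling the radius by t in (0, 1] has norm at most 1 and does not move the arc parameter. -/
theorem IsSymbol.radialQuot (hp : IsSymbol δ (strip T) N p) :
    IsSymbol δ (strip T) (N + 2) (fun k => radialQuot (p k)) := by
  have h := (hp.dirDeriv radial).dirDeriv radial
  have h2 := h.integral_comp (Ω' := strip T) scaleRadius contDiff_scaleRadius (B := 1) 0 1
    (fun t ht => by
      rw [Set.uIoc_of_le zero_le_one] at ht
      exact norm_scaleRadius_le (by rw [abs_of_pos ht.1]; exact ht.2))
    (fun v hv t _ => hv)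
  rw [show N + 2 = N + 1 + 1 by ring]
  exact h2

theorem IsSymbol.transport (hp : IsSymbol δ (strip T) N p) (hδ : 0 ≤ δ) (b : E2) :
    IsSymbol δ (strip T) (N + 2) (fun k => transport b (p k)) := by
  have h1 := (hp.dirDeriv (rayDir b)).mono_order hδ (N' := N + 2) (by linarith)
  have h2 := hp.radialQuot.clm_mul hδ
    ((ContinuousLinearMap.fst ℝ ℝ E2).comp (ContinuousLinearMap.fst ℝ (ℝ × E2) ℝ)) (S := T)
    (fun v hv => hv)
  exact h1.add h2

theorem transport_eq_zero_of_vanish {p : RaySpace → ℂ} (hp : ContDiff ℝ ∞ p) (he : IsEven p) {x : E2}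
    (hS : 0 ≤ S) {z : ℝ} (hz : 0 ≤ z) (h : ∀ σ, S < σ → p (ringPoint b x z σ) = 0)
    {σ : ℝ} (hσ : S < σ) : transport b p (ringPoint b x z σ) = 0 := by
  have h1 := hasDerivAt_ringPoint_param hp he b x hz (hS.trans_lt hσ)
  refine h1.unique ((hasDerivAt_const σ (0 : ℂ)).congr_of_eventuallyEq ?_)
  filter_upwards [lt_mem_nhds hσ] with τ hτ using h τ hτ

/-- Beyond the far end both the σ-derivative and the z-derivative of p along the curves vanish.
Their difference is z times the radial quotient, and z > 0. -/
theorem radialQuot_eq_zero_of_vanish {p : RaySpace → ℂ} (hp : ContDiff ℝ ∞ p) (he : IsEven p) {x : E2}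
    (hS : 0 ≤ S) (h : ∀ z ∈ Set.Ioo 0 ρ, ∀ σ, S < σ → p (ringPoint b x z σ) = 0)
    {z : ℝ} (hz : z ∈ Set.Ioo 0 ρ) {σ : ℝ} (hσ : S < σ) : radialQuot p (ringPoint b x z σ) = 0 := by
  have h1 := (hasDerivAt_ringPoint_height hp he b x hz.1 (hS.trans_lt hσ)).unique
    ((hasDerivAt_const z (0 : ℂ)).congr_of_eventuallyEq (by
      filter_upwards [Ioo_mem_nhds hz.1 hz.2] with y hy using h y hy σ hσ))
  have h2 := transport_eq_zero_of_vanish hp he hS hz.1.le (h z hz) hσ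
  have h3 : (z : ℂ) * radialQuot p (ringPoint b x z σ) = 0 := by
    have h4 : ((ringPoint b x z σ).1.1 : ℂ) = z + σ := by simp [ringPoint]
    rw [transport, h4] at h2
    linear_combination h2 - h1
  have hz' : (z : ℂ) ≠ 0 := by exact_mod_cast hz.1.ne'
  exact (mul_eq_zero.1 h3).resolve_left hz'

theorem IsRaySymbol.transport (hp : IsRaySymbol δ b T ρ S X N p) (hδ : 0 ≤ δ) (hS : 0 ≤ S) :
    IsRaySymbol δ b T ρ S X (N + 2) (fun k => transport b (p k)) where
  symbol := hp.symbol.transport hδ b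
  even k hk := (hp.even k hk).transport (hp.symbol.smooth k hk) b
  vanish k hk x hx z hz _ hσ := transport_eq_zero_of_vanish (hp.symbol.smooth k hk) (hp.even k hk)
    hS hz.1.le (hp.vanish k hk x hx z hz) hσ

theorem IsRaySymbol.radialQuot (hp : IsRaySymbol δ b T ρ S X N p) (hS : 0 ≤ S) :
    IsRaySymbol δ b T ρ S X (N + 2) (fun k => radialQuot (p k)) where
  symbol := hp.symbol.radialQuot
  even k hk := (hp.even k hk).radialQuot (hp.symbol.smooth k hk)
  vanish k hk x hx _ hz _ hσ := radialQuot_eq_zero_of_vanish (hp.symbol.smooth k hk) (hp.even k hk)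
    hS (hp.vanish k hk x hx) hz hσ

theorem IsRaySymbol.iterate (hp : IsRaySymbol δ b T ρ S X N p) (hδ : 0 ≤ δ) (hS : 0 ≤ S) (j : ℕ) :
    IsRaySymbol δ b T ρ S X (N + 2 * j) (fun k => (KirchhoffPolygon.transport b)^[j] (p k)) := by
  induction j with
  | zero => simpa using hp
  | succ j ih =>
    have h := ih.transport hδ hS
    simp only [Function.iterate_succ_apply']
    convert h using 1
    push_cast; ring

/-- The vanishing beyond S is strict, so all iterates vanish at S + 1 and no step has a boundary
term at the far end. -/
theorem IsRaySymbol.ringIntegral_expand (hp : IsRaySymbol δ b T ρ S X N p) (hδ : 0 ≤ δ) (hS : 0 ≤ S)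
    {c : ℝ} (hc : 0 < c) {k : ℝ} (hk : 1 < k) {x : E2} (hx : x ∈ X) {z : ℝ} (hz : z ∈ Set.Ioo 0 ρ)
    (m : ℕ) :
    ringIntegral (k * c) (S + 1) b (p k) x z =
      ∑ j ∈ Finset.range m, (Complex.I / (k * c : ℝ)) ^ (j + 1) *
        (Complex.exp (Complex.I * (k * c * z : ℝ)) *
          (KirchhoffPolygon.transport b)^[j] (p k) ((z, x - z • b), 0)) +
      (Complex.I / (k * c : ℝ)) ^ m *
        ringIntegral (k * c) (S + 1) b ((KirchhoffPolygon.transport b)^[m] (p k)) x z := by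
  induction m with
  | zero => simp
  | succ m ih =>
    have hm := hp.iterate hδ hS m
    have h := ringIntegral_eq_add (κ := k * c) (S := S + 1) (hm.symbol.smooth k hk) (hm.even k hk)
      hz.1.le (by linarith) (by positivity) (hm.vanish k hk x hx z hz (S + 1) (by linarith))
    rw [ih, h, Finset.sum_range_succ, Function.iterate_succ_apply']
    ring

theorem norm_exp_I_mul (t : ℝ) : ‖Complex.exp (Complex.I * (t : ℝ))‖ = 1 := by
  rw [mul_comm]; exact Complex.norm_exp_ofReal_mul_I t

theorem IsSymbol.norm_le {E : Type} [NormedAddCommGroup E] [NormedSpace ℝ E] {Ω : Set E}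
    {p : ℝ → E → ℂ} (hp : IsSymbol δ Ω N p) : ∃ C : ℝ, 0 ≤ C ∧
    ∀ k : ℝ, 1 < k → ∀ v ∈ Ω, ‖p k v‖ ≤ C * k ^ (δ * N) := by
  obtain ⟨C, h0, hC⟩ := hp.exists_nonneg 0
  exact ⟨C, h0, fun k hk v hv => by simpa using hC k hk v hv⟩

theorem norm_I_div_pow {c : ℝ} (hc : 0 < c) {k : ℝ} (hk : 1 < k) (j : ℕ) :
    ‖(Complex.I / (k * c : ℝ)) ^ j‖ = c⁻¹ ^ j * k ^ (-(j : ℝ)) := by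
  have hk0 : 0 < k := by linarith
  rw [norm_pow, norm_div, Complex.norm_I, Complex.norm_real, Real.norm_of_nonneg (by positivity),
    Real.rpow_neg hk0.le, Real.rpow_natCast, ← inv_pow, ← mul_pow, one_div, mul_inv, mul_comm]

theorem ringCenter_mem_strip (hT : ρ + S + 1 ≤ T) (hS : 0 ≤ S) {z : ℝ} (hz : z ∈ Set.Ioo 0 ρ) (y : E2)
    (w : ℝ) : (((z, y), w) : RaySpace) ∈ strip T := by
  simp only [strip, Set.mem_ofPred_eq]
  rw [abs_of_pos hz.1]
  linarith [hz.2]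

/-- Each application of `transport` raises the order by 2 and costs k^{2δ}, while each division by
kc gains k⁻¹; successive terms thus shrink by k^{2δ-1}. -/
theorem IsRaySymbol.term_bound (hp : IsRaySymbol δ b T ρ S X N p) (hδ : 0 ≤ δ) (hS : 0 ≤ S)
    (hT : ρ + S + 1 ≤ T) {c : ℝ} (hc : 0 < c) (j : ℕ) : ∃ C : ℝ, 0 ≤ C ∧ ∀ k : ℝ, 1 < k → ∀ x : E2,
    ∀ z ∈ Set.Ioo 0 ρ, ‖(Complex.I / (k * c : ℝ)) ^ (j + 1) *
        (Complex.exp (Complex.I * (k * c * z : ℝ)) *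
          (KirchhoffPolygon.transport b)^[j] (p k) ((z, x - z • b), 0))‖ ≤
      C * k ^ (δ * N + ((2 * δ - 1) * j - 1)) := by
  obtain ⟨C, h0, hC⟩ := (hp.iterate hδ hS j).symbol.norm_le
  refine ⟨c⁻¹ ^ (j + 1) * C, by positivity, fun k hk x z hz => ?_⟩
  have hk0 : 0 < k := by linarith
  rw [norm_mul, norm_mul, norm_exp_I_mul, one_mul, norm_I_div_pow hc hk]
  have h := hC k hk _ (ringCenter_mem_strip hT hS hz (x - z • b) 0)
  calc _ ≤ c⁻¹ ^ (j + 1) * k ^ (-((j + 1 : ℕ) : ℝ)) * (C * k ^ (δ * (N + 2 * j))) := by gcongr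
    _ = c⁻¹ ^ (j + 1) * C * (k ^ (-((j + 1 : ℕ) : ℝ)) * k ^ (δ * (N + 2 * j))) := by ring
    _ = _ := by
      rw [← Real.rpow_add hk0]
      congr 2
      push_cast
      ring

theorem IsRaySymbol.remainder_bound (hp : IsRaySymbol δ b T ρ S X N p) (hδ : 0 ≤ δ) (hS : 0 ≤ S)
    (hT : ρ + S + 1 ≤ T) {c : ℝ} (hc : 0 < c) (m : ℕ) : ∃ C : ℝ, 0 ≤ C ∧ ∀ k : ℝ, 1 < k →
    ∀ x : E2, ∀ z ∈ Set.Ioo 0 ρ, ‖(Complex.I / (k * c : ℝ)) ^ m *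
        ringIntegral (k * c) (S + 1) b ((KirchhoffPolygon.transport b)^[m] (p k)) x z‖ ≤
      C * k ^ (δ * N + (2 * δ - 1) * m) := by
  obtain ⟨C, h0, hC⟩ := (hp.iterate hδ hS m).symbol.norm_le
  refine ⟨c⁻¹ ^ m * (C * (S + 1)), by positivity, fun k hk x z hz => ?_⟩
  have hk0 : 0 < k := by linarith
  have h : ‖ringIntegral (k * c) (S + 1) b ((KirchhoffPolygon.transport b)^[m] (p k)) x z‖ ≤
      C * k ^ (δ * (N + 2 * m)) * (S + 1) := by
    have h1 := intervalIntegral.norm_integral_le_of_norm_le_const (a := 0) (b := S + 1)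
      (f := fun σ => Complex.exp (Complex.I * (k * c * (z + σ) : ℝ)) *
        (KirchhoffPolygon.transport b)^[m] (p k) (ringPoint b x z σ))
      (C := C * k ^ (δ * (N + 2 * m))) (fun σ hσ => ?_)
    · rwa [sub_zero, abs_of_nonneg (by linarith : 0 ≤ S + 1)] at h1
    · rw [Set.uIoc_of_le (by linarith)] at hσ
      rw [norm_mul, norm_exp_I_mul, one_mul]
      refine hC k hk _ ?_
      simp only [strip, Set.mem_ofPred_eq, ringPoint]
      rw [abs_of_pos (by linarith [hz.1, hσ.1])]
      linarith [hz.2, hσ.2]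
  rw [norm_mul, norm_I_div_pow hc hk]
  calc _ ≤ c⁻¹ ^ m * k ^ (-(m : ℝ)) * (C * k ^ (δ * (N + 2 * m)) * (S + 1)) := by gcongr
    _ = c⁻¹ ^ m * (C * (S + 1)) * (k ^ (-(m : ℝ)) * k ^ (δ * (N + 2 * m))) := by ring
    _ = _ := by
      rw [← Real.rpow_add hk0]
      congr 2
      ring

/-- The oscillatory integrals of a symbol of order `N` are `O(k^{δN-1})`. -/
theorem IsRaySymbol.ringIntegral_bound (hp : IsRaySymbol δ b T ρ S X N p) (hδ : 0 ≤ δ)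
    (hδ₁ : δ < 1 / 2) (hS : 0 ≤ S) (hT : ρ + S + 1 ≤ T) {c : ℝ} (hc : 0 < c) :
    ∃ C : ℝ, 0 ≤ C ∧ ∀ k : ℝ, 1 < k → ∀ x ∈ X, ∀ z ∈ Set.Ioo 0 ρ,
      ‖ringIntegral (k * c) (S + 1) b (p k) x z‖ ≤ C * k ^ (δ * N - 1) := by
  -- With (1 - 2δ)m ≥ 1 the remainder k^{δN - (1-2δ)m} is already within the claimed bound.
  obtain ⟨m, hm⟩ := exists_nat_ge (1 / (1 - 2 * δ))
  rw [div_le_iff₀ (by linarith)] at hm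
  choose C h0 hC using fun j => hp.term_bound hδ hS hT hc j
  obtain ⟨B, hB0, hB⟩ := hp.remainder_bound hδ hS hT hc m
  refine ⟨∑ j ∈ Finset.range m, C j + B, add_nonneg (Finset.sum_nonneg fun j _ => h0 j) hB0,
    fun k hk x hx z hz => ?_⟩
  rw [hp.ringIntegral_expand hδ hS hc hk hx hz m, add_mul, Finset.sum_mul]
  refine (norm_add_le _ _).trans (add_le_add ((norm_sum_le _ _).trans
    (Finset.sum_le_sum fun j _ => (hC j k hk x z hz).trans ?_)) ((hB k hk x z hz).trans ?_))
  · have := h0 j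
    have := hk.le
    have h2 : 0 ≤ (1 - 2 * δ) * (j : ℝ) := mul_nonneg (by linarith) (by positivity)
    gcongr
    linarith
  · have := hk.le
    gcongr
    linarith

theorem dirDeriv_eventuallyEq_zero {E : Type} [NormedAddCommGroup E] [NormedSpace ℝ E] {p : E → ℂ}
    {v : E} {a : ℂ} (h : p =ᶠ[𝓝 v] fun _ => a) (e : E) : dirDeriv e p =ᶠ[𝓝 v] fun _ => 0 := by
  filter_upwards [h.eventuallyEq_nhds] with u hu
  simp [dirDeriv, hu.fderiv_eq]

/-- The quotient is nonlocal in the radius, but it averages over smaller radii only. A ball about a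
point of radius coordinate zero contains the whole averaging segment of each of its points. -/
theorem radialQuot_eventuallyEq_zero {p : RaySpace → ℂ} {y : ℝ × E2} {a : ℂ}
    (h : p =ᶠ[𝓝 (y, 0)] fun _ => a) : radialQuot p =ᶠ[𝓝 (y, 0)] fun _ => 0 := by
  have h2 := dirDeriv_eventuallyEq_zero (dirDeriv_eventuallyEq_zero h radial) radial
  obtain ⟨ε, hε, hb⟩ := Metric.eventually_nhds_iff.1 h2
  refine Metric.eventually_nhds_iff.2 ⟨ε, hε, fun v hv => ?_⟩
  rw [radialQuot, intervalIntegral.integral_congr (g := fun _ => 0)]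
  · simp
  · intro t ht
    rw [Set.uIcc_of_le zero_le_one] at ht
    refine hb ?_
    rw [Prod.dist_eq] at hv ⊢
    refine (max_le_max le_rfl ?_).trans_lt hv
    simp only [dist_zero_right, norm_mul, Real.norm_eq_abs]
    exact mul_le_of_le_one_left (abs_nonneg _) (abs_le.2 ⟨by linarith [ht.1], ht.2⟩)

theorem transport_eventuallyEq_zero {p : RaySpace → ℂ} {y : ℝ × E2} {a : ℂ} (b : E2)
    (h : p =ᶠ[𝓝 (y, 0)] fun _ => a) : transport b p =ᶠ[𝓝 (y, 0)] fun _ => 0 := by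
  filter_upwards [dirDeriv_eventuallyEq_zero h (rayDir b), radialQuot_eventuallyEq_zero h]
    with v h1 h2
  simp [transport, h1, h2]

theorem iterate_transport_eventuallyEq_zero {p : RaySpace → ℂ} {y : ℝ × E2} {a : ℂ} (b : E2)
    (h : p =ᶠ[𝓝 (y, 0)] fun _ => a) (j : ℕ) :
    (transport b)^[j + 1] p =ᶠ[𝓝 (y, 0)] fun _ => 0 := by
  induction j with
  | zero => exact transport_eventuallyEq_zero b h
  | succ j ih =>
    rw [Function.iterate_succ_apply']
    exact transport_eventuallyEq_zero b ih

/-- The oscillatory integral of a symbol that is constant near the start of the curve is its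
boundary term, up to an error that is smaller than every power of `k`. -/
theorem IsRaySymbol.ringIntegral_asymp (hp : IsRaySymbol δ b T ρ S X N p) (hδ : 0 ≤ δ)
    (hδ₁ : δ < 1 / 2) (hS : 0 ≤ S) (hT : ρ + S + 1 ≤ T) {c : ℝ} (hc : 0 < c) (B : ℝ) :
    ∃ C : ℝ, 0 ≤ C ∧ ∀ k : ℝ, 1 < k → ∀ x ∈ X, ∀ z ∈ Set.Ioo 0 ρ,
      (∃ a : ℂ, p k =ᶠ[𝓝 ((z, x - z • b), 0)] fun _ => a) →
      ‖ringIntegral (k * c) (S + 1) b (p k) x z - Complex.I / (k * c : ℝ) *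
        (Complex.exp (Complex.I * (k * c * z : ℝ)) * p k ((z, x - z • b), 0))‖ ≤ C * k ^ (-B) := by
  obtain ⟨m, hm⟩ := exists_nat_ge ((B + δ * N) / (1 - 2 * δ))
  rw [div_le_iff₀ (by linarith)] at hm
  obtain ⟨C, hC0, hC⟩ := hp.remainder_bound hδ hS hT hc (m + 1)
  refine ⟨C, hC0, fun k hk x hx z hz ⟨a, ha⟩ => ?_⟩
  -- One more term than the remainder estimate suggests: the term of index 0 is the asserted leading
  -- term, and those of positive index vanish because p is locally constant at the start of the
  -- curve.
  rw [hp.ringIntegral_expand hδ hS hc hk hx hz (m + 1), Finset.sum_range_succ',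
    Finset.sum_eq_zero fun j _ => by
      rw [(iterate_transport_eventuallyEq_zero b ha j).eq_of_nhds]; simp]
  simp only [zero_add, pow_one, Function.iterate_zero, id_eq, add_sub_cancel_left]
  refine (hC k hk x z hz).trans ?_
  have := hk.le
  gcongr
  push_cast
  linarith

/-! ### The Lorentz boost of the plane -/

/-- The distance from a point at height `z` over the origin to the point `y` of the plane. -/
def slant (z : ℝ) (y : E2) : ℝ := √(‖y‖ ^ 2 + z ^ 2)

/-- The linear part of the boost. -/
def stretch (a : E2) (c : ℝ) : E2 →L[ℝ] E2 :=
  ContinuousLinearMap.id ℝ E2 + ((1 / (c * (1 + c))) • innerSL ℝ a).smulRight a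

/-- The Lorentz boost of the hyperboloid `ρ² = |y|² + z²`, written in the plane of `y`, which
takes the phase `ρ + a · y` to `cρ`. -/
def boost (a : E2) (c z : ℝ) (y : E2) : E2 := stretch a c y - (slant z y / c) • a

theorem stretch_apply (a : E2) (c : ℝ) (v : E2) :
    stretch a c v = v + (1 / (c * (1 + c)) * inner ℝ a v) • a := by
  simp [stretch]

theorem stretch_neg (a : E2) (c : ℝ) : stretch (-a) c = stretch a c := by
  ext1 v; simp [stretch_apply]

section Boost

variable {a : E2} {c : ℝ} (hc : 0 < c) (hac : ‖a‖ ^ 2 + c ^ 2 = 1)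

theorem slant_sq (z : ℝ) (y : E2) : slant z y ^ 2 = ‖y‖ ^ 2 + z ^ 2 :=
  Real.sq_sqrt (by positivity)

theorem slant_pos {z : ℝ} (hz : 0 < z) (y : E2) : 0 < slant z y :=
  Real.sqrt_pos.2 (by positivity)

include hac in
theorem norm_le_one_of_sq_add : ‖a‖ ≤ 1 := by
  nlinarith [sq_nonneg c, norm_nonneg a]

include hac in
theorem abs_inner_le_slant (z : ℝ) (y : E2) : |inner ℝ a y| ≤ slant z y := by
  refine (abs_real_inner_le_norm a y).trans ?_
  have h1 : ‖a‖ * ‖y‖ ≤ ‖y‖ :=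
    mul_le_of_le_one_left (norm_nonneg _) (norm_le_one_of_sq_add hac)
  exact h1.trans (Real.le_sqrt_of_sq_le (by nlinarith [sq_nonneg z]))

include hc hac in
theorem inner_stretch (y : E2) : inner ℝ a (stretch a c y) = inner ℝ a y / c := by
  rw [stretch_apply, inner_add_right, inner_smul_right, real_inner_self_eq_norm_sq,
    show ‖a‖ ^ 2 = (1 - c) * (1 + c) by linarith]
  field_simp
  ring

include hc hac in
theorem inner_boost (z : ℝ) (y : E2) :
    inner ℝ a (boost a c z y) = (inner ℝ a y - (1 - c ^ 2) * slant z y) / c := by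
  rw [boost, inner_sub_right, inner_stretch hc hac, inner_smul_right, real_inner_self_eq_norm_sq,
    show ‖a‖ ^ 2 = 1 - c ^ 2 by linarith]
  ring

include hc hac in
-- The boost preserves slant² - |y|² = z², which gives the identity after squaring; the sign of the
-- root comes from |a·y| ≤ slant.
theorem slant_boost (z : ℝ) (y : E2) :
    slant z (boost a c z y) = (slant z y - inner ℝ a y) / c := by
  have hs := slant_sq z y
  have hle := (abs_le.1 (abs_inner_le_slant hac z y)).2
  have ha : ‖a‖ ^ 2 = 1 - c ^ 2 := by linarith
  refine (Real.sqrt_eq_iff_mul_self_eq (by positivity) (div_nonneg (by linarith) hc.le)).2 ?_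
  have h1 : ‖boost a c z y‖ ^ 2 = ‖y‖ ^ 2 +
      2 * ((1 / (c * (1 + c)) * inner ℝ a y - slant z y / c) * inner ℝ a y) +
      (1 / (c * (1 + c)) * inner ℝ a y - slant z y / c) ^ 2 * (1 - c ^ 2) := by
    rw [boost, stretch_apply, add_sub_assoc, ← sub_smul, norm_add_sq_real, inner_smul_right,
      norm_smul, mul_pow, ha, Real.norm_eq_abs, sq_abs, real_inner_comm]
  rw [h1, show ‖y‖ ^ 2 = slant z y ^ 2 - z ^ 2 by linarith]
  field_simp
  ring

include hc hac in
theorem boost_neg_boost (z : ℝ) (y : E2) : boost (-a) c z (boost a c z y) = y := by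
  rw [boost, stretch_neg, slant_boost hc hac, stretch_apply, inner_boost hc hac, boost,
    stretch_apply]
  have hc' : (1 + c) ≠ 0 := by positivity
  match_scalars
  · ring
  · field_simp
    ring

include hc hac in
-- This is the purpose of the boost: the new phase does not depend on the direction of y.
theorem slant_add_inner_boost (z : ℝ) (y : E2) :
    slant z (boost a c z y) + inner ℝ a (boost a c z y) = c * slant z y := by
  rw [slant_boost hc hac, inner_boost hc hac]
  field_simp
  ring

theorem hasFDerivAt_slant {z : ℝ} (hz : 0 < z) (y : E2) :
    HasFDerivAt (slant z) ((1 / slant z y) • innerSL ℝ y) y := by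
  have h1 : HasFDerivAt (fun y : E2 => ‖y‖ ^ 2 + z ^ 2) (2 • innerSL ℝ y) y :=
    (hasStrictFDerivAt_norm_sq y).hasFDerivAt.add_const _
  have h2 := h1.sqrt (by positivity)
  refine h2.congr_fderiv ?_
  ext v
  simp [slant]
  ring

/-- The derivative of the boost. -/
def boostDeriv (a : E2) (c z : ℝ) (y : E2) : E2 →L[ℝ] E2 :=
  ContinuousLinearMap.id ℝ E2 +
    ((1 / (c * (1 + c))) • innerSL ℝ a - (1 / (c * slant z y)) • innerSL ℝ y).smulRight a

theorem hasFDerivAt_boost (a : E2) (c : ℝ) {z : ℝ} (hz : 0 < z) (y : E2) :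
    HasFDerivAt (boost a c z) (boostDeriv a c z y) y := by
  have h := (stretch a c).hasFDerivAt.sub
    (((hasFDerivAt_slant hz y).mul_const (1 / c)).smul_const a) (x := y)
  have h2 : boost a c z = ⇑(stretch a c) - fun y => (slant z y * (1 / c)) • a := by
    ext1 y
    simp [boost, div_eq_mul_inv]
  rw [h2]
  refine h.congr_fderiv ?_
  ext1 v
  simp only [boostDeriv, stretch, add_apply, sub_apply,
    ContinuousLinearMap.smulRight_apply, smul_apply, smul_eq_mul,
    ContinuousLinearMap.id_apply, innerSL_apply_apply]
  match_scalars
  · ring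
  · field_simp

include hc hac in
-- The derivative is the identity plus a rank-one map f ⊗ a, so its determinant is 1 + f(a).
theorem det_boostDeriv {z : ℝ} (hz : 0 < z) (y : E2) :
    (boostDeriv a c z y).det = slant z (boost a c z y) / slant z y := by
  have h := LinearMap.transvection.det (R := ℝ) (V := E2)
    ((((1 / (c * (1 + c))) • innerSL ℝ a - (1 / (c * slant z y)) • innerSL ℝ y : E2 →L[ℝ] ℝ) :
      E2 →ₗ[ℝ] ℝ)) a
  have h2 : (boostDeriv a c z y).det = _ := h
  have hs := slant_pos hz y
  rw [h2, slant_boost hc hac]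
  simp only [ContinuousLinearMap.coe_coe, sub_apply,
    smul_apply, innerSL_apply_apply, smul_eq_mul, real_inner_self_eq_norm_sq,
    real_inner_comm y a]
  rw [show ‖a‖ ^ 2 = (1 - c) * (1 + c) by linarith, real_inner_comm a y]
  field_simp
  ring

include hc hac in
-- The measure dy/slant is Lorentz invariant: the Jacobian is precisely the ratio of the two slants.
-- Bijectivity follows from the inverse boost, with -a in place of a.
theorem integral_boost {z : ℝ} (hz : 0 < z) (F : E2 → ℂ) :
    ∫ y, F y / (slant z y : ℝ) = ∫ y, F (boost a c z y) / (slant z y : ℝ) := by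
  have hinj : Function.Injective (boost a c z) :=
    Function.LeftInverse.injective (boost_neg_boost hc hac z)
  have hsurj : Function.Surjective (boost a c z) := fun y => by
    have h := boost_neg_boost hc (a := -a) (by simpa using hac) z y
    rw [neg_neg] at h
    exact ⟨_, h⟩
  have h := integral_image_eq_integral_abs_det_fderiv_smul (volume : Measure E2)
    MeasurableSet.univ (fun y _ => (hasFDerivAt_boost a c hz y).hasFDerivWithinAt)
    hinj.injOn (fun y => F y / (slant z y : ℝ))
  rw [Set.image_univ, hsurj.range_eq, setIntegral_univ, setIntegral_univ] at h
  rw [h]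
  congr 1
  ext1 y
  have h1 := slant_pos hz y
  have h2 := slant_pos hz (boost a c z y)
  have h1' : (slant z y : ℂ) ≠ 0 := by exact_mod_cast h1.ne'
  have h2' : (slant z (boost a c z y) : ℂ) ≠ 0 := by exact_mod_cast h2.ne'
  rw [det_boostDeriv hc hac hz, abs_of_pos (by positivity), Complex.real_smul]
  push_cast
  field_simp

end Boost

/-! ### Polar coordinates and means over ellipses -/

/-- The point of the unit circle with the polar angle `θ`. -/
def circlePt (θ : ℝ) : E2 :=
  Real.cos θ • EuclideanSpace.single 0 (1 : ℝ) + Real.sin θ • EuclideanSpace.single 1 (1 : ℝ)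

theorem norm_circlePt (θ : ℝ) : ‖circlePt θ‖ = 1 := by
  rw [EuclideanSpace.norm_eq, Real.sqrt_eq_one]
  simp [circlePt, Fin.sum_univ_two]

theorem circlePt_add_pi (θ : ℝ) : circlePt (θ + Real.pi) = -circlePt θ := by
  simp [circlePt, Real.cos_add_pi, Real.sin_add_pi]; abel

theorem contDiff_circlePt : ContDiff ℝ ∞ circlePt := by
  unfold circlePt
  fun_prop

theorem integral_polar (H : E2 → ℂ) :
    ∫ y, H y = ∫ v in Set.Ioi (0 : ℝ) ×ˢ Set.Ioo (-Real.pi) Real.pi, v.1 • H (v.1 • circlePt v.2) := by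
  have h1 := (Complex.orthonormalBasisOneI.repr.measurePreserving).integral_comp
    Complex.orthonormalBasisOneI.repr.toHomeomorph.measurableEmbedding H
  rw [← h1, ← Complex.integral_comp_polarCoord_symm]
  refine setIntegral_congr_fun (measurableSet_Ioi.prod measurableSet_Ioo) fun v _ => ?_
  have : Complex.orthonormalBasisOneI.repr (Complex.polarCoord.symm v) = v.1 • circlePt v.2 := by
    rw [Complex.polarCoord_symm_apply]
    ext i
    fin_cases i <;> simp [circlePt, Complex.orthonormalBasisOneI_repr_apply, -Complex.ofReal_cos,
      -Complex.ofReal_sin]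
  simp only [this]

/-- The map `((s, y), w) ↦ y + w T e(θ)` from the ray coordinates to the plane. -/
def ellipsePt (a : E2) (c θ : ℝ) : RaySpace →L[ℝ] E2 :=
  (ContinuousLinearMap.snd ℝ ℝ E2).comp (ContinuousLinearMap.fst ℝ (ℝ × E2) ℝ) +
    (ContinuousLinearMap.snd ℝ (ℝ × E2) ℝ).smulRight (stretch a c (circlePt θ))

theorem ellipsePt_apply (a : E2) (c θ : ℝ) (v : RaySpace) :
    ellipsePt a c θ v = v.1.2 + v.2 • stretch a c (circlePt θ) := rfl

/-- The integral of `g` over the ellipse with the centre `y` and the size `w`. -/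
def ringMean (a : E2) (c : ℝ) (g : E2 → ℂ) : RaySpace → ℂ :=
  fun v => ∫ θ in (-Real.pi)..Real.pi, g (ellipsePt a c θ v)

theorem contDiff_ellipsePt (a : E2) (c : ℝ) :
    ContDiff ℝ ∞ fun v : RaySpace × ℝ => ellipsePt a c v.2 v.1 := by
  have h := contDiff_circlePt
  simp only [ellipsePt_apply]
  fun_prop

theorem norm_ellipsePt_le (a : E2) (c θ : ℝ) : ‖ellipsePt a c θ‖ ≤ 1 + ‖stretch a c‖ := by
  refine ContinuousLinearMap.opNorm_le_bound _ (by positivity) fun v => ?_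
  rw [ellipsePt_apply, add_mul]
  refine (norm_add_le _ _).trans (add_le_add ?_ ?_)
  · rw [one_mul]
    exact (norm_snd_le v.1).trans (norm_fst_le v)
  · rw [norm_smul, mul_comm]
    refine mul_le_mul ?_ (norm_snd_le v) (norm_nonneg _) (norm_nonneg _)
    simpa [norm_circlePt] using (stretch a c).le_opNorm (circlePt θ)

theorem IsSymbol.ringMean {δ N : ℝ} {g : ℝ → E2 → ℂ} (hg : IsSymbol δ Set.univ N g) (a : E2) (c T : ℝ) :
    IsSymbol δ (strip T) N (fun k => ringMean a c (g k)) :=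
  hg.integral_comp (ellipsePt a c) (contDiff_ellipsePt a c) (B := 1 + ‖stretch a c‖)
    (-Real.pi) Real.pi (fun t _ => norm_ellipsePt_le a c t) (fun _ _ _ _ => Set.mem_univ _)

theorem continuous_ringMean (a : E2) (c : ℝ) {g : E2 → ℂ} (hg : Continuous g) :
    Continuous (ringMean a c g) :=
  intervalIntegral.continuous_parametric_intervalIntegral_of_continuous'
    (f := fun (v : RaySpace) (θ : ℝ) => g (ellipsePt a c θ v))
    (hg.comp (contDiff_ellipsePt a c).continuous) _ _

/-- Reversing the radius amounts to the shift θ ↦ θ + π, which does not change an integral over a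
full period. -/
theorem isEven_ringMean (a : E2) (c : ℝ) (g : E2 → ℂ) : IsEven (ringMean a c g) := by
  intro v
  set f : ℝ → ℂ := fun θ => g (ellipsePt a c θ v) with hf
  have hper : Function.Periodic f (2 * Real.pi) := fun θ => by
    simp only [hf, ellipsePt_apply]
    rw [show θ + 2 * Real.pi = θ + Real.pi + Real.pi by ring, circlePt_add_pi, circlePt_add_pi,
      neg_neg]
  have h1 : ringMean a c g (v.1, -v.2) = ∫ θ in (-Real.pi)..Real.pi, f (θ + Real.pi) := by
    refine intervalIntegral.integral_congr fun θ _ => ?_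
    simp [hf, ellipsePt_apply, circlePt_add_pi]
  have h2 := hper.intervalIntegral_add_eq (-Real.pi + Real.pi) (-Real.pi)
  rw [h1, intervalIntegral.integral_comp_add_right]
  rw [show -Real.pi + Real.pi + 2 * Real.pi = Real.pi + Real.pi by ring,
    show -Real.pi + 2 * Real.pi = Real.pi by ring] at h2
  rw [h2, ringMean]

/-- A small ellipse whose centre is near y lies inside the neighbourhood on which g is constant; the
angular interval has length 2π. -/
theorem ringMean_eventuallyEq_const {a : E2} {c : ℝ} {g : E2 → ℂ} {y : ℝ × E2} {u : ℂ}
    (h : g =ᶠ[𝓝 y.2] fun _ => u) : ringMean a c g =ᶠ[𝓝 (y, 0)] fun _ => 2 * Real.pi * u := by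
  obtain ⟨ε, hε, hb⟩ := Metric.eventually_nhds_iff.1 h
  have hcont : ContinuousAt (fun v : RaySpace => ‖v.1.2 - y.2‖ + |v.2| * ‖stretch a c‖) (y, 0) := by
    fun_prop
  have hev := hcont.eventually_lt continuousAt_const (g := fun _ => ε) (by simpa using hε)
  filter_upwards [hev] with v hv
  rw [ringMean, intervalIntegral.integral_congr (g := fun _ => u)]
  · simp only [intervalIntegral.integral_const, Complex.real_smul]
    push_cast
    ring
  · intro θ _
    refine hb ?_
    rw [dist_eq_norm, ellipsePt_apply, add_sub_right_comm]
    refine (norm_add_le _ _).trans_lt (lt_of_le_of_lt ?_ hv)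
    gcongr
    rw [norm_smul, Real.norm_eq_abs]
    gcongr
    simpa [norm_circlePt] using (stretch a c).le_opNorm (circlePt θ)

theorem slant_smul_circlePt {z w : ℝ} (θ : ℝ) : slant z (w • circlePt θ) = √(w ^ 2 + z ^ 2) := by
  rw [slant, norm_smul, norm_circlePt, mul_one, Real.norm_eq_abs, sq_abs]

/-! ### Exact reduction of the single layer to a one-dimensional integral -/

section Formula

variable {a : E2} {c : ℝ} (hc : 0 < c) (hac : ‖a‖ ^ 2 + c ^ 2 = 1)

/-- The length of the curves on which functions supported in the ball of radius `Q` live. -/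
def ringLength (c Q ρ : ℝ) : ℝ := (2 * Q + 3 * ρ) / c

include hc hac in
-- If g did not vanish, the boosted point u would satisfy |u| ≤ Q + ρ. Then c·slant(y) = slant(u) +
-- a·u ≤ 2|u| + z < 2Q + 3ρ, which is where `ringLength` comes from.
theorem eq_zero_of_slant_gt {g : E2 → ℂ} {Q : ℝ} (hQ : ∀ q, Q < ‖q‖ → g q = 0) {ρ : ℝ} {x : E2} (hx : ‖x‖ < ρ)
    {z : ℝ} (hz : z ∈ Set.Ioo 0 ρ) {y : E2} (hy : ringLength c Q ρ < slant z y) :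
    g (x + boost a c z y) = 0 := by
  by_contra h
  have h1 : ‖x + boost a c z y‖ ≤ Q := not_lt.1 fun h2 => h (hQ _ h2)
  have h2 := slant_add_inner_boost hc hac z y
  set u := boost a c z y
  have h3 : ‖u‖ ≤ Q + ρ := by
    have := norm_sub_le (x + u) x
    rw [add_sub_cancel_left] at this
    linarith
  have h4 : slant z u ≤ ‖u‖ + z := by
    refine (Real.sqrt_le_left (by linarith [norm_nonneg u, hz.1])).2 ?_
    nlinarith [mul_nonneg (norm_nonneg u) hz.1.le]
  have h5 : inner ℝ a u ≤ ‖u‖ := (real_inner_le_norm a u).trans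
    (mul_le_of_le_one_left (norm_nonneg _) (norm_le_one_of_sq_add hac))
  rw [ringLength, div_lt_iff₀ hc] at hy
  linarith [hz.2]

/-- The slant is constant on a circle about the origin, so there the boost acts as a fixed linear
stretch followed by a translation: the image is the ellipse parametrized by `ellipsePt`. -/
theorem boost_smul_circlePt (a : E2) (c : ℝ) (x : E2) (z σ θ : ℝ) (hz : 0 ≤ z) (hσ : 0 ≤ σ) :
    slant z (√(σ * (σ + 2 * z)) • circlePt θ) = z + σ ∧
    ellipsePt a c θ (ringPoint (c⁻¹ • a) x z σ) =
      x + boost a c z (√(σ * (σ + 2 * z)) • circlePt θ) := by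
  have h : slant z (√(σ * (σ + 2 * z)) • circlePt θ) = z + σ := by
    rw [slant_smul_circlePt, Real.sq_sqrt (by positivity), ← Real.sqrt_sq (by positivity : 0 ≤ z + σ)]
    congr 1
    ring
  refine ⟨h, ?_⟩
  rw [boost, h, ellipsePt_apply, ringPoint]
  simp only [map_smul, smul_smul]
  rw [div_eq_mul_inv]
  abel

include hc hac in
theorem ringMean_vanish {g : E2 → ℂ} {Q : ℝ} (hQ : ∀ q, Q < ‖q‖ → g q = 0) {ρ : ℝ} {x : E2}
    (hQ0 : 0 ≤ Q) (hx : ‖x‖ < ρ) {z : ℝ} (hz : z ∈ Set.Ioo 0 ρ) {σ : ℝ} (hσ : ringLength c Q ρ < σ) :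
    ringMean a c g (ringPoint (c⁻¹ • a) x z σ) = 0 := by
  have hS : 0 ≤ ringLength c Q ρ := by
    have := hz.1.trans hz.2
    rw [ringLength]; positivity
  rw [ringMean, intervalIntegral.integral_congr (g := fun _ => 0)]
  · simp
  · intro θ _
    obtain ⟨h1, h2⟩ := boost_smul_circlePt a c x z σ θ hz.1.le (by linarith)
    simp only [h2]
    refine eq_zero_of_slant_gt hc hac hQ hx hz ?_
    rw [h1]
    linarith [hz.1]

theorem integrableOn_of_continuous_of_eq_zero {f : ℝ → ℂ} (hf : Continuous f) {W : ℝ}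
    (h : ∀ w, W < w → f w = 0) : IntegrableOn f (Set.Ici 0) := by
  refine IntegrableOn.of_forall_sdiff_eq_zero (s := Set.Icc 0 W)
    (hf.continuousOn.integrableOn_compact isCompact_Icc) measurableSet_Ici fun w hw => h w ?_
  by_contra hle
  exact hw.2 ⟨hw.1, not_lt.1 hle⟩

theorem continuous_slant (z : ℝ) : Continuous (slant z) := by
  unfold slant
  fun_prop

theorem continuous_boost (a : E2) (c z : ℝ) : Continuous (boost a c z) := by
  have := continuous_slant z
  unfold boost
  fun_prop

theorem sqrt_shift_mul (z w : ℝ) (hw : 0 ≤ w) :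
    √((√(w ^ 2 + z ^ 2) - z) * (√(w ^ 2 + z ^ 2) - z + 2 * z)) = w := by
  have h := Real.sq_sqrt (by positivity : 0 ≤ w ^ 2 + z ^ 2)
  rw [show (√(w ^ 2 + z ^ 2) - z) * (√(w ^ 2 + z ^ 2) - z + 2 * z) = w ^ 2 by nlinarith,
    Real.sqrt_sq hw]

include hc hac in
-- The substitution σ = √(w² + z²) - z has dσ = w dw/√(w² + z²). This absorbs both the polar
-- Jacobian w and the denominator, so the resulting integrand is regular down to σ = 0.
theorem integral_boosted_eq {g : E2 → ℂ} (hg : Continuous g) {Q : ℝ} (hQ0 : 0 ≤ Q)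
    (hQ : ∀ q, Q < ‖q‖ → g q = 0) (κ : ℝ) {ρ : ℝ} {x : E2}
    (hx : ‖x‖ < ρ) {z : ℝ} (hz : z ∈ Set.Ioo 0 ρ) :
    ∫ y, Complex.exp (Complex.I * (κ * slant z y : ℝ)) * g (x + boost a c z y) / (slant z y : ℝ) =
      ringIntegral κ (ringLength c Q ρ + 1) (c⁻¹ • a) (ringMean a c g) x z := by
  set S := ringLength c Q ρ with hS
  have hS0 : 0 ≤ S := by
    have := hz.1.trans hz.2
    rw [hS, ringLength]; positivity
  set H : E2 → ℂ := fun y =>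
    Complex.exp (Complex.I * (κ * slant z y : ℝ)) * g (x + boost a c z y) / (slant z y : ℝ) with hH
  have hsl := continuous_slant z
  have hbo := continuous_boost a c z
  have hHc : Continuous H := by
    refine Continuous.div (by fun_prop) (by fun_prop) fun y => ?_
    exact_mod_cast (slant_pos hz.1 y).ne'
  have hle : ∀ w, w ≤ √(w ^ 2 + z ^ 2) := fun w => Real.le_sqrt_of_sq_le (by nlinarith)
  have hH0 : ∀ w θ, S < w → H (w • circlePt θ) = 0 := fun w θ hw => by
    simp only [hH]
    rw [eq_zero_of_slant_gt hc hac hQ hx hz]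
    · simp
    · rw [slant_smul_circlePt]
      exact hw.trans_le (hle w)
  have hcirc := contDiff_circlePt.continuous
  have hf2 : Continuous fun v : ℝ × ℝ => v.1 • H (v.1 • circlePt v.2) := by fun_prop
  -- Fubini needs integrability on the unbounded polar domain; it holds because the integrand
  -- vanishes for w > S.
  have hkernel : IntegrableOn (fun v : ℝ × ℝ => v.1 • H (v.1 • circlePt v.2))
      (Set.Ioi (0 : ℝ) ×ˢ Set.Ioo (-Real.pi) Real.pi) := by
    refine IntegrableOn.of_forall_sdiff_eq_zero (s := Set.Icc 0 S ×ˢ Set.Icc (-Real.pi) Real.pi)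
      (hf2.continuousOn.integrableOn_compact (isCompact_Icc.prod isCompact_Icc))
      (measurableSet_Ioi.prod measurableSet_Ioo) fun v hv => ?_
    rw [hH0 v.1 v.2, smul_zero]
    by_contra hlt
    exact hv.2 ⟨⟨le_of_lt hv.1.1, not_lt.1 hlt⟩, Set.Ioo_subset_Icc_self hv.1.2⟩
  rw [integral_polar, Measure.volume_eq_prod, setIntegral_prod _ hkernel]
  set G : ℝ → ℂ := fun σ => Complex.exp (Complex.I * (κ * (z + σ) : ℝ)) *
    ringMean a c g (ringPoint (c⁻¹ • a) x z σ) with hG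
  have hGc : Continuous G :=
    continuous_ringIntegrand_right κ (c⁻¹ • a) (continuous_ringMean a c hg) x z
  have hG0 : ∀ σ, S < σ → G σ = 0 := fun σ hσ => by
    simp only [hG]
    rw [ringMean_vanish hc hac hQ hQ0 hx hz hσ, mul_zero]
  set f : ℝ → ℝ := fun w => √(w ^ 2 + z ^ 2) - z with hf
  have hfc : Continuous f := by fun_prop
  have hz2 : ∀ w : ℝ, 0 < w ^ 2 + z ^ 2 := fun w => by have := hz.1; positivity
  have hfd : ∀ w, HasDerivAt f (w / √(w ^ 2 + z ^ 2)) w := fun w => by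
    have h1 := (((hasDerivAt_pow 2 w).add_const (z ^ 2)).sqrt (hz2 w).ne').sub_const z
    refine h1.congr_deriv ?_
    have := (Real.sqrt_pos.2 (hz2 w)).ne'
    field_simp
    simp
  have hinner : ∀ w ∈ Set.Ioi (0 : ℝ), (∫ θ in Set.Ioo (-Real.pi) Real.pi, w • H (w • circlePt θ)) =
      (w / √(w ^ 2 + z ^ 2)) • (G ∘ f) w := fun w hw => by
    have hw' : (0 : ℝ) ≤ w := le_of_lt hw
    have hσ : 0 ≤ f w := by
      simp only [hf, sub_nonneg]
      exact Real.le_sqrt_of_sq_le (by nlinarith)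
    rw [← integral_Ioc_eq_integral_Ioo, ← intervalIntegral.integral_of_le (by linarith [Real.pi_pos])]
    simp only [Function.comp, hG, ringMean]
    rw [← intervalIntegral.integral_const_mul, ← intervalIntegral.integral_smul]
    refine intervalIntegral.integral_congr fun θ _ => ?_
    obtain ⟨h1, h2⟩ := boost_smul_circlePt a c x z (f w) θ hz.1.le hσ
    have h3 : √(f w * (f w + 2 * z)) = w := sqrt_shift_mul z w hw'
    rw [h3] at h1 h2
    simp only [h2, hH, h1, Complex.real_smul]
    have h4 : z + f w = √(w ^ 2 + z ^ 2) := by simp [hf]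
    rw [h4]
    push_cast
    ring
  rw [setIntegral_congr_fun measurableSet_Ioi hinner]
  have hf0 : f 0 = 0 := by simp [hf, Real.sqrt_sq hz.1.le]
  rw [integral_deriv_smul_comp_Ioi (f := f) (f' := fun w => w / √(w ^ 2 + z ^ 2)) (g := G)
    hfc.continuousOn ?_ (fun w _ => (hfd w).hasDerivWithinAt) hGc.continuousOn ?_ ?_, hf0]
  · rw [ringIntegral, intervalIntegral.integral_of_le (by linarith)]
    refine (setIntegral_eq_of_subset_of_forall_sdiff_eq_zero measurableSet_Ioi
      Set.Ioc_subset_Ioi_self fun σ hσ => hG0 σ ?_)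
    by_contra hlt
    exact hσ.2 ⟨hσ.1, by linarith [not_lt.1 hlt]⟩
  · refine tendsto_atTop_mono (f := fun w => w - z) (fun w => ?_)
      (tendsto_atTop_add_const_right _ _ tendsto_id)
    simp only [hf]
    linarith [hle w]
  · refine (integrableOn_of_continuous_of_eq_zero hGc hG0).mono_set ?_
    rintro _ ⟨w, hw, rfl⟩
    simp only [hf, Set.mem_Ici, sub_nonneg]
    exact Real.le_sqrt_of_sq_le (by nlinarith)
  -- Since σ = √(w² + z²) - z ≥ w - z, radii w > S + z give σ > S.
  · refine integrableOn_of_continuous_of_eq_zero (W := S + z) ?_ fun w hw => ?_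
    · have h1 : Continuous fun w : ℝ => w / √(w ^ 2 + z ^ 2) :=
        continuous_id.div (by fun_prop) fun w => (Real.sqrt_pos.2 (hz2 w)).ne'
      exact h1.smul (hGc.comp hfc)
    · simp only [Function.comp]
      rw [hG0, smul_zero]
      simp only [hf]
      linarith [hle w]

include hc hac in
-- Centre the integral at x, which releases the factor e^{ik a·x}, and then boost: the remaining
-- phase k(a·y + slant) becomes kc·slant.
theorem integral_wave_eq_ringIntegral {g : E2 → ℂ} (hg : Continuous g) {Q : ℝ} (hQ0 : 0 ≤ Q)
    (hQ : ∀ q, Q < ‖q‖ → g q = 0) (k : ℝ) {ρ : ℝ} {x : E2}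
    (hx : ‖x‖ < ρ) {z : ℝ} (hz : z ∈ Set.Ioo 0 ρ) :
    ∫ q, g q * Complex.exp (Complex.I * (k * inner ℝ a q : ℝ)) *
        (Complex.exp (Complex.I * (k * slant z (x - q) : ℝ)) / (slant z (x - q) : ℝ)) =
      Complex.exp (Complex.I * (k * inner ℝ a x : ℝ)) *
        ringIntegral (k * c) (ringLength c Q ρ + 1) (c⁻¹ • a) (ringMean a c g) x z := by
  rw [← integral_boosted_eq hc hac hg hQ0 hQ (k * c) hx hz, ← integral_const_mul,
    ← integral_add_left_eq_self _ x]
  have h := integral_boost hc hac hz.1 (fun y => g (x + y) *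
    Complex.exp (Complex.I * (k * inner ℝ a (x + y) : ℝ)) *
    Complex.exp (Complex.I * (k * slant z y : ℝ)))
  have hneg : ∀ y : E2, slant z (x - (x + y)) = slant z y := fun y => by simp [slant]
  simp only [hneg]
  refine Eq.trans ?_ (h.trans ?_)
  · congr 1; ext1 y; ring
  · congr 1
    ext1 y
    have h2 := slant_add_inner_boost hc hac z y
    rw [mul_assoc (g _), ← Complex.exp_add, ← mul_div_assoc, ← mul_assoc, ← Complex.exp_add,
      mul_comm (g _), ← mul_add, ← mul_add, ← Complex.ofReal_add, ← Complex.ofReal_add,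
      inner_add_right]
    have h3 : k * (inner ℝ a x + inner ℝ a (boost a c z y)) + k * slant z (boost a c z y) =
      k * inner ℝ a x + k * c * slant z y := by linear_combination k * h2
    rw [h3]

end Formula

/-! ### Layer potentials and their derivatives off the support -/

/-- The potential with the kernel `K` and the density `G` on the image of `τ`. -/
def layer (τ : E2 →ᵃⁱ[ℝ] E3) (K : E3 → ℂ) (G : E2 → ℂ) (r : E3) : ℂ := ∫ q, G q * K (r - τ q)

section Layer

variable {τ : E2 →ᵃⁱ[ℝ] E3} {K : E3 → ℂ} {G : E2 → ℂ}

theorem hasFDerivAt_affineIsometry (τ : E2 →ᵃⁱ[ℝ] E3) (q : E2) :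
    HasFDerivAt τ τ.linearIsometry.toContinuousLinearMap q := by
  have h : (τ : E2 → E3) = fun q => τ.linearIsometry q + τ 0 := by
    ext1 q
    have := τ.map_vadd 0 q
    simpa using this
  rw [h]
  exact τ.linearIsometry.toContinuousLinearMap.hasFDerivAt.add_const _

theorem contDiff_affineIsometry (τ : E2 →ᵃⁱ[ℝ] E3) : ContDiff ℝ ∞ τ := by
  have h : (τ : E2 → E3) = fun q => τ.linearIsometry q + τ 0 := by
    ext1 q
    have := τ.map_vadd 0 q
    simpa using this
  rw [h]
  exact τ.linearIsometry.toContinuousLinearMap.contDiff.add contDiff_const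

theorem ContDiffOn.dirDeriv_compl_zero (hK : ContDiffOn ℝ ∞ K {0}ᶜ) (v : E3) :
    ContDiffOn ℝ ∞ (dirDeriv v K) {0}ᶜ :=
  (hK.fderiv_of_isOpen isOpen_compl_singleton (m := ∞) (by simp)).clm_apply contDiffOn_const

theorem continuous_mul_of_continuousAt_tsupport {F : Type} [NormedAddCommGroup F] [NormedSpace ℂ F]
    (hG : Continuous G) {f : E2 → F} (hf : ∀ q ∈ tsupport G, ContinuousAt f q) :
    Continuous fun q => G q • f q := by
  refine continuous_of_tsupport fun q hq => hG.continuousAt.smul (hf q ?_)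
  exact closure_mono (fun x (hx : G x • f x ≠ 0) (h0 : G x = 0) => hx (by simp [h0])) hq

theorem integrable_smul_of_continuousAt_tsupport {F : Type} [NormedAddCommGroup F] [NormedSpace ℂ F]
    (hG : Continuous G) (hGc : HasCompactSupport G) {f : E2 → F}
    (hf : ∀ q ∈ tsupport G, ContinuousAt f q) : Integrable fun q => G q • f q :=
  (continuous_mul_of_continuousAt_tsupport hG hf).integrable_of_hasCompactSupport
    (hGc.mono fun x hx hG => hx (by simp [hG]))

theorem sub_ne_zero_of_notMem {A : Set E2} {r : E3} (hr : r ∉ τ '' A) {q : E2} (hq : q ∈ A) :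
    r - τ q ≠ 0 := fun h => hr ⟨q, hq, (sub_eq_zero.1 h).symm⟩

theorem continuousAt_kernel {F : Type} [NormedAddCommGroup F] [NormedSpace ℝ F] {K : E3 → F}
    (hK : ContinuousOn K {0}ᶜ) {r : E3} (hr : r ∉ τ '' tsupport G) {q : E2} (hq : q ∈ tsupport G) :
    ContinuousAt (fun q => K (r - τ q)) q := by
  have h1 : ContinuousAt K (r - τ q) :=
    hK.continuousAt (isOpen_compl_singleton.mem_nhds (sub_ne_zero_of_notMem hr hq))
  exact h1.comp_of_eq (continuousAt_const.sub τ.continuous.continuousAt) rfl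

theorem isOpen_compl_image_tsupport (hGc : HasCompactSupport G) : IsOpen (τ '' tsupport G)ᶜ :=
  (hGc.isCompact.image τ.continuous).isClosed.isOpen_compl

/-- For r' in a small closed ball about r and q in the compact support, the differences r' - τ q
form a compact set that avoids 0. The kernel derivative is bounded there, which dominates the
differentiated integrand. -/
theorem hasFDerivAt_layer (hG : Continuous G) (hGc : HasCompactSupport G)
    (hK : ContDiffOn ℝ ∞ K {0}ᶜ) {r : E3} (hr : r ∉ τ '' tsupport G) :
    HasFDerivAt (layer τ K G) (∫ q, G q • fderiv ℝ K (r - τ q)) r := by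
  have hKc := hK.continuousOn
  have hK' : ContinuousOn (fderiv ℝ K) {0}ᶜ :=
    hK.continuousOn_fderiv_of_isOpen isOpen_compl_singleton (by simp)
  have ho := isOpen_compl_image_tsupport (τ := τ) hGc
  obtain ⟨ε, hε, hball⟩ := Metric.nhds_basis_closedBall.mem_iff.1 (ho.mem_nhds hr)
  have hcomp : IsCompact ((fun v : E3 × E2 => v.1 - τ v.2) '' (Metric.closedBall r ε ×ˢ tsupport G)) := by
    refine ((isCompact_closedBall r ε).prod hGc.isCompact).image ?_
    have := τ.continuous
    fun_prop
  obtain ⟨B, hB⟩ := hcomp.exists_bound_of_continuousOn (hK'.mono (by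
    rintro _ ⟨v, ⟨h1, h2⟩, rfl⟩
    exact sub_ne_zero_of_notMem (hball h1) h2))
  refine hasFDerivAt_integral_of_dominated_of_fderiv_le (s := Metric.ball r ε)
    (bound := fun q => ‖G q‖ * B) (F := fun r q => G q * K (r - τ q))
    (F' := fun r q => G q • fderiv ℝ K (r - τ q)) (Metric.ball_mem_nhds r hε) ?_ ?_ ?_ ?_ ?_ ?_
  · filter_upwards [ho.mem_nhds hr] with r' hr'
    exact (continuous_mul_of_continuousAt_tsupport hG fun q hq =>
      continuousAt_kernel hKc hr' hq).aestronglyMeasurable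
  · exact integrable_smul_of_continuousAt_tsupport hG hGc fun q hq => continuousAt_kernel hKc hr hq
  · exact (continuous_mul_of_continuousAt_tsupport hG fun q hq =>
      continuousAt_kernel hK' hr hq).aestronglyMeasurable
  · refine Eventually.of_forall fun q r' hr' => ?_
    rw [norm_smul]
    by_cases hq : q ∈ tsupport G
    · exact mul_le_mul_of_nonneg_left (hB _ ⟨(r', q), ⟨Metric.ball_subset_closedBall hr', hq⟩, rfl⟩)
        (norm_nonneg _)
    · simp [image_eq_zero_of_notMem_tsupport hq]
  · exact (hG.norm.integrable_of_hasCompactSupport hGc.norm).mul_const B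
  · refine Eventually.of_forall fun q r' hr' => ?_
    by_cases hq : q ∈ tsupport G
    · have h1 : HasFDerivAt K (fderiv ℝ K (r' - τ q)) (r' - τ q) :=
        ((hK.differentiableOn (by simp)).differentiableAt (isOpen_compl_singleton.mem_nhds
          (sub_ne_zero_of_notMem (hball (Metric.ball_subset_closedBall hr')) hq))).hasFDerivAt
      have h2 : HasFDerivAt (fun r' => K (r' - τ q)) (fderiv ℝ K (r' - τ q)) r' :=
        h1.comp r' ((hasFDerivAt_id r').sub_const (τ q))
      exact h2.const_mul (G q)
    · have h0 := image_eq_zero_of_notMem_tsupport hq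
      simp only [h0, zero_mul]
      refine (hasFDerivAt_const (𝕜 := ℝ) (0 : ℂ) r').congr_fderiv ?_
      ext v
      simp

theorem fderiv_layer_apply (hG : Continuous G) (hGc : HasCompactSupport G)
    (hK : ContDiffOn ℝ ∞ K {0}ᶜ) {r : E3} (hr : r ∉ τ '' tsupport G) (v : E3) :
    fderiv ℝ (layer τ K G) r v = layer τ (dirDeriv v K) G r := by
  rw [(hasFDerivAt_layer hG hGc hK hr).fderiv, ContinuousLinearMap.integral_apply]
  · rfl
  · refine integrable_smul_of_continuousAt_tsupport hG hGc fun q hq => ?_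
    exact continuousAt_kernel
      (hK.continuousOn_fderiv_of_isOpen isOpen_compl_singleton (by simp)) hr hq

theorem continuousAt_layer (hG : Continuous G) (hGc : HasCompactSupport G)
    (hK : ContDiffOn ℝ ∞ K {0}ᶜ) {r : E3} (hr : r ∉ τ '' tsupport G) :
    ContinuousAt (layer τ K G) r :=
  (hasFDerivAt_layer hG hGc hK hr).continuousAt

/-- A tangential derivative of the kernel can be moved onto the density. -/
theorem layer_dirDeriv_tangent (hG : ContDiff ℝ ∞ G) (hGc : HasCompactSupport G)
    (hK : ContDiffOn ℝ ∞ K {0}ᶜ) {r : E3} (hr : r ∉ τ '' tsupport G) (e : E2) :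
    layer τ (dirDeriv (τ.linear e) K) G r = layer τ K (dirDeriv e G) r := by
  have hKc := hK.continuousOn
  have hd : ∀ q ∈ tsupport G, HasFDerivAt (fun q => K (r - τ q))
      ((fderiv ℝ K (r - τ q)).comp (-τ.linearIsometry.toContinuousLinearMap)) q := fun q hq => by
    have h1 : HasFDerivAt K (fderiv ℝ K (r - τ q)) (r - τ q) :=
      ((hK.differentiableOn (by simp)).differentiableAt (isOpen_compl_singleton.mem_nhds
        (sub_ne_zero_of_notMem hr hq))).hasFDerivAt
    exact h1.comp q ((hasFDerivAt_affineIsometry τ q).const_sub r)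
  -- The point r may lie in the plane, where the kernel is singular at some q outside the support of
  -- G; at such q both sides vanish.
  have heq : ∀ q, G q * fderiv ℝ (fun q => K (r - τ q)) q e =
      -(G q * dirDeriv (τ.linear e) K (r - τ q)) := fun q => by
    by_cases hq : q ∈ tsupport G
    · rw [(hd q hq).fderiv]
      simp [dirDeriv]
    · simp [image_eq_zero_of_notMem_tsupport hq]
  have hsub : tsupport (fun q => fderiv ℝ G q e) ⊆ tsupport G :=
    tsupport_fderiv_apply_subset ℝ e
  have hG'c : HasCompactSupport (fun q => fderiv ℝ G q e) := hGc.fderiv_apply ℝ e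
  have hi1 : Integrable fun q => G q * dirDeriv (τ.linear e) K (r - τ q) :=
    integrable_smul_of_continuousAt_tsupport hG.continuous hGc fun q hq =>
      continuousAt_kernel (ContDiffOn.dirDeriv_compl_zero hK _).continuousOn hr hq
  have h := integral_mul_fderiv_eq_neg_fderiv_mul_of_integrable (μ := volume) (f := G)
    (g := fun q => K (r - τ q)) (v := e)
    (integrable_smul_of_continuousAt_tsupport (ContDiff.dirDeriv hG e).continuous hG'c
      fun q hq => continuousAt_kernel hKc hr (hsub hq))
    (by simp only [heq]; exact hi1.neg)
    (integrable_smul_of_continuousAt_tsupport hG.continuous hGc fun q hq =>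
      continuousAt_kernel hKc hr hq)
    (fun q _ => hG.differentiable (by simp) q) (fun q hq => (hd q hq).differentiableAt)
  simp only [heq, integral_neg, neg_inj] at h
  exact h

end Layer

/-! ### The spherical kernel -/

/-- The kernel of the outgoing spherical wave. -/
def sphericalKernel (k : ℝ) (v : E3) : ℂ := Complex.exp (Complex.I * (k * ‖v‖ : ℝ)) / (‖v‖ : ℝ)

theorem contDiffOn_sphericalKernel (k : ℝ) : ContDiffOn ℝ ∞ (sphericalKernel k) {0}ᶜ := by
  intro v hv
  have h1 : ContDiffAt ℝ ∞ (fun v : E3 => ‖v‖) v := contDiffAt_norm ℝ hv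
  have h2 : ContDiffAt ℝ ∞ (fun v : E3 => ((‖v‖ : ℝ) : ℂ)) v :=
    Complex.ofRealCLM.contDiff.contDiffAt.comp v h1
  have h3 : ContDiffAt ℝ ∞ (fun v : E3 => ((k * ‖v‖ : ℝ) : ℂ)) v :=
    Complex.ofRealCLM.contDiff.contDiffAt.comp v (contDiffAt_const.mul h1)
  have h4 : ContDiffAt ℝ ∞ (fun v : E3 => Complex.exp (Complex.I * (k * ‖v‖ : ℝ))) v :=
    (contDiffAt_const.mul h3).cexp
  have h5 : ((‖v‖ : ℝ) : ℂ) ≠ 0 := by exact_mod_cast norm_ne_zero_iff.2 hv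
  refine ContDiffAt.contDiffWithinAt ?_
  unfold sphericalKernel
  simp only [div_eq_mul_inv]
  exact h4.mul (h2.inv h5)

theorem fderiv_sphericalWave (k : ℝ) (r p n : E3) :
    fderiv ℝ (fun p : E3 => sphericalWave k r p) p n = -dirDeriv n (sphericalKernel k) (r - p) := by
  have h : (fun p : E3 => sphericalWave k r p) = fun p => sphericalKernel k (-(p - r)) := by
    ext1 p; rw [neg_sub]; rfl
  have h2 := (ContinuousLinearEquiv.neg ℝ (M := E3)).comp_right_fderiv (f := sphericalKernel k)
    (x := p - r)
  rw [h, fderiv_comp_sub (f := fun u => sphericalKernel k (-u))]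
  have h3 : fderiv ℝ (fun u => sphericalKernel k (-u)) (p - r) = _ := h2
  rw [h3]
  simp [dirDeriv]

/-! ### Height derivatives of the oscillatory integral and their size -/

/-- The derivative of `ringIntegral` in the height. -/
def ringDeriv (κ S : ℝ) (b : E2) (p : RaySpace → ℂ) (x : E2) (z : ℝ) : ℂ :=
  -(Complex.exp (Complex.I * (κ * z : ℝ)) * p ((z, x - z • b), 0)) -
    z * ringIntegral κ S b (radialQuot p) x z

/-- The second derivative of `ringIntegral` in the height. -/
def ringDeriv₂ (κ S : ℝ) (b : E2) (p : RaySpace → ℂ) (x : E2) (z : ℝ) : ℂ :=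
  -(Complex.I * κ * Complex.exp (Complex.I * (κ * z : ℝ)) * p ((z, x - z • b), 0) +
      Complex.exp (Complex.I * (κ * z : ℝ)) * dirDeriv (rayDir b) p ((z, x - z • b), 0)) -
    (ringIntegral κ S b (radialQuot p) x z + z * ringDeriv κ S b (radialQuot p) x z)

/-- The radial quotient is itself even and vanishes at the far end, so the formula for the first
derivative applies to it in turn. -/
theorem hasDerivAt_ringDeriv {κ S : ℝ} {b x : E2} {p : RaySpace → ℂ} {z : ℝ}
    (hp : ContDiff ℝ ∞ p) (he : IsEven p) (hz : 0 < z) (hS : 0 ≤ S)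
    (h0 : radialQuot p (ringPoint b x z S) = 0) :
    HasDerivAt (fun z => ringDeriv κ S b p x z) (ringDeriv₂ κ S b p x z) z := by
  have h1 := hasDerivAt_ringIntegral (κ := κ) (contDiff_radialQuot hp) (he.radialQuot hp) hz hS h0
  have h2 := hasDerivAt_exp_phase κ z (hasDerivAt_id z)
  have h3 : HasDerivAt (fun z : ℝ => (((z, x - z • b), 0) : RaySpace)) (rayDir b) z := by
    refine HasDerivAt.prodMk ((hasDerivAt_id z).prodMk ?_) (hasDerivAt_const z (0 : ℝ))
    simpa using ((hasDerivAt_id z).smul_const b).const_sub x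
  have h4 := ((hp.differentiable (by simp) ((z, x - z • b), 0)).hasFDerivAt).comp_hasDerivAt z h3
  have h5 : HasDerivAt (fun z : ℝ => (z : ℂ)) 1 z := (hasDerivAt_id z).ofReal_comp
  refine ((h2.mul h4).neg.sub (h5.mul h1)).congr_deriv ?_
  simp only [ringDeriv₂, ringDeriv, dirDeriv, id, one_mul, Function.comp]

theorem continuous_ringCenter (b : E2) :
    Continuous fun v : E2 × ℝ => (((v.2, v.1 - v.2 • b), 0) : RaySpace) := by fun_prop

theorem continuous_ringDeriv (κ S : ℝ) (b : E2) {p : RaySpace → ℂ} (hp : ContDiff ℝ ∞ p) :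
    Continuous fun v : E2 × ℝ => ringDeriv κ S b p v.1 v.2 := by
  have h1 := hp.continuous.comp (continuous_ringCenter b)
  have h2 := continuous_ringIntegral κ S b (contDiff_radialQuot hp).continuous
  have h3 : Continuous fun v : E2 × ℝ => Complex.exp (Complex.I * (κ * v.2 : ℝ)) := by fun_prop
  exact (h3.mul h1).neg.sub ((Complex.continuous_ofReal.comp continuous_snd).mul h2)

theorem continuous_ringDeriv₂ (κ S : ℝ) (b : E2) {p : RaySpace → ℂ} (hp : ContDiff ℝ ∞ p) :
    Continuous fun v : E2 × ℝ => ringDeriv₂ κ S b p v.1 v.2 := by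
  have h1 := hp.continuous.comp (continuous_ringCenter b)
  have h1' := (ContDiff.dirDeriv hp (rayDir b)).continuous.comp (continuous_ringCenter b)
  have h2 := continuous_ringIntegral κ S b (contDiff_radialQuot hp).continuous
  have h2' := continuous_ringDeriv κ S b (contDiff_radialQuot hp)
  have h3 : Continuous fun v : E2 × ℝ => Complex.exp (Complex.I * (κ * v.2 : ℝ)) := by fun_prop
  exact (((continuous_const.mul h3).mul h1).add (h3.mul h1')).neg.sub
    (h2.add ((Complex.continuous_ofReal.comp continuous_snd).mul h2'))

section Estimates

variable {δ : ℝ} {b : E2} {T ρ S : ℝ} {X : Set E2} {N : ℝ} {p : ℝ → RaySpace → ℂ}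

/-- The boundary term dominates: the integral of the radial quotient has order N + 2, hence size
k^{δ(N+2)-1}, and 2δ ≤ 1. -/
theorem IsRaySymbol.ringDeriv_bound (hp : IsRaySymbol δ b T ρ S X N p) (hδ : 0 ≤ δ)
    (hδ₁ : δ < 1 / 2) (hS : 0 ≤ S) (hρ : 0 ≤ ρ) (hT : ρ + S + 1 ≤ T) {c : ℝ} (hc : 0 < c) :
    ∃ C : ℝ, 0 ≤ C ∧ ∀ k : ℝ, 1 < k → ∀ x ∈ X, ∀ z ∈ Set.Ioo 0 ρ,
      ‖ringDeriv (k * c) (S + 1) b (p k) x z‖ ≤ C * k ^ (δ * N) := by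
  obtain ⟨C₀, h₀, hC₀⟩ := hp.symbol.norm_le
  obtain ⟨C₁, h₁, hC₁⟩ := (hp.radialQuot hS).ringIntegral_bound hδ hδ₁ hS hT hc
  refine ⟨C₀ + ρ * C₁, by positivity, fun k hk x hx z hz => ?_⟩
  rw [ringDeriv, add_mul]
  refine (norm_sub_le _ _).trans (add_le_add ?_ ?_)
  · rw [norm_neg, norm_mul, norm_exp_I_mul, one_mul]
    exact hC₀ k hk _ (ringCenter_mem_strip hT hS hz _ _)
  · rw [norm_mul, Complex.norm_real, Real.norm_of_nonneg hz.1.le, mul_assoc]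
    refine mul_le_mul hz.2.le ((hC₁ k hk x hx z hz).trans ?_) (norm_nonneg _) hρ
    have := hk.le
    gcongr
    linarith

theorem IsRaySymbol.ringDeriv₂_bound (hp : IsRaySymbol δ b T ρ S X N p) (hδ : 0 ≤ δ)
    (hδ₁ : δ < 1 / 2) (hS : 0 ≤ S) (hρ : 0 ≤ ρ) (hT : ρ + S + 1 ≤ T) {c : ℝ} (hc : 0 < c) :
    ∃ C : ℝ, 0 ≤ C ∧ ∀ k : ℝ, 1 < k → ∀ x ∈ X, ∀ z ∈ Set.Ioo 0 ρ,
      ‖ringDeriv₂ (k * c) (S + 1) b (p k) x z‖ ≤ C * k ^ (δ * N + 1) := by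
  obtain ⟨C₀, h₀, hC₀⟩ := hp.symbol.norm_le
  obtain ⟨C₀', h₀', hC₀'⟩ := (hp.symbol.dirDeriv (rayDir b)).norm_le
  obtain ⟨C₁, h₁, hC₁⟩ := (hp.radialQuot hS).ringIntegral_bound hδ hδ₁ hS hT hc
  obtain ⟨C₂, h₂, hC₂⟩ := (hp.radialQuot hS).ringDeriv_bound hδ hδ₁ hS hρ hT hc
  refine ⟨c * C₀ + C₀' + (C₁ + ρ * C₂), by positivity, fun k hk x hx z hz => ?_⟩
  have hk0 : 0 < k := by linarith
  have hk1 := hk.le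
  rw [ringDeriv₂, add_mul, add_mul, add_mul]
  refine (norm_sub_le _ _).trans (add_le_add ?_ ?_)
  · rw [norm_neg]
    refine (norm_add_le _ _).trans (add_le_add ?_ ?_)
    · rw [norm_mul, norm_mul, norm_mul, norm_exp_I_mul, Complex.norm_I, Complex.norm_real,
        Real.norm_of_nonneg (by positivity), one_mul, mul_one, Real.rpow_add_one hk0.ne']
      have := hC₀ k hk _ (ringCenter_mem_strip hT hS hz (x - z • b) 0)
      calc _ ≤ k * c * (C₀ * k ^ (δ * N)) := by gcongr
        _ = _ := by ring
    · rw [norm_mul, norm_exp_I_mul, one_mul]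
      refine (hC₀' k hk _ (ringCenter_mem_strip hT hS hz _ _)).trans ?_
      gcongr
      linarith
  · refine (norm_add_le _ _).trans (add_le_add ?_ ?_)
    · refine (hC₁ k hk x hx z hz).trans ?_
      gcongr
      linarith
    · rw [norm_mul, Complex.norm_real, Real.norm_of_nonneg hz.1.le, mul_assoc]
      refine mul_le_mul hz.2.le ((hC₂ k hk x hx z hz).trans ?_) (norm_nonneg _) hρ
      gcongr
      linarith

/-- Where p is locally constant the radial quotient vanishes near the start of the curve, so even
its leading boundary term disappears. -/
theorem IsRaySymbol.ringIntegral_radialQuot_asymp (hp : IsRaySymbol δ b T ρ S X N p) (hδ : 0 ≤ δ)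
    (hδ₁ : δ < 1 / 2) (hS : 0 ≤ S) (hT : ρ + S + 1 ≤ T) {c : ℝ} (hc : 0 < c) (B : ℝ) :
    ∃ C : ℝ, 0 ≤ C ∧ ∀ k : ℝ, 1 < k → ∀ x ∈ X, ∀ z ∈ Set.Ioo 0 ρ,
      (∃ a : ℂ, p k =ᶠ[𝓝 ((z, x - z • b), 0)] fun _ => a) →
      ‖ringIntegral (k * c) (S + 1) b (KirchhoffPolygon.radialQuot (p k)) x z‖ ≤ C * k ^ (-B) := by
  obtain ⟨C, h, hC⟩ := (hp.radialQuot hS).ringIntegral_asymp hδ hδ₁ hS hT hc B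
  refine ⟨C, h, fun k hk x hx z hz ⟨a, ha⟩ => ?_⟩
  have h0 := radialQuot_eventuallyEq_zero ha
  have h1 := hC k hk x hx z hz ⟨0, h0⟩
  rw [h0.eq_of_nhds] at h1
  simpa using h1

theorem IsRaySymbol.ringDeriv_asymp (hp : IsRaySymbol δ b T ρ S X N p) (hδ : 0 ≤ δ)
    (hδ₁ : δ < 1 / 2) (hS : 0 ≤ S) (hρ : 0 ≤ ρ) (hT : ρ + S + 1 ≤ T) {c : ℝ} (hc : 0 < c) (B : ℝ) :
    ∃ C : ℝ, 0 ≤ C ∧ ∀ k : ℝ, 1 < k → ∀ x ∈ X, ∀ z ∈ Set.Ioo 0 ρ,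
      (∃ a : ℂ, p k =ᶠ[𝓝 ((z, x - z • b), 0)] fun _ => a) →
      ‖ringDeriv (k * c) (S + 1) b (p k) x z + Complex.exp (Complex.I * (k * c * z : ℝ)) *
        p k ((z, x - z • b), 0)‖ ≤ C * k ^ (-B) := by
  obtain ⟨C, h, hC⟩ := hp.ringIntegral_radialQuot_asymp hδ hδ₁ hS hT hc B
  refine ⟨ρ * C, by positivity, fun k hk x hx z hz ha => ?_⟩
  rw [ringDeriv, show ∀ u v : ℂ, -u - v + u = -v by intros; ring, norm_neg, norm_mul,
    Complex.norm_real, Real.norm_of_nonneg hz.1.le, mul_assoc]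
  exact mul_le_mul hz.2.le (hC k hk x hx z hz ha) (norm_nonneg _) hρ

theorem IsRaySymbol.ringDeriv₂_asymp (hp : IsRaySymbol δ b T ρ S X N p) (hδ : 0 ≤ δ)
    (hδ₁ : δ < 1 / 2) (hS : 0 ≤ S) (hρ : 0 ≤ ρ) (hT : ρ + S + 1 ≤ T) {c : ℝ} (hc : 0 < c) (B : ℝ) :
    ∃ C : ℝ, 0 ≤ C ∧ ∀ k : ℝ, 1 < k → ∀ x ∈ X, ∀ z ∈ Set.Ioo 0 ρ,
      (∃ a : ℂ, p k =ᶠ[𝓝 ((z, x - z • b), 0)] fun _ => a) →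
      ‖ringDeriv₂ (k * c) (S + 1) b (p k) x z + Complex.I * (k * c : ℝ) *
        (Complex.exp (Complex.I * (k * c * z : ℝ)) * p k ((z, x - z • b), 0))‖ ≤ C * k ^ (-B) := by
  obtain ⟨C, h, hC⟩ := hp.ringIntegral_radialQuot_asymp hδ hδ₁ hS hT hc B
  obtain ⟨C', h', hC'⟩ := (hp.radialQuot hS).ringDeriv_asymp hδ hδ₁ hS hρ hT hc B
  refine ⟨C + ρ * C', by positivity, fun k hk x hx z hz ⟨a, ha⟩ => ?_⟩
  have h0 := radialQuot_eventuallyEq_zero ha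
  have h1 := hC' k hk x hx z hz ⟨0, h0⟩
  have h2 := hC k hk x hx z hz ⟨a, ha⟩
  rw [h0.eq_of_nhds, mul_zero, add_zero] at h1
  rw [ringDeriv₂, (dirDeriv_eventuallyEq_zero ha (rayDir b)).eq_of_nhds, mul_zero, add_zero,
    mul_assoc (Complex.I * _), show ∀ u v : ℂ, -u - v + u = -v by intros; ring, add_mul, norm_neg]
  refine (norm_add_le _ _).trans (add_le_add h2 ?_)
  rw [norm_mul, Complex.norm_real, Real.norm_of_nonneg hz.1.le, mul_assoc]
  exact mul_le_mul hz.2.le h1 (norm_nonneg _) hρ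

end Estimates

/-! ### Plane densities and exact formulas for the layers -/

/-- A symbol on the plane with support in the ball of radius `Q`. -/
structure IsPlaneSymbol (δ Q N : ℝ) (g : ℝ → E2 → ℂ) : Prop where
  symbol : IsSymbol δ Set.univ N g
  eq_zero : ∀ k : ℝ, 1 < k → ∀ q, Q < ‖q‖ → g k q = 0

section Density

variable {δ Q N : ℝ} {g : ℝ → E2 → ℂ} {a : E2} {c : ℝ}

theorem IsPlaneSymbol.ringMean (hg : IsPlaneSymbol δ Q N g) (hc : 0 < c)
    (hac : ‖a‖ ^ 2 + c ^ 2 = 1) (hQ : 0 ≤ Q) (ρ : ℝ) :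
    IsRaySymbol δ (c⁻¹ • a) (ρ + ringLength c Q ρ + 1) ρ (ringLength c Q ρ) (Metric.ball 0 ρ) N
      (fun k => ringMean a c (g k)) where
  symbol := hg.symbol.ringMean a c _
  even k _ := isEven_ringMean a c (g k)
  vanish k hk _ hx _ hz _ hσ := ringMean_vanish hc hac (hg.eq_zero k hk) hQ
    (mem_ball_zero_iff.1 hx) hz hσ

theorem IsPlaneSymbol.dirDeriv (hg : IsPlaneSymbol δ Q N g) (e : E2) :
    IsPlaneSymbol δ Q (N + 1) (fun k => dirDeriv e (g k)) where
  symbol := hg.symbol.dirDeriv e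
  eq_zero k hk q hq := by
    refine (dirDeriv_eventuallyEq_zero (a := 0) ?_ e).eq_of_nhds
    filter_upwards [continuous_norm.continuousAt.eventually (lt_mem_nhds hq)] with q' hq'
      using hg.eq_zero k hk q' hq'

theorem IsPlaneSymbol.hasCompactSupport (hg : IsPlaneSymbol δ Q N g) {k : ℝ} (hk : 1 < k) :
    HasCompactSupport (g k) :=
  HasCompactSupport.of_support_subset_isCompact (isCompact_closedBall (0 : E2) Q) fun q hq => by
    rw [mem_closedBall_zero_iff]
    exact not_lt.1 fun h => hq (hg.eq_zero k hk q h)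

end Density

/-- The density `g e^{ik (α · q)}` on the image of `τ`. -/
def waveDensity (τ : E2 →ᵃⁱ[ℝ] E3) (α : E3) (k : ℝ) (g : E2 → ℂ) (q : E2) : ℂ :=
  g q * planeWave k α (τ q)

theorem contDiff_planeWave (k : ℝ) (α : E3) : ContDiff ℝ ∞ (planeWave k α) := by
  unfold planeWave
  have h : ContDiff ℝ ∞ fun r : E3 => ((k * inner ℝ α r : ℝ) : ℂ) :=
    Complex.ofRealCLM.contDiff.comp (contDiff_const.mul (contDiff_const.inner ℝ contDiff_id))
  exact (contDiff_const.mul h).cexp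

section Formula

variable {τ : E2 →ᵃⁱ[ℝ] E3} {α : E3} {k : ℝ} {g : E2 → ℂ}

theorem contDiff_waveDensity (hg : ContDiff ℝ ∞ g) : ContDiff ℝ ∞ (waveDensity τ α k g) :=
  hg.mul ((contDiff_planeWave k α).comp (contDiff_affineIsometry τ))

theorem tsupport_waveDensity_subset (g : E2 → ℂ) :
    tsupport (waveDensity τ α k g) ⊆ tsupport g :=
  closure_mono fun q hq h => hq (by simp [waveDensity, show g q = 0 from h])

theorem hasCompactSupport_waveDensity (hg : HasCompactSupport g) :
    HasCompactSupport (waveDensity τ α k g) :=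
  hg.mono fun q hq h => hq (by simp [waveDensity, show g q = 0 from h])

theorem affineIsometry_apply (τ : E2 →ᵃⁱ[ℝ] E3) (q : E2) : τ q = τ.linear q + τ 0 := by
  have := τ.map_vadd 0 q
  simpa using this

theorem fderiv_planeWave (k : ℝ) (α r v : E3) :
    fderiv ℝ (planeWave k α) r v = Complex.I * (k * inner ℝ α v : ℝ) * planeWave k α r := by
  have h1 : HasFDerivAt (fun r : E3 => inner ℝ α r) (innerSL ℝ α) r := (innerSL ℝ α).hasFDerivAt
  have h2 : HasFDerivAt (fun r : E3 => ((k * inner ℝ α r : ℝ) : ℂ))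
      (Complex.ofRealCLM.comp (k • innerSL ℝ α)) r :=
    Complex.ofRealCLM.hasFDerivAt.comp r (h1.const_mul k)
  have h3 := (h2.const_mul Complex.I).cexp
  have h4 : fderiv ℝ (planeWave k α) r = _ := h3.fderiv
  rw [h4]
  simp [planeWave]
  ring

variable {a : E2} (ha : ∀ v : E2, inner ℝ α (τ.linear v) = inner ℝ a v)

include ha in
theorem dirDeriv_waveDensity (hg : ContDiff ℝ ∞ g) (e : E2) :
    dirDeriv e (waveDensity τ α k g) = fun q => waveDensity τ α k (dirDeriv e g) q +
      Complex.I * (k * inner ℝ a e : ℝ) * waveDensity τ α k g q := by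
  ext1 q
  have h1 := (hg.differentiable (by simp) q).hasFDerivAt
  have h2 := (((contDiff_planeWave k α).differentiable (by simp) (τ q)).hasFDerivAt).comp q
    (hasFDerivAt_affineIsometry τ q)
  have h3 : fderiv ℝ (waveDensity τ α k g) q = _ := (h1.mul h2).fderiv
  unfold dirDeriv
  rw [h3]
  have h4 := fderiv_planeWave k α (τ q) (τ.linear e)
  rw [ha] at h4
  simp only [add_apply, smul_apply, ContinuousLinearMap.comp_apply, smul_eq_mul,
    LinearIsometry.coe_toContinuousLinearMap, Function.comp]
  have h5 : τ.linearIsometry e = τ.linear e := rfl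
  rw [h5, h4]
  simp only [waveDensity]
  ring

include ha in
theorem planeWave_affineIsometry (q : E2) : planeWave k α (τ q) =
    planeWave k α (τ 0) * Complex.exp (Complex.I * (k * inner ℝ a q : ℝ)) := by
  rw [planeWave, planeWave, affineIsometry_apply τ q, inner_add_right, ha, ← Complex.exp_add]
  congr 1
  push_cast
  ring

variable {ν : E3} (hν : ‖ν‖ = 1) (hτν : ∀ v : E2, inner ℝ ν (τ.linear v) = 0)

include hν hτν in
theorem notMem_image_of_height {x : E2} {z : ℝ} (hz : z ≠ 0) (A : Set E2) : τ x + z • ν ∉ τ '' A := by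
  rintro ⟨q, -, hq⟩
  have h : inner ℝ ν (τ q) = inner ℝ ν (τ x + z • ν) := by rw [hq]
  rw [affineIsometry_apply τ q, affineIsometry_apply τ x] at h
  simp only [inner_add_right, hτν, inner_smul_right, real_inner_self_eq_norm_sq, hν] at h
  apply hz
  linarith

include hν hτν in
theorem norm_sub_eq_slant (x q : E2) (z : ℝ) : ‖τ x + z • ν - τ q‖ = slant z (x - q) := by
  have h : τ x + z • ν - τ q = τ.linear (x - q) + z • ν := by
    rw [affineIsometry_apply τ q, affineIsometry_apply τ x, map_sub]
    abel
  have h2 : ‖τ.linear (x - q)‖ = ‖x - q‖ := τ.linearIsometry.norm_map (x - q)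
  rw [h, slant, ← Real.sqrt_sq (norm_nonneg (_ + _)), norm_add_sq_real, inner_smul_right,
    real_inner_comm, hτν, norm_smul, hν, h2]
  simp

variable {c : ℝ} (hc : 0 < c) (hac : ‖a‖ ^ 2 + c ^ 2 = 1) {Q : ℝ} (hQ0 : 0 ≤ Q)
  (hQ : ∀ q, Q < ‖q‖ → g q = 0) {ρ : ℝ} {x : E2} (hx : ‖x‖ < ρ) {z : ℝ} (hz : z ∈ Set.Ioo 0 ρ)

include ha hν hτν hc hac hQ0 hQ hx hz in
theorem layer_eq_ringIntegral (hg : Continuous g) :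
    layer τ (sphericalKernel k) (waveDensity τ α k g) (τ x + z • ν) =
      planeWave k α (τ x) *
        ringIntegral (k * c) (ringLength c Q ρ + 1) (c⁻¹ • a) (ringMean a c g) x z := by
  rw [planeWave_affineIsometry ha, mul_assoc,
    ← integral_wave_eq_ringIntegral hc hac hg hQ0 hQ k hx hz, ← integral_const_mul]
  refine integral_congr_ae (Eventually.of_forall fun q => ?_)
  simp only [waveDensity, sphericalKernel, norm_sub_eq_slant hν hτν, planeWave_affineIsometry ha q]
  ring

theorem hasDerivAt_add_smul (r ν : E3) (z : ℝ) : HasDerivAt (fun z : ℝ => r + z • ν) ν z := by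
  simpa using ((hasDerivAt_id z).smul_const ν).const_add r

include ha hν hτν hc hac hQ0 hQ hx hz in
-- Both sides are the z-derivative of the identity `layer_eq_ringIntegral`, which holds on a whole
-- interval of heights; derivatives are unique.
theorem layer_dirDeriv_eq_ringDeriv (hg : ContDiff ℝ ∞ g) (hgc : HasCompactSupport g) :
    layer τ (dirDeriv ν (sphericalKernel k)) (waveDensity τ α k g) (τ x + z • ν) =
      planeWave k α (τ x) *
        ringDeriv (k * c) (ringLength c Q ρ + 1) (c⁻¹ • a) (ringMean a c g) x z := by
  have hS : 0 ≤ ringLength c Q ρ + 1 := by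
    have := hz.1.trans hz.2
    rw [ringLength]; positivity
  have hm : ContDiff ℝ ∞ (ringMean a c g) :=
    contDiff_integral_of_contDiff (hg.comp (contDiff_ellipsePt a c)) _ _
  have h1 := (hasDerivAt_ringIntegral (κ := k * c) hm (isEven_ringMean a c g) hz.1 hS
    (ringMean_vanish hc hac hQ hQ0 hx hz (lt_add_one _))).const_mul (planeWave k α (τ x))
  have hr := notMem_image_of_height hν hτν (x := x) hz.1.ne' (tsupport (waveDensity τ α k g))
  have hcont := (contDiff_waveDensity (τ := τ) (α := α) (k := k) hg).continuous
  have hcs := hasCompactSupport_waveDensity (τ := τ) (α := α) (k := k) hgc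
  have h2 := (hasFDerivAt_layer hcont hcs (contDiffOn_sphericalKernel k) hr).differentiableAt.hasFDerivAt.comp_hasDerivAt
      z (hasDerivAt_add_smul (τ x) ν z)
  rw [fderiv_layer_apply hcont hcs (contDiffOn_sphericalKernel k) hr] at h2
  refine h2.unique (h1.congr_of_eventuallyEq ?_)
  filter_upwards [Ioo_mem_nhds hz.1 hz.2] with y hy
  exact layer_eq_ringIntegral ha hν hτν hc hac hQ0 hQ hx hy hg.continuous

include ha hν hτν hc hac hQ0 hQ hx hz in
theorem layer_dirDeriv_dirDeriv_eq_ringDeriv₂ (hg : ContDiff ℝ ∞ g) (hgc : HasCompactSupport g) :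
    layer τ (dirDeriv ν (dirDeriv ν (sphericalKernel k))) (waveDensity τ α k g) (τ x + z • ν) =
      planeWave k α (τ x) *
        ringDeriv₂ (k * c) (ringLength c Q ρ + 1) (c⁻¹ • a) (ringMean a c g) x z := by
  have hS : 0 ≤ ringLength c Q ρ := by
    have := hz.1.trans hz.2
    rw [ringLength]; positivity
  have hm : ContDiff ℝ ∞ (ringMean a c g) :=
    contDiff_integral_of_contDiff (hg.comp (contDiff_ellipsePt a c)) _ _
  have hev := isEven_ringMean a c g
  have hA : radialQuot (ringMean a c g) (ringPoint (c⁻¹ • a) x z (ringLength c Q ρ + 1)) = 0 :=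
    radialQuot_eq_zero_of_vanish hm hev hS (fun z hz σ hσ => ringMean_vanish hc hac hQ hQ0 hx hz hσ)
      hz (lt_add_one _)
  have h1 := (hasDerivAt_ringDeriv (κ := k * c) hm (isEven_ringMean a c g) hz.1 (by linarith)
    hA).const_mul (planeWave k α (τ x))
  have hr := notMem_image_of_height hν hτν (x := x) hz.1.ne' (tsupport (waveDensity τ α k g))
  have hcont := (contDiff_waveDensity (τ := τ) (α := α) (k := k) hg).continuous
  have hcs := hasCompactSupport_waveDensity (τ := τ) (α := α) (k := k) hgc
  have hK := ContDiffOn.dirDeriv_compl_zero (contDiffOn_sphericalKernel k) ν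
  have h2 := (hasFDerivAt_layer hcont hcs hK hr).differentiableAt.hasFDerivAt.comp_hasDerivAt
      z (hasDerivAt_add_smul (τ x) ν z)
  rw [fderiv_layer_apply hcont hcs hK hr] at h2
  refine h2.unique (h1.congr_of_eventuallyEq ?_)
  filter_upwards [Ioo_mem_nhds hz.1 hz.2] with y hy
  exact layer_dirDeriv_eq_ringDeriv ha hν hτν hc hac hQ0 hQ hx hy hg hgc

end Formula

/-! ### Adapted frames, feet and heights -/

/-- `ν` is a unit normal of the image of `τ`, and the tangential part of `α` is the image of `a`,
of norm `√(1 - c²)`. -/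
structure IsFrame (τ : E2 →ᵃⁱ[ℝ] E3) (α ν : E3) (a : E2) (c : ℝ) : Prop where
  norm_normal : ‖ν‖ = 1
  normal : ∀ v : E2, inner ℝ ν (τ.linear v) = 0
  tangent : ∀ v : E2, inner ℝ α (τ.linear v) = inner ℝ a v
  pos : 0 < c
  sq : ‖a‖ ^ 2 + c ^ 2 = 1

/-- The vectors of an orthonormal basis adapted to the plane with the unit normal `ν`. -/
def frameVec (τ : E2 →ᵃⁱ[ℝ] E3) (ν : E3) : Fin 3 → E3 :=
  ![τ.linear (EuclideanSpace.single 0 1), τ.linear (EuclideanSpace.single 1 1), ν]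

section Frame

variable {τ : E2 →ᵃⁱ[ℝ] E3} {α ν : E3} {a : E2} {c : ℝ}

theorem inner_linear (τ : E2 →ᵃⁱ[ℝ] E3) (u v : E2) :
    inner ℝ (τ.linear u) (τ.linear v) = inner ℝ u v :=
  τ.linearIsometry.inner_map_map u v

theorem orthonormal_frameVec (hν : ‖ν‖ = 1) (hτν : ∀ v : E2, inner ℝ ν (τ.linear v) = 0) :
    Orthonormal ℝ (frameVec τ ν) := by
  have h1 : ∀ v : E2, inner ℝ ν (τ.linearIsometry v) = 0 := hτν
  have h2 : ∀ v : E2, inner ℝ (τ.linearIsometry v) ν = 0 := fun v => by rw [real_inner_comm, h1]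
  rw [orthonormal_iff_ite]
  intro i j
  fin_cases i <;> fin_cases j <;>
    simp [frameVec, h1, h2, hν, EuclideanSpace.inner_single_left]

/-- The orthonormal basis with the vectors `frameVec`. -/
def frameBasis (hν : ‖ν‖ = 1) (hτν : ∀ v : E2, inner ℝ ν (τ.linear v) = 0) :
    OrthonormalBasis (Fin 3) ℝ E3 :=
  (basisOfOrthonormalOfCardEqFinrank (orthonormal_frameVec hν hτν) (by simp)).toOrthonormalBasis
    (by simpa using orthonormal_frameVec hν hτν)

theorem frameBasis_apply (hν : ‖ν‖ = 1) (hτν : ∀ v : E2, inner ℝ ν (τ.linear v) = 0) (i : Fin 3) :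
    frameBasis hν hτν i = frameVec τ ν i := by
  simp [frameBasis]

theorem sum_frameVec (hν : ‖ν‖ = 1) (hτν : ∀ v : E2, inner ℝ ν (τ.linear v) = 0) (v : E3) :
    ∑ i, inner ℝ (frameVec τ ν i) v • frameVec τ ν i = v := by
  simpa only [frameBasis_apply] using (frameBasis hν hτν).sum_repr' v

/-- The tangential part of a vector. -/
def tangentPart (τ : E2 →ᵃⁱ[ℝ] E3) (v : E3) : E2 :=
  (inner ℝ (τ.linear (EuclideanSpace.single 0 1)) v) • EuclideanSpace.single 0 (1 : ℝ) +
  (inner ℝ (τ.linear (EuclideanSpace.single 1 1)) v) • EuclideanSpace.single 1 (1 : ℝ)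

theorem linear_tangentPart (hν : ‖ν‖ = 1) (hτν : ∀ v : E2, inner ℝ ν (τ.linear v) = 0) (v : E3) :
    τ.linear (tangentPart τ v) + (inner ℝ ν v) • ν = v := by
  conv_rhs => rw [← sum_frameVec hν hτν v]
  simp [Fin.sum_univ_three, frameVec, tangentPart]

/-- The foot in the plane of the perpendicular from `r`. -/
def foot (τ : E2 →ᵃⁱ[ℝ] E3) (r : E3) : E2 := tangentPart τ (r - τ 0)

/-- The height of `r` over the plane. -/
def height (τ : E2 →ᵃⁱ[ℝ] E3) (ν r : E3) : ℝ := inner ℝ ν (r - τ 0)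

theorem continuous_foot (τ : E2 →ᵃⁱ[ℝ] E3) : Continuous (foot τ) := by
  unfold foot tangentPart
  fun_prop

theorem continuous_height (τ : E2 →ᵃⁱ[ℝ] E3) (ν : E3) : Continuous (height τ ν) := by
  unfold height
  fun_prop

theorem foot_add_height (hν : ‖ν‖ = 1) (hτν : ∀ v : E2, inner ℝ ν (τ.linear v) = 0) (r : E3) :
    τ (foot τ r) + height τ ν r • ν = r := by
  have h := linear_tangentPart hν hτν (r - τ 0)
  rw [affineIsometry_apply, foot, height, add_right_comm, h]
  abel

theorem foot_apply (hτν : ∀ v : E2, inner ℝ ν (τ.linear v) = 0) (x : E2) (z : ℝ) :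
    foot τ (τ x + z • ν) = x := by
  have h2 : ∀ v : E2, inner ℝ (τ.linear v) ν = 0 := fun v => by rw [real_inner_comm, hτν]
  rw [foot, affineIsometry_apply τ x, show τ.linear x + τ 0 + z • ν - τ 0 = τ.linear x + z • ν by abel,
    tangentPart]
  simp only [inner_add_right, inner_linear, inner_smul_right, h2]
  ext i
  fin_cases i <;> simp [EuclideanSpace.inner_single_left]

theorem height_apply (hν : ‖ν‖ = 1) (hτν : ∀ v : E2, inner ℝ ν (τ.linear v) = 0) (x : E2) (z : ℝ) :
    height τ ν (τ x + z • ν) = z := by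
  rw [height, affineIsometry_apply τ x, show τ.linear x + τ 0 + z • ν - τ 0 = τ.linear x + z • ν by abel]
  rw [inner_add_right, hτν, inner_smul_right, real_inner_self_eq_norm_sq, hν]
  norm_num

theorem norm_le_sum_frameVec (hν : ‖ν‖ = 1) (hτν : ∀ v : E2, inner ℝ ν (τ.linear v) = 0)
    (U : E3 →L[ℝ] ℂ) : ‖U‖ ≤ ∑ i, ‖U (frameVec τ ν i)‖ := by
  refine ContinuousLinearMap.opNorm_le_bound _ (by positivity) fun v => ?_
  conv_lhs => rw [← sum_frameVec hν hτν v]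
  rw [map_sum, Finset.sum_mul]
  refine (norm_sum_le _ _).trans (Finset.sum_le_sum fun i _ => ?_)
  rw [map_smul, norm_smul, mul_comm]
  refine mul_le_mul_of_nonneg_left ?_ (norm_nonneg _)
  have h1 := norm_inner_le_norm (𝕜 := ℝ) (frameVec τ ν i) v
  rwa [(orthonormal_frameVec hν hτν).1 i, one_mul] at h1

/-- An operator is the sum of the rank-one operators built from its values on the orthonormal frame,
so convergence of these values suffices. -/
theorem exists_tendsto_of_frameVec (hν : ‖ν‖ = 1) (hτν : ∀ v : E2, inner ℝ ν (τ.linear v) = 0)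
    {f : E3 → E3 →L[ℝ] ℂ} {l : Filter E3}
    (h : ∀ i, ∃ u, Tendsto (fun r => f r (frameVec τ ν i)) l (𝓝 u)) : ∃ U, Tendsto f l (𝓝 U) := by
  choose u hu using h
  have hf : f = fun r => ∑ i, ContinuousLinearMap.smulRightL ℝ E3 ℂ (innerSL ℝ (frameVec τ ν i))
      (f r (frameVec τ ν i)) := by
    ext1 r
    ext1 v
    conv_lhs => rw [← sum_frameVec hν hτν v]
    simp
  rw [hf]
  exact ⟨_, tendsto_finsetSum _ fun i _ =>
    ((ContinuousLinearMap.smulRightL ℝ E3 ℂ (innerSL ℝ (frameVec τ ν i))).continuous.tendsto _).comp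
      (hu i)⟩

theorem norm_planeWave (k : ℝ) (α r : E3) : ‖planeWave k α r‖ = 1 := norm_exp_I_mul _

end Frame

/-! ### Uniform bounds and asymptotics of the layers -/

section Bounds

variable {τ : E2 →ᵃⁱ[ℝ] E3} {α ν : E3} {a : E2} {c : ℝ} (hF : IsFrame τ α ν a c)
variable {δ Q N : ℝ} {g : ℝ → E2 → ℂ} (hg : IsPlaneSymbol δ Q N g)

theorem ringLength_nonneg (hc : 0 < c) (hQ : 0 ≤ Q) {ρ : ℝ} (hρ : 0 < ρ) : 0 ≤ ringLength c Q ρ := by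
  rw [ringLength]; positivity

include hF hg in
theorem layer_bounds (hδ : 0 ≤ δ) (hδ₁ : δ < 1 / 2) (hQ : 0 ≤ Q) {ρ : ℝ} (hρ : 0 < ρ) :
    ∃ C : ℝ, 0 ≤ C ∧ ∀ k : ℝ, 1 < k → ∀ x : E2, ‖x‖ < ρ → ∀ z ∈ Set.Ioo 0 ρ,
      ‖layer τ (sphericalKernel k) (waveDensity τ α k (g k)) (τ x + z • ν)‖ ≤ C * k ^ (δ * N - 1) ∧
      ‖layer τ (dirDeriv ν (sphericalKernel k)) (waveDensity τ α k (g k)) (τ x + z • ν)‖ ≤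
        C * k ^ (δ * N) ∧
      ‖layer τ (dirDeriv ν (dirDeriv ν (sphericalKernel k))) (waveDensity τ α k (g k))
        (τ x + z • ν)‖ ≤ C * k ^ (δ * N + 1) := by
  have hS := ringLength_nonneg hF.pos hQ hρ
  have hp := hg.ringMean hF.pos hF.sq hQ ρ
  obtain ⟨C₀, h₀, hC₀⟩ := hp.ringIntegral_bound hδ hδ₁ hS le_rfl hF.pos
  obtain ⟨C₁, h₁, hC₁⟩ := hp.ringDeriv_bound hδ hδ₁ hS hρ.le le_rfl hF.pos
  obtain ⟨C₂, h₂, hC₂⟩ := hp.ringDeriv₂_bound hδ hδ₁ hS hρ.le le_rfl hF.pos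
  refine ⟨C₀ + C₁ + C₂, by positivity, fun k hk x hx z hz => ?_⟩
  have hk0 : 0 < k := by linarith
  have hgs := hg.symbol.smooth k hk
  have hgc := hg.hasCompactSupport hk
  have hx' : x ∈ Metric.ball (0 : E2) ρ := mem_ball_zero_iff.2 hx
  rw [layer_eq_ringIntegral hF.tangent hF.norm_normal hF.normal hF.pos hF.sq hQ (hg.eq_zero k hk)
      hx hz hgs.continuous,
    layer_dirDeriv_eq_ringDeriv hF.tangent hF.norm_normal hF.normal hF.pos hF.sq hQ
      (hg.eq_zero k hk) hx hz hgs hgc,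
    layer_dirDeriv_dirDeriv_eq_ringDeriv₂ hF.tangent hF.norm_normal hF.normal hF.pos hF.sq hQ
      (hg.eq_zero k hk) hx hz hgs hgc]
  simp only [norm_mul, norm_planeWave, one_mul]
  refine ⟨(hC₀ k hk x hx' z hz).trans ?_, (hC₁ k hk x hx' z hz).trans ?_,
    (hC₂ k hk x hx' z hz).trans ?_⟩ <;> gcongr <;> linarith

include hF hg in
-- Where the density equals u near the ray base x - za/c, its ring mean is 2πu near the start of the
-- curve. The three estimates are the leading boundary terms of `ringIntegral`, `ringDeriv` and
-- `ringDeriv₂`.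
theorem layer_asymp (hδ : 0 ≤ δ) (hδ₁ : δ < 1 / 2) (hQ : 0 ≤ Q) {ρ : ℝ} (hρ : 0 < ρ) (B : ℝ) :
    ∃ C : ℝ, 0 ≤ C ∧ ∀ k : ℝ, 1 < k → ∀ x : E2, ‖x‖ < ρ → ∀ z ∈ Set.Ioo 0 ρ, ∀ u E : ℂ,
      g k =ᶠ[𝓝 (x - z • c⁻¹ • a)] (fun _ => u) →
      E = planeWave k α (τ x) * Complex.exp (Complex.I * (k * c * z : ℝ)) →
      ‖layer τ (sphericalKernel k) (waveDensity τ α k (g k)) (τ x + z • ν) -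
        Complex.I / (k * c : ℝ) * (2 * Real.pi * u * E)‖ ≤ C * k ^ (-B) ∧
      ‖layer τ (dirDeriv ν (sphericalKernel k)) (waveDensity τ α k (g k)) (τ x + z • ν) +
        2 * Real.pi * u * E‖ ≤ C * k ^ (-B) ∧
      ‖layer τ (dirDeriv ν (dirDeriv ν (sphericalKernel k))) (waveDensity τ α k (g k))
        (τ x + z • ν) + Complex.I * (k * c : ℝ) * (2 * Real.pi * u * E)‖ ≤ C * k ^ (-B) := by
  have hS := ringLength_nonneg hF.pos hQ hρ
  have hp := hg.ringMean hF.pos hF.sq hQ ρ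
  obtain ⟨C₀, h₀, hC₀⟩ := hp.ringIntegral_asymp hδ hδ₁ hS le_rfl hF.pos B
  obtain ⟨C₁, h₁, hC₁⟩ := hp.ringDeriv_asymp hδ hδ₁ hS hρ.le le_rfl hF.pos B
  obtain ⟨C₂, h₂, hC₂⟩ := hp.ringDeriv₂_asymp hδ hδ₁ hS hρ.le le_rfl hF.pos B
  refine ⟨C₀ + C₁ + C₂, by positivity, fun k hk x hx z hz u E hu hE => ?_⟩
  have hk0 : 0 < k := by linarith
  have hgs := hg.symbol.smooth k hk
  have hgc := hg.hasCompactSupport hk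
  have hx' : x ∈ Metric.ball (0 : E2) ρ := mem_ball_zero_iff.2 hx
  have hm := ringMean_eventuallyEq_const (a := a) (c := c) (y := (z, x - z • c⁻¹ • a)) hu
  have e₀ := hC₀ k hk x hx' z hz ⟨_, hm⟩
  have e₁ := hC₁ k hk x hx' z hz ⟨_, hm⟩
  have e₂ := hC₂ k hk x hx' z hz ⟨_, hm⟩
  rw [hm.eq_of_nhds] at e₀ e₁ e₂
  rw [layer_eq_ringIntegral hF.tangent hF.norm_normal hF.normal hF.pos hF.sq hQ (hg.eq_zero k hk)
      hx hz hgs.continuous,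
    layer_dirDeriv_eq_ringDeriv hF.tangent hF.norm_normal hF.normal hF.pos hF.sq hQ
      (hg.eq_zero k hk) hx hz hgs hgc,
    layer_dirDeriv_dirDeriv_eq_ringDeriv₂ hF.tangent hF.norm_normal hF.normal hF.pos hF.sq hQ
      (hg.eq_zero k hk) hx hz hgs hgc, hE]
  set w := planeWave k α (τ x) with hw
  have hw1 : ‖w‖ = 1 := norm_planeWave _ _ _
  set e := Complex.exp (Complex.I * (k * c * z : ℝ))
  refine ⟨?_, ?_, ?_⟩
  · rw [show ∀ R : ℂ, w * R - Complex.I / (k * c : ℝ) * (2 * Real.pi * u * (w * e)) =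
      w * (R - Complex.I / (k * c : ℝ) * (e * (2 * Real.pi * u))) by intro R; ring, norm_mul, hw1,
      one_mul]
    refine e₀.trans ?_
    gcongr
    linarith
  · rw [show ∀ R : ℂ, w * R + 2 * Real.pi * u * (w * e) = w * (R + e * (2 * Real.pi * u)) by
      intro R; ring, norm_mul, hw1, one_mul]
    refine e₁.trans ?_
    gcongr
    linarith
  · rw [show ∀ R : ℂ, w * R + Complex.I * (k * c : ℝ) * (2 * Real.pi * u * (w * e)) =
      w * (R + Complex.I * (k * c : ℝ) * (e * (2 * Real.pi * u))) by intro R; ring, norm_mul, hw1,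
      one_mul]
    refine e₂.trans ?_
    gcongr
    linarith

end Bounds

/-! ### One-sided limits at the plane -/

section Limits

variable {τ : E2 →ᵃⁱ[ℝ] E3} {α ν : E3} {a : E2} {c : ℝ} (hF : IsFrame τ α ν a c)
variable {k Q : ℝ} {g : E2 → ℂ} (hQ0 : 0 ≤ Q) (hQ : ∀ q, Q < ‖q‖ → g q = 0)
  (hg : ContDiff ℝ ∞ g) (hgc : HasCompactSupport g)

/-- The open half-space on the side of the normal. -/
def upperSide (τ : E2 →ᵃⁱ[ℝ] E3) (ν : E3) : Set E3 := {r | 0 < height τ ν r}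

include hF in
-- The representing function is continuous also across height zero, although it agrees with f only
-- for positive heights; this is the source of all limits on the plane.
theorem exists_tendsto_of_eq_continuous {f : E3 → ℂ} {r₀ : E3} (h₀ : 0 ≤ height τ ν r₀)
    (h : ∀ ρ > 0, ∃ V : E2 × ℝ → ℂ, Continuous V ∧ ∀ x : E2, ‖x‖ < ρ → ∀ z ∈ Set.Ioo 0 ρ,
      f (τ x + z • ν) = planeWave k α (τ x) * V (x, z)) :
    ∃ u, Tendsto f (𝓝[upperSide τ ν] r₀) (𝓝 u) := by
  set ρ := ‖foot τ r₀‖ + height τ ν r₀ + 1 with hρ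
  have hn := norm_nonneg (foot τ r₀)
  obtain ⟨V, hV, hfV⟩ := h ρ (by linarith)
  have hcf := continuous_foot τ
  have hch := continuous_height τ ν
  have hcont : Continuous fun r => planeWave k α (τ (foot τ r)) * V (foot τ r, height τ ν r) :=
    (((contDiff_planeWave k α).continuous.comp τ.continuous).comp hcf).mul
      (hV.comp (hcf.prodMk hch))
  refine ⟨_, ((hcont.tendsto r₀).mono_left nhdsWithin_le_nhds).congr' ?_⟩
  have e1 : ∀ᶠ r in 𝓝[upperSide τ ν] r₀, ‖foot τ r‖ < ρ :=
    (hcf.norm.continuousAt.eventually (gt_mem_nhds (by linarith))).filter_mono nhdsWithin_le_nhds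
  have e2 : ∀ᶠ r in 𝓝[upperSide τ ν] r₀, height τ ν r < ρ :=
    (hch.continuousAt.eventually (gt_mem_nhds (by linarith))).filter_mono nhdsWithin_le_nhds
  filter_upwards [e1, e2, self_mem_nhdsWithin] with r h1 h2 h3
  rw [← hfV _ h1 _ ⟨h3, h2⟩, foot_add_height hF.norm_normal hF.normal]

include hF hQ0 hQ hg hgc in
theorem exists_tendsto_layer {r₀ : E3} (h₀ : 0 ≤ height τ ν r₀) :
    (∃ u, Tendsto (layer τ (sphericalKernel k) (waveDensity τ α k g)) (𝓝[upperSide τ ν] r₀) (𝓝 u)) ∧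
    (∃ u, Tendsto (layer τ (dirDeriv ν (sphericalKernel k)) (waveDensity τ α k g))
      (𝓝[upperSide τ ν] r₀) (𝓝 u)) ∧
    (∃ u, Tendsto (layer τ (dirDeriv ν (dirDeriv ν (sphericalKernel k))) (waveDensity τ α k g))
      (𝓝[upperSide τ ν] r₀) (𝓝 u)) := by
  have hm : ContDiff ℝ ∞ (ringMean a c g) :=
    contDiff_integral_of_contDiff (hg.comp (contDiff_ellipsePt a c)) _ _
  refine ⟨exists_tendsto_of_eq_continuous (k := k) hF h₀ fun ρ hρ => ⟨fun v =>
    ringIntegral (k * c) (ringLength c Q ρ + 1) (c⁻¹ • a) (ringMean a c g) v.1 v.2,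
      continuous_ringIntegral _ _ _ hm.continuous, fun x hx z hz => ?_⟩,
    exists_tendsto_of_eq_continuous (k := k) hF h₀ fun ρ hρ => ⟨fun v =>
    ringDeriv (k * c) (ringLength c Q ρ + 1) (c⁻¹ • a) (ringMean a c g) v.1 v.2,
      continuous_ringDeriv _ _ _ hm, fun x hx z hz => ?_⟩,
    exists_tendsto_of_eq_continuous (k := k) hF h₀ fun ρ hρ => ⟨fun v =>
    ringDeriv₂ (k * c) (ringLength c Q ρ + 1) (c⁻¹ • a) (ringMean a c g) v.1 v.2,
      continuous_ringDeriv₂ _ _ _ hm, fun x hx z hz => ?_⟩⟩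
  · exact layer_eq_ringIntegral hF.tangent hF.norm_normal hF.normal hF.pos hF.sq hQ0 hQ
      hx hz hg.continuous
  · exact layer_dirDeriv_eq_ringDeriv hF.tangent hF.norm_normal hF.normal hF.pos hF.sq hQ0
      hQ hx hz hg hgc
  · exact layer_dirDeriv_dirDeriv_eq_ringDeriv₂ hF.tangent hF.norm_normal hF.normal hF.pos hF.sq
      hQ0 hQ hx hz hg hgc

end Limits

/-! ### Combined layers and their gradients -/

/-- A combination of the single and the double layer with the density `g e^{ik (α · q)}`. -/
def field (τ : E2 →ᵃⁱ[ℝ] E3) (α ν : E3) (β γ : ℂ) (k : ℝ) (g : E2 → ℂ) (r : E3) : ℂ :=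
  k * β * layer τ (sphericalKernel k) (waveDensity τ α k g) r +
    γ * layer τ (dirDeriv ν (sphericalKernel k)) (waveDensity τ α k g) r

section Field

variable {τ : E2 →ᵃⁱ[ℝ] E3} {α ν : E3} {β γ : ℂ} {k : ℝ} {g : E2 → ℂ}
  (hg : ContDiff ℝ ∞ g) (hgc : HasCompactSupport g)

theorem notMem_image_waveDensity {r : E3} (hr : r ∉ τ '' tsupport g) :
    r ∉ τ '' tsupport (waveDensity τ α k g) :=
  fun h => hr (Set.image_mono (tsupport_waveDensity_subset g) h)

include hg hgc in
theorem hasFDerivAt_field {r : E3} (hr : r ∉ τ '' tsupport g) :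
    HasFDerivAt (field τ α ν β γ k g)
      ((k * β) • fderiv ℝ (layer τ (sphericalKernel k) (waveDensity τ α k g)) r +
        γ • fderiv ℝ (layer τ (dirDeriv ν (sphericalKernel k)) (waveDensity τ α k g)) r) r := by
  have hcont := (contDiff_waveDensity (τ := τ) (α := α) (k := k) hg).continuous
  have hcs := hasCompactSupport_waveDensity (τ := τ) (α := α) (k := k) hgc
  have hr' := notMem_image_waveDensity (α := α) (k := k) hr
  have hK := contDiffOn_sphericalKernel k
  have hK' := ContDiffOn.dirDeriv_compl_zero hK ν
  exact (((hasFDerivAt_layer hcont hcs hK hr').differentiableAt.hasFDerivAt).const_mul _).add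
    (((hasFDerivAt_layer hcont hcs hK' hr').differentiableAt.hasFDerivAt).const_mul _)

include hg hgc in
theorem fderiv_field_apply {r : E3} (hr : r ∉ τ '' tsupport g) (v : E3) :
    fderiv ℝ (field τ α ν β γ k g) r v =
      k * β * layer τ (dirDeriv v (sphericalKernel k)) (waveDensity τ α k g) r +
        γ * layer τ (dirDeriv v (dirDeriv ν (sphericalKernel k))) (waveDensity τ α k g) r := by
  have hcont := (contDiff_waveDensity (τ := τ) (α := α) (k := k) hg).continuous
  have hcs := hasCompactSupport_waveDensity (τ := τ) (α := α) (k := k) hgc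
  have hr' := notMem_image_waveDensity (α := α) (k := k) hr
  have hK := contDiffOn_sphericalKernel k
  have hK' := ContDiffOn.dirDeriv_compl_zero hK ν
  rw [(hasFDerivAt_field hg hgc hr).fderiv]
  simp only [add_apply, smul_apply, smul_eq_mul]
  rw [fderiv_layer_apply hcont hcs hK hr', fderiv_layer_apply hcont hcs hK' hr']

theorem layer_add_mul {K : E3 → ℂ} {G₁ G₂ : E2 → ℂ} {r : E3} (s : ℂ)
    (h₁ : Integrable fun q => G₁ q * K (r - τ q)) (h₂ : Integrable fun q => G₂ q * K (r - τ q)) :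
    layer τ K (fun q => G₁ q + s * G₂ q) r = layer τ K G₁ r + s * layer τ K G₂ r := by
  simp only [layer]
  rw [← integral_const_mul, ← integral_add h₁ (h₂.const_mul s)]
  congr 1
  ext1 q
  ring

theorem tsupport_dirDeriv_subset (g : E2 → ℂ) (e : E2) : tsupport (dirDeriv e g) ⊆ tsupport g :=
  tsupport_fderiv_apply_subset ℝ e

variable {a : E2} (ha : ∀ v : E2, inner ℝ α (τ.linear v) = inner ℝ a v)

include hg hgc ha in
theorem layer_dirDeriv_linear {K : E3 → ℂ} (hK : ContDiffOn ℝ ∞ K {0}ᶜ) {r : E3}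
    (hr : r ∉ τ '' tsupport g) (e : E2) :
    layer τ (dirDeriv (τ.linear e) K) (waveDensity τ α k g) r =
      layer τ K (waveDensity τ α k (dirDeriv e g)) r +
        Complex.I * (k * inner ℝ a e : ℝ) * layer τ K (waveDensity τ α k g) r := by
  have hkernel : ∀ {h : E2 → ℂ}, ContDiff ℝ ∞ h → tsupport h ⊆ tsupport g →
      Integrable fun q => waveDensity τ α k h q * K (r - τ q) := fun {h} hh hs => by
    have hhc : HasCompactSupport h := hgc.of_isClosed_subset (isClosed_tsupport h) hs
    refine integrable_smul_of_continuousAt_tsupport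
      (contDiff_waveDensity (τ := τ) (α := α) (k := k) hh).continuous
      (hasCompactSupport_waveDensity hhc) fun q hq => continuousAt_kernel hK.continuousOn ?_ hq
    exact notMem_image_waveDensity fun h' => hr (Set.image_mono hs h')
  rw [layer_dirDeriv_tangent (contDiff_waveDensity hg) (hasCompactSupport_waveDensity hgc) hK
    (notMem_image_waveDensity hr), dirDeriv_waveDensity ha hg]
  exact layer_add_mul _ (hkernel (ContDiff.dirDeriv hg e) (tsupport_dirDeriv_subset g e))
    (hkernel hg le_rfl)

include hg hgc ha in
-- A tangential derivative of a field is made of fields of the same kind, so tangential gradient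
-- estimates reduce to estimates of values.
theorem fderiv_field_tangent {r : E3} (hr : r ∉ τ '' tsupport g) (e : E2) :
    fderiv ℝ (field τ α ν β γ k g) r (τ.linear e) = field τ α ν β γ k (dirDeriv e g) r +
      Complex.I * (k * inner ℝ a e : ℝ) * field τ α ν β γ k g r := by
  have hK := contDiffOn_sphericalKernel k
  rw [fderiv_field_apply hg hgc hr, layer_dirDeriv_linear hg hgc ha hK hr,
    layer_dirDeriv_linear hg hgc ha (ContDiffOn.dirDeriv_compl_zero hK ν) hr]
  simp only [field]
  ring

end Field

section FieldLimits

variable {τ : E2 →ᵃⁱ[ℝ] E3} {α ν : E3} {a : E2} {c : ℝ} {β γ : ℂ} {k : ℝ} {g : E2 → ℂ}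
  (hg : ContDiff ℝ ∞ g) (hgc : HasCompactSupport g)

include hg hgc in
theorem exists_tendsto_fderiv_field_of_notMem (hF : IsFrame τ α ν a c) {r : E3}
    (hr : r ∉ τ '' tsupport g) :
    ∃ U, Tendsto (fderiv ℝ (field τ α ν β γ k g)) (𝓝 r) (𝓝 U) := by
  refine exists_tendsto_of_frameVec hF.norm_normal hF.normal fun i => ?_
  have hcont := (contDiff_waveDensity (τ := τ) (α := α) (k := k) hg).continuous
  have hcs := hasCompactSupport_waveDensity (τ := τ) (α := α) (k := k) hgc
  have hr' := notMem_image_waveDensity (α := α) (k := k) hr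
  have hK := contDiffOn_sphericalKernel k
  have hK' := ContDiffOn.dirDeriv_compl_zero hK ν
  have h1 := continuousAt_layer hcont hcs (ContDiffOn.dirDeriv_compl_zero hK (frameVec τ ν i)) hr'
  have h2 := continuousAt_layer hcont hcs (ContDiffOn.dirDeriv_compl_zero hK' (frameVec τ ν i)) hr'
  refine ⟨_, ((h1.const_mul (k * β)).add (h2.const_mul γ)).tendsto.congr' ?_⟩
  filter_upwards [(isOpen_compl_image_tsupport (τ := τ) hgc).mem_nhds hr] with r' hr''
  exact (fderiv_field_apply hg hgc hr'' _).symm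

variable {Q : ℝ} (hQ0 : 0 ≤ Q) (hQ : ∀ q, Q < ‖q‖ → g q = 0)

theorem notMem_image_of_mem_upperSide (hF : IsFrame τ α ν a c) {r : E3} (hr : r ∈ upperSide τ ν)
    (A : Set E2) : r ∉ τ '' A := by
  have h := notMem_image_of_height hF.norm_normal hF.normal (x := foot τ r)
    (show height τ ν r ≠ 0 from ne_of_gt hr) A
  rwa [foot_add_height hF.norm_normal hF.normal] at h

include hg hgc hQ0 hQ in
theorem exists_tendsto_field (hF : IsFrame τ α ν a c) {r₀ : E3} (h₀ : 0 ≤ height τ ν r₀) :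
    ∃ u, Tendsto (field τ α ν β γ k g) (𝓝[upperSide τ ν] r₀) (𝓝 u) := by
  obtain ⟨⟨u, hu⟩, ⟨v, hv⟩, -⟩ := exists_tendsto_layer (k := k) hF hQ0 hQ hg hgc h₀
  exact ⟨_, (hu.const_mul (k * β)).add (hv.const_mul γ)⟩

theorem dirDeriv_eq_zero_of_lt (hQ : ∀ q, Q < ‖q‖ → g q = 0) (e q : E2) (hq : Q < ‖q‖) :
    dirDeriv e g q = 0 := by
  refine (dirDeriv_eventuallyEq_zero (a := 0) ?_ e).eq_of_nhds
  filter_upwards [continuous_norm.continuousAt.eventually (lt_mem_nhds hq)] with q' hq'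
    using hQ q' hq'

include hg hgc hQ0 hQ in
theorem exists_tendsto_fderiv_field (hF : IsFrame τ α ν a c) {r₀ : E3} (h₀ : 0 ≤ height τ ν r₀) :
    ∃ U, Tendsto (fderiv ℝ (field τ α ν β γ k g)) (𝓝[upperSide τ ν] r₀) (𝓝 U) := by
  refine exists_tendsto_of_frameVec hF.norm_normal hF.normal fun i => ?_
  have htan : ∀ e : E2, ∃ u, Tendsto (fun r => fderiv ℝ (field τ α ν β γ k g) r (τ.linear e))
      (𝓝[upperSide τ ν] r₀) (𝓝 u) := fun e => by
    obtain ⟨u, hu⟩ := exists_tendsto_field (β := β) (γ := γ) (k := k) hg hgc hQ0 hQ hF h₀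
    obtain ⟨v, hv⟩ := exists_tendsto_field (β := β) (γ := γ) (k := k) (ContDiff.dirDeriv hg e)
      (hgc.of_isClosed_subset (isClosed_tsupport _) (tsupport_dirDeriv_subset g e)) hQ0
      (dirDeriv_eq_zero_of_lt hQ e) hF h₀
    refine ⟨_, (hv.add (hu.const_mul (Complex.I * (k * inner ℝ a e : ℝ)))).congr' ?_⟩
    filter_upwards [self_mem_nhdsWithin] with r hr
    exact (fderiv_field_tangent hg hgc hF.tangent (notMem_image_of_mem_upperSide hF hr _) e).symm
  fin_cases i
  · exact htan _
  · exact htan _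
  · obtain ⟨-, ⟨u, hu⟩, ⟨v, hv⟩⟩ := exists_tendsto_layer (k := k) hF hQ0 hQ hg hgc h₀
    refine ⟨_, ((hu.const_mul (k * β)).add (hv.const_mul γ)).congr' ?_⟩
    filter_upwards [self_mem_nhdsWithin] with r hr
    exact (fderiv_field_apply hg hgc (notMem_image_of_mem_upperSide hF hr _) ν).symm

end FieldLimits

section FieldBounds

variable {τ : E2 →ᵃⁱ[ℝ] E3} {α ν : E3} {a : E2} {c : ℝ}
  {δ Q N : ℝ} {g : ℝ → E2 → ℂ}

theorem field_bound (hF : IsFrame τ α ν a c) (hg : IsPlaneSymbol δ Q N g) (hδ : 0 ≤ δ)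
    (hδ₁ : δ < 1 / 2) (hQ : 0 ≤ Q) {ρ : ℝ} (hρ : 0 < ρ) (β γ : ℂ) :
    ∃ C : ℝ, 0 ≤ C ∧ ∀ k : ℝ, 1 < k → ∀ x : E2, ‖x‖ < ρ → ∀ z ∈ Set.Ioo 0 ρ,
      ‖field τ α ν β γ k (g k) (τ x + z • ν)‖ ≤ C * k ^ (δ * N) ∧
      ‖fderiv ℝ (field τ α ν β γ k (g k)) (τ x + z • ν) ν‖ ≤ C * k ^ (δ * N + 1) := by
  obtain ⟨C, hC0, hC⟩ := layer_bounds hF hg hδ hδ₁ hQ hρ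
  refine ⟨‖β‖ * C + ‖γ‖ * C, by positivity, fun k hk x hx z hz => ?_⟩
  have hk0 : 0 < k := by linarith
  obtain ⟨h0, h1, h2⟩ := hC k hk x hx z hz
  have hr := notMem_image_of_height hF.norm_normal hF.normal (x := x) hz.1.ne' (tsupport (g k))
  have e1 : k ^ (δ * N) = k * k ^ (δ * N - 1) := by
    rw [Real.rpow_sub_one hk0.ne']; field_simp
  have e2 : k ^ (δ * N + 1) = k * k ^ (δ * N) := by
    rw [Real.rpow_add_one hk0.ne', mul_comm]
  constructor
  · rw [field, add_mul]
    refine (norm_add_le _ _).trans (add_le_add ?_ ?_)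
    · rw [norm_mul, norm_mul, Complex.norm_real, Real.norm_of_nonneg hk0.le, e1]
      calc _ ≤ k * ‖β‖ * (C * k ^ (δ * N - 1)) := by gcongr
        _ = _ := by ring
    · rw [norm_mul, mul_assoc]
      gcongr
  · rw [fderiv_field_apply (hg.symbol.smooth k hk) (hg.hasCompactSupport hk) hr, add_mul]
    refine (norm_add_le _ _).trans (add_le_add ?_ ?_)
    · rw [norm_mul, norm_mul, Complex.norm_real, Real.norm_of_nonneg hk0.le, e2]
      calc _ ≤ k * ‖β‖ * (C * k ^ (δ * N)) := by gcongr
        _ = _ := by ring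
    · rw [norm_mul, mul_assoc]
      gcongr

/-- A derivative of a density of order 0 has order 1, so its field is O(k^δ), which is below k. The
other tangential term has the explicit factor k. -/
theorem field_bounds (hF : IsFrame τ α ν a c) (hg : IsPlaneSymbol δ Q 0 g) (hδ : 0 ≤ δ)
    (hδ₁ : δ < 1 / 2) (hQ : 0 ≤ Q) {ρ : ℝ} (hρ : 0 < ρ) (β γ : ℂ) :
    ∃ C : ℝ, 0 ≤ C ∧ ∀ k : ℝ, 1 < k → ∀ x : E2, ‖x‖ < ρ → ∀ z ∈ Set.Ioo 0 ρ,
      ‖field τ α ν β γ k (g k) (τ x + z • ν)‖ ≤ C ∧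
      ‖fderiv ℝ (field τ α ν β γ k (g k)) (τ x + z • ν)‖ ≤ C * k := by
  obtain ⟨C, hC0, hC⟩ := field_bound hF hg hδ hδ₁ hQ hρ β γ
  choose C' hC'0 hC' using fun e => field_bound hF (hg.dirDeriv e) hδ hδ₁ hQ hρ β γ
  set e₀ : E2 := EuclideanSpace.single 0 1
  set e₁ : E2 := EuclideanSpace.single 1 1
  have := hC'0 e₀
  have := hC'0 e₁
  refine ⟨C + (C' e₀ + ‖a‖ * C) + (C' e₁ + ‖a‖ * C), by positivity, fun k hk x hx z hz => ?_⟩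
  have hk0 : 0 < k := by linarith
  have hr := notMem_image_of_height hF.norm_normal hF.normal (x := x) hz.1.ne' (tsupport (g k))
  have hgs := hg.symbol.smooth k hk
  have hgc := hg.hasCompactSupport hk
  obtain ⟨h0, h1⟩ := hC k hk x hx z hz
  simp only [mul_zero, Real.rpow_zero, mul_one, zero_add, Real.rpow_one] at h0 h1
  refine ⟨h0.trans ?_, ?_⟩
  · have := norm_nonneg a
    nlinarith [mul_nonneg this hC0]
  · have htan : ∀ e : E2, ‖e‖ = 1 → ‖fderiv ℝ (field τ α ν β γ k (g k)) (τ x + z • ν) (τ.linear e)‖ ≤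
        (C' e + ‖a‖ * C) * k := fun e he => by
      have h2 := (hC' e k hk x hx z hz).1
      rw [fderiv_field_tangent hgs hgc hF.tangent hr, add_mul]
      refine (norm_add_le _ _).trans (add_le_add (h2.trans ?_) ?_)
      · have h3 : k ^ (δ * (0 + 1)) ≤ k ^ (1 : ℝ) :=
          Real.rpow_le_rpow_of_exponent_le hk.le (by linarith)
        rw [Real.rpow_one] at h3
        exact mul_le_mul_of_nonneg_left h3 (hC'0 e)
      · rw [norm_mul, norm_mul, Complex.norm_I, one_mul, Complex.norm_real, norm_mul,
          Real.norm_of_nonneg hk0.le]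
        have h4 : ‖inner ℝ a e‖ ≤ ‖a‖ := by
          simpa [he] using norm_inner_le_norm (𝕜 := ℝ) a e
        calc _ ≤ k * ‖a‖ * C := by gcongr
          _ = _ := by ring
    refine (norm_le_sum_frameVec hF.norm_normal hF.normal _).trans ?_
    rw [Fin.sum_univ_three]
    have t0 := htan e₀ (by simp [e₀])
    have t1 := htan e₁ (by simp [e₁])
    have s0 : frameVec τ ν 0 = τ.linear e₀ := rfl
    have s1 : frameVec τ ν 1 = τ.linear e₁ := rfl
    have s2 : frameVec τ ν 2 = ν := rfl
    rw [s0, s1, s2]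
    linarith

theorem field_asymp_normal (hF : IsFrame τ α ν a c) (hg : IsPlaneSymbol δ Q N g) (hδ : 0 ≤ δ)
    (hδ₁ : δ < 1 / 2) (hQ : 0 ≤ Q) {ρ : ℝ} (hρ : 0 < ρ) (β γ : ℂ) :
    ∃ C : ℝ, 0 ≤ C ∧ ∀ k : ℝ, 1 < k → ∀ x : E2, ‖x‖ < ρ → ∀ z ∈ Set.Ioo 0 ρ, ∀ u E : ℂ,
      g k =ᶠ[𝓝 (x - z • c⁻¹ • a)] (fun _ => u) →
      E = planeWave k α (τ x) * Complex.exp (Complex.I * (k * c * z : ℝ)) →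
      ‖field τ α ν β γ k (g k) (τ x + z • ν) - 2 * Real.pi * (Complex.I * β / c - γ) * u * E‖ ≤
        C / k ∧
      ‖fderiv ℝ (field τ α ν β γ k (g k)) (τ x + z • ν) ν -
        Complex.I * (k * c : ℝ) * (2 * Real.pi * (Complex.I * β / c - γ) * u * E)‖ ≤ C / k := by
  -- The exponent 2 leaves 1/k after multiplication by the factor k in front of the single layer.
  obtain ⟨C, hC0, hC⟩ := layer_asymp hF hg hδ hδ₁ hQ hρ 2
  refine ⟨‖β‖ * C + ‖γ‖ * C, by positivity, fun k hk x hx z hz u E hu hE => ?_⟩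
  have hk0 : 0 < k := by linarith
  have hk' : (k : ℂ) ≠ 0 := by exact_mod_cast hk0.ne'
  have hc' : (c : ℂ) ≠ 0 := by exact_mod_cast hF.pos.ne'
  obtain ⟨h0, h1, h2⟩ := hC k hk x hx z hz u E hu hE
  have hr := notMem_image_of_height hF.norm_normal hF.normal (x := x) hz.1.ne' (tsupport (g k))
  have hpow : k * k ^ (-2 : ℝ) = k⁻¹ := by
    rw [Real.rpow_neg hk0.le, Real.rpow_two]; field_simp
  have hpow' : k ^ (-2 : ℝ) ≤ k⁻¹ := by
    rw [← hpow]
    exact le_mul_of_one_le_left (by positivity) hk.le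
  have key : ∀ A B : ℂ, ‖A‖ ≤ C * k ^ (-2 : ℝ) → ‖B‖ ≤ C * k ^ (-2 : ℝ) →
      ‖k * β * A + γ * B‖ ≤ (‖β‖ * C + ‖γ‖ * C) / k := fun A B hA hB => by
    rw [add_div]
    refine (norm_add_le _ _).trans (add_le_add ?_ ?_)
    · rw [norm_mul, norm_mul, Complex.norm_real, Real.norm_of_nonneg hk0.le]
      calc _ ≤ k * ‖β‖ * (C * k ^ (-2 : ℝ)) := by gcongr
        _ = ‖β‖ * C * (k * k ^ (-2 : ℝ)) := by ring
        _ = _ := by rw [hpow, div_eq_mul_inv]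
    · rw [norm_mul]
      calc _ ≤ ‖γ‖ * (C * k ^ (-2 : ℝ)) := by gcongr
        _ ≤ ‖γ‖ * (C * k⁻¹) := by gcongr
        _ = _ := by rw [div_eq_mul_inv]; ring
  constructor
  · convert key _ _ h0 h1 using 2
    rw [field]
    push_cast
    field_simp
    ring
  · rw [fderiv_field_apply (hg.symbol.smooth k hk) (hg.hasCompactSupport hk) hr]
    convert key _ _ h1 h2 using 2
    push_cast
    field_simp
    linear_combination (-2 * (k : ℂ) * β * Real.pi * u * E) * Complex.I_mul_I

end FieldBounds

/-! ### Plane waves continued from the plane -/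

/-- The plane wave in the direction `d` with the phase shift `t`. -/
def phasedWave (k : ℝ) (d : E3) (t : ℝ) (r : E3) : ℂ :=
  planeWave k d r * Complex.exp (Complex.I * (k * t : ℝ))

theorem contDiff_phasedWave (k : ℝ) (d : E3) (t : ℝ) : ContDiff ℝ ∞ (phasedWave k d t) :=
  (contDiff_planeWave k d).mul contDiff_const

theorem fderiv_phasedWave (k : ℝ) (d : E3) (t : ℝ) (r v : E3) :
    fderiv ℝ (phasedWave k d t) r v = Complex.I * (k * inner ℝ d v : ℝ) * phasedWave k d t r := by
  have h := (((contDiff_planeWave k d).differentiable (by simp) r).hasFDerivAt).mul_const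
    (Complex.exp (Complex.I * (k * t : ℝ)))
  have h2 : fderiv ℝ (phasedWave k d t) r = _ := h.fderiv
  rw [h2]
  simp only [smul_apply, smul_eq_mul, fderiv_planeWave, phasedWave]
  ring

theorem norm_phasedWave (k : ℝ) (d : E3) (t : ℝ) (r : E3) : ‖phasedWave k d t r‖ = 1 := by
  rw [phasedWave, norm_mul, norm_planeWave, norm_exp_I_mul, one_mul]

theorem norm_fderiv_phasedWave_le {k : ℝ} (hk : 0 ≤ k) (d : E3) (t : ℝ) (r : E3) :
    ‖fderiv ℝ (phasedWave k d t) r‖ ≤ k * ‖d‖ := by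
  refine ContinuousLinearMap.opNorm_le_bound _ (by positivity) fun v => ?_
  rw [fderiv_phasedWave, norm_mul, norm_phasedWave, norm_mul, Complex.norm_I, Complex.norm_real,
    norm_mul, Real.norm_of_nonneg hk, one_mul, mul_one, mul_assoc]
  exact mul_le_mul_of_nonneg_left (norm_inner_le_norm d v) hk

/-- The direction `d` and the phase shift `t` of the wave that continues the incident wave from the
plane to the side of `ν`. -/
structure IsContinued (τ : E2 →ᵃⁱ[ℝ] E3) (α ν : E3) (a : E2) (c : ℝ) (d : E3) (t : ℝ) : Prop where
  tangent : ∀ v : E2, inner ℝ d (τ.linear v) = inner ℝ a v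
  normal : inner ℝ d ν = c
  shift : inner ℝ d (τ 0) + t = inner ℝ α (τ 0)

section Asymptotics

variable {τ : E2 →ᵃⁱ[ℝ] E3} {α ν : E3} {a : E2} {c : ℝ}
  {δ Q : ℝ} {g : ℝ → E2 → ℂ} {d : E3} {t : ℝ}

theorem phasedWave_apply (hF : IsFrame τ α ν a c) (hd : IsContinued τ α ν a c d t) (k : ℝ) (x : E2)
    (z : ℝ) : phasedWave k d t (τ x + z • ν) =
      planeWave k α (τ x) * Complex.exp (Complex.I * (k * c * z : ℝ)) := by
  rw [phasedWave, planeWave, planeWave, ← Complex.exp_add, ← Complex.exp_add, ← mul_add, ← mul_add,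
    ← Complex.ofReal_add, ← Complex.ofReal_add]
  congr 3
  rw [affineIsometry_apply τ x]
  simp only [inner_add_right, inner_smul_right, hd.tangent, hd.normal, hF.tangent]
  linear_combination k * hd.shift

/-- Near the ray base the differentiated density vanishes, so its field is O(1/k), and the other
tangential term is k|a|·O(1/k). The errors obtained are thus O(1/k) for values and O(1) for
gradients, before they are weakened to powers of √k. -/
theorem field_asymp (hF : IsFrame τ α ν a c) (hd : IsContinued τ α ν a c d t)
    (hg : IsPlaneSymbol δ Q 0 g) (hδ : 0 ≤ δ)
    (hδ₁ : δ < 1 / 2) (hQ : 0 ≤ Q) {ρ : ℝ} (hρ : 0 < ρ) (β γ : ℂ) :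
    ∃ C : ℝ, 0 ≤ C ∧ ∀ k : ℝ, 1 < k → ∀ x : E2, ‖x‖ < ρ → ∀ z ∈ Set.Ioo 0 ρ, ∀ u A : ℂ,
      g k =ᶠ[𝓝 (x - z • c⁻¹ • a)] (fun _ => u) → A = 2 * Real.pi * (Complex.I * β / c - γ) * u →
      ‖field τ α ν β γ k (g k) (τ x + z • ν) - A * phasedWave k d t (τ x + z • ν)‖ ≤ C / √k ∧
      ‖fderiv ℝ (field τ α ν β γ k (g k)) (τ x + z • ν) -
        A • fderiv ℝ (phasedWave k d t) (τ x + z • ν)‖ ≤ C * √k := by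
  obtain ⟨C, hC0, hC⟩ := field_asymp_normal hF hg hδ hδ₁ hQ hρ β γ
  choose C' hC'0 hC' using fun e => field_asymp_normal hF (hg.dirDeriv e) hδ hδ₁ hQ hρ β γ
  set e₀ : E2 := EuclideanSpace.single 0 1
  set e₁ : E2 := EuclideanSpace.single 1 1
  have := hC'0 e₀
  have := hC'0 e₁
  refine ⟨C + (C' e₀ + ‖a‖ * C) + (C' e₁ + ‖a‖ * C), by positivity,
    fun k hk x hx z hz u A hu hA => ?_⟩
  have hk0 : 0 < k := by linarith
  have hr := notMem_image_of_height hF.norm_normal hF.normal (x := x) hz.1.ne' (tsupport (g k))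
  have hgs := hg.symbol.smooth k hk
  have hgc := hg.hasCompactSupport hk
  set r := τ x + z • ν with hrdef
  set E := phasedWave k d t r with hE
  have hEeq := phasedWave_apply hF hd k x z
  obtain ⟨h0, h1⟩ := hC k hk x hx z hz u E hu hEeq
  rw [← hA] at h0 h1
  have hsq : 1 ≤ √k := Real.one_le_sqrt.2 hk.le
  have hsk : √k ≤ k := by nlinarith [Real.mul_self_sqrt hk0.le]
  have hdiv : ∀ D : ℝ, 0 ≤ D → D / k ≤ D := fun D hD => div_le_self hD hk.le
  constructor
  · refine h0.trans ?_
    have : C ≤ C + (C' e₀ + ‖a‖ * C) + (C' e₁ + ‖a‖ * C) := by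
      nlinarith [mul_nonneg (norm_nonneg a) hC0]
    gcongr
  · have htan : ∀ e : E2, ‖e‖ = 1 → ‖(fderiv ℝ (field τ α ν β γ k (g k)) r -
        A • fderiv ℝ (phasedWave k d t) r) (τ.linear e)‖ ≤ C' e + ‖a‖ * C := fun e he => by
      have h2 := (hC' e k hk x hx z hz 0 E (dirDeriv_eventuallyEq_zero hu e) hEeq).1
      rw [mul_zero, zero_mul, sub_zero] at h2
      simp only [sub_apply, smul_apply, smul_eq_mul]
      rw [fderiv_field_tangent hgs hgc hF.tangent hr, fderiv_phasedWave, hd.tangent]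
      rw [show ∀ P R W : ℂ, P + W * R - A * (W * phasedWave k d t r) = P + W * (R - A * E) by
        intros; rw [hE]; ring]
      refine (norm_add_le _ _).trans (add_le_add (h2.trans (hdiv _ (hC'0 e))) ?_)
      rw [norm_mul, norm_mul, Complex.norm_I, one_mul, Complex.norm_real, norm_mul,
        Real.norm_of_nonneg hk0.le]
      have h4 : ‖inner ℝ a e‖ ≤ ‖a‖ := by
        simpa [he] using norm_inner_le_norm (𝕜 := ℝ) a e
      calc _ ≤ k * ‖a‖ * (C / k) := by gcongr
        _ = _ := by field_simp
    have hnor : ‖(fderiv ℝ (field τ α ν β γ k (g k)) r -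
        A • fderiv ℝ (phasedWave k d t) r) ν‖ ≤ C := by
      simp only [sub_apply, smul_apply, smul_eq_mul]
      rw [fderiv_phasedWave, hd.normal, mul_left_comm]
      exact h1.trans (hdiv _ hC0)
    refine (norm_le_sum_frameVec hF.norm_normal hF.normal _).trans ?_
    rw [Fin.sum_univ_three]
    have t0 := htan e₀ (by simp [e₀])
    have t1 := htan e₁ (by simp [e₁])
    have s0 : frameVec τ ν 0 = τ.linear e₀ := rfl
    have s1 : frameVec τ ν 1 = τ.linear e₁ := rfl
    have s2 : frameVec τ ν 2 = ν := rfl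
    rw [s0, s1, s2]
    refine le_trans ?_ (le_mul_of_one_le_right (by positivity) hsq)
    linarith

end Asymptotics

/-! ### The cut-off extended by zero -/

/-- The cut-off function on `M₀`, extended by zero. -/
def cutoffExt (M₀ : Set E2) (η : ℝ → E2 → ℝ) (k : ℝ) (q : E2) : ℂ := (M₀.indicator (η k) q : ℝ)

section Cutoff

variable {δ : ℝ} {M₀ : Set E2} {η : ℝ → E2 → ℝ} {k : ℝ}

/-- Some frontier point realizes the distance from x to the complement of s, and y lies in that
complement. -/
theorem infDist_frontier_le_dist {s : Set E2} {x y : E2} (hx : x ∈ s) (hy : y ∉ s) :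
    Metric.infDist x (frontier s) ≤ dist x y := by
  obtain ⟨z, hz, hxz⟩ := exists_mem_frontier_infDist_compl_eq_dist hx fun h => hy (h ▸ trivial)
  exact (Metric.infDist_le_dist_of_mem hz).trans (hxz ▸ Metric.infDist_le_dist_of_mem hy)

/-- Points of M₀ within k^{-δ} of a point outside M₀ are as close to the frontier, where the cut-off
vanishes. The extension by zero is therefore smooth, with closed support inside M₀. -/
theorem cutoffExt_eventuallyEq_zero (hη : IsCutoff δ M₀ η) (hk : 1 < k) {q : E2} (hq : q ∉ M₀) :
    cutoffExt M₀ η k =ᶠ[𝓝 q] fun _ => 0 := by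
  have hk' : 0 < k ^ (-δ) := Real.rpow_pos_of_pos (by linarith) _
  filter_upwards [Metric.ball_mem_nhds q hk'] with q' hq'
  by_cases h : q' ∈ M₀
  · rw [cutoffExt, Set.indicator_of_mem h, hη.eq_zero k hk q' h
      ((infDist_frontier_le_dist h hq).trans_lt hq'), Complex.ofReal_zero]
  · rw [cutoffExt, Set.indicator_of_notMem h, Complex.ofReal_zero]

theorem cutoffExt_eventuallyEq_comp (hM : IsOpen M₀) {q : E2} (hq : q ∈ M₀) :
    cutoffExt M₀ η k =ᶠ[𝓝 q] Complex.ofRealLI ∘ η k := by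
  filter_upwards [hM.mem_nhds hq] with q' hq'
  rw [cutoffExt, Set.indicator_of_mem hq']
  rfl

theorem tsupport_cutoffExt_subset (hη : IsCutoff δ M₀ η) (hk : 1 < k) :
    tsupport (cutoffExt M₀ η k) ⊆ M₀ := by
  intro q hq
  by_contra h
  exact notMem_tsupport_iff_eventuallyEq.2 (cutoffExt_eventuallyEq_zero hη hk h) hq

theorem isPlaneSymbol_cutoffExt (hM : IsOpen M₀) (hη : IsCutoff δ M₀ η) {Q : ℝ}
    (hQ : ∀ q ∈ M₀, ‖q‖ ≤ Q) : IsPlaneSymbol δ Q 0 (cutoffExt M₀ η) where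
  symbol := by
    refine ⟨fun k hk => contDiff_iff_contDiffAt.2 fun q => ?_, fun m => ?_⟩
    · by_cases hq : q ∈ M₀
      · exact (Complex.ofRealLI.contDiff.contDiffAt.comp q
          ((hη.smooth k hk).contDiffAt (hM.mem_nhds hq))).congr_of_eventuallyEq
            (cutoffExt_eventuallyEq_comp hM hq)
      · exact contDiffAt_const.congr_of_eventuallyEq (cutoffExt_eventuallyEq_zero hη hk hq)
    · obtain ⟨C, hC⟩ := hη.deriv_bound m
      refine ⟨max C 0, fun k hk q _ => ?_⟩
      have hk' : 0 ≤ k ^ (δ * m) := Real.rpow_nonneg (by linarith) _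
      rw [zero_add]
      by_cases hq : q ∈ M₀
      · rw [((cutoffExt_eventuallyEq_comp hM hq).iteratedFDeriv ℝ m).eq_of_nhds,
          LinearIsometry.norm_iteratedFDeriv_comp_left _
            ((hη.smooth k hk).contDiffAt (hM.mem_nhds hq)) (by exact_mod_cast le_top)]
        exact (hC k hk q hq).trans (mul_le_mul_of_nonneg_right (le_max_left _ _) hk')
      · rw [((cutoffExt_eventuallyEq_zero hη hk hq).iteratedFDeriv ℝ m).eq_of_nhds,
          iteratedFDeriv_fun_zero, Pi.zero_apply, norm_zero]
        positivity
  eq_zero k _ q hq := by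
    rw [cutoffExt, Set.indicator_of_notMem fun h => (hQ q h).not_gt hq, Complex.ofReal_zero]

theorem cutoffExt_eventuallyEq_one (hM : IsOpen M₀) (hη : IsCutoff δ M₀ η) (hk : 1 < k) {q : E2}
    (hq : q ∈ M₀) (hd : 2 * k ^ (-δ) < Metric.infDist q (frontier M₀)) :
    cutoffExt M₀ η k =ᶠ[𝓝 q] fun _ => 1 := by
  filter_upwards [hM.mem_nhds hq,
    (Metric.continuous_infDist_pt (frontier M₀)).continuousAt.eventually (lt_mem_nhds hd)]
    with q' h1 h2
  rw [cutoffExt, Set.indicator_of_mem h1, hη.eq_one k hk q' h1 h2, Complex.ofReal_one]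

end Cutoff

/-! ### The Kirchhoff approximation as a combined layer, and its amplitudes -/

section Kirchhoff

variable {τ : E2 →ᵃⁱ[ℝ] E3} {M₀ : Set E2} {η : ℝ → E2 → ℝ} {α n : E3} {Λ : ℂ}

theorem singleLayer_eq_layer (hM : IsOpen M₀) (k : ℝ) (r : E3) :
    singleLayer τ M₀ η α k r =
      layer τ (sphericalKernel k) (waveDensity τ α k (cutoffExt M₀ η k)) r := by
  rw [singleLayer, layer, ← integral_indicator hM.measurableSet]
  congr 1
  ext1 q
  by_cases hq : q ∈ M₀ <;> simp [hq, waveDensity, cutoffExt, sphericalWave, sphericalKernel]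

/-- The sign arises because the kernel is differentiated in q, while `layer` uses its derivative as
a function of r - q. -/
theorem doubleLayer_eq_layer (hM : IsOpen M₀) (k : ℝ) (r : E3) :
    doubleLayer τ M₀ η α n k r =
      -layer τ (dirDeriv n (sphericalKernel k)) (waveDensity τ α k (cutoffExt M₀ η k)) r := by
  rw [doubleLayer, layer, ← integral_indicator hM.measurableSet, ← integral_neg]
  congr 1
  ext1 q
  by_cases hq : q ∈ M₀ <;> simp [hq, waveDensity, cutoffExt, fderiv_sphericalWave]

theorem kirchhoff_eq_field (hM : IsOpen M₀) (k : ℝ) :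
    kirchhoff τ M₀ η α n Λ k = field τ α n
      (Complex.I / (4 * Real.pi) * (reflCoeff α n Λ - 1) * (inner ℝ n α : ℝ))
      (-((reflCoeff α n Λ + 1) / (4 * Real.pi))) k (cutoffExt M₀ η k) := by
  ext1 r
  rw [kirchhoff, field, singleLayer_eq_layer hM, doubleLayer_eq_layer hM]
  ring

/-- Reversing the normal changes the sign of the kernel derivative only. This lets one estimate,
made on the side of the normal, serve both sides of the plane. -/
theorem field_neg_normal (β γ : ℂ) (k : ℝ) (g : E2 → ℂ) :
    field τ α (-n) β (-γ) k g = field τ α n β γ k g := by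
  ext1 r
  have h : dirDeriv (-n) (sphericalKernel k) = fun v => -dirDeriv n (sphericalKernel k) v := by
    ext1 v
    simp [dirDeriv]
  simp only [field, h, layer, mul_neg, integral_neg, neg_mul, neg_neg]

theorem isFrame_normal (hα : ‖α‖ = 1) (hn : ‖n‖ = 1) (hnorm : ∀ v : E2, inner ℝ n (τ.linear v) = 0)
    (hnα : inner ℝ n α < 0) : IsFrame τ α n (tangentPart τ α) (-inner ℝ n α) := by
  have h := linear_tangentPart hn hnorm α
  have h' : ∀ v : E2, inner ℝ α (τ.linear v) = inner ℝ (tangentPart τ α) v := fun v => by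
    conv_lhs => rw [← h]
    rw [inner_add_left, inner_linear, inner_smul_left, hnorm, mul_zero, add_zero]
  refine ⟨hn, hnorm, h', by linarith, ?_⟩
  have h2 : inner ℝ α α = 1 := by rw [real_inner_self_eq_norm_sq, hα, one_pow]
  nth_rw 2 [← h] at h2
  rw [inner_add_right, h', inner_smul_right, real_inner_self_eq_norm_sq, real_inner_comm n α] at h2
  linarith

theorem IsFrame.neg {a : E2} {c : ℝ} (h : IsFrame τ α n a c) : IsFrame τ α (-n) a c :=
  ⟨by rw [norm_neg, h.norm_normal], fun v => by rw [inner_neg_left, h.normal, neg_zero],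
    h.tangent, h.pos, h.sq⟩

theorem isContinued_reflDir {a : E2} (h : IsFrame τ α n a (-inner ℝ n α)) :
    IsContinued τ α n a (-inner ℝ n α) (reflDir α n) (phaseShift τ α n) := by
  refine ⟨fun v => ?_, ?_, ?_⟩
  · rw [reflDir, inner_sub_left, inner_smul_left, h.normal, h.tangent, mul_zero, sub_zero]
  · rw [reflDir, inner_sub_left, real_inner_smul_left, real_inner_self_eq_norm_sq, h.norm_normal,
      real_inner_comm n α]
    ring
  · rw [reflDir, inner_sub_left, real_inner_smul_left, phaseShift]
    ring

theorem isContinued_self {a : E2} (h : IsFrame τ α n a (-inner ℝ n α)) :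
    IsContinued τ α (-n) a (-inner ℝ n α) α 0 :=
  ⟨h.tangent, by rw [inner_neg_right, real_inner_comm], add_zero _⟩

/-- With c = -n·α one has iβ/c = (A-1)/(4π) and -γ = (A+1)/(4π), whose sum is A/(2π). -/
theorem reflected_amplitude (hnα : inner ℝ n α < 0) :
    2 * Real.pi * (Complex.I * (Complex.I / (4 * Real.pi) * (reflCoeff α n Λ - 1) *
      (inner ℝ n α : ℝ)) / (-inner ℝ n α : ℝ) - -((reflCoeff α n Λ + 1) / (4 * Real.pi))) =
      reflCoeff α n Λ := by
  have h1 : ((inner ℝ n α : ℝ) : ℂ) ≠ 0 := by exact_mod_cast hnα.ne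
  have h2 : (Real.pi : ℂ) ≠ 0 := by exact_mod_cast Real.pi_ne_zero
  push_cast
  field_simp
  ring_nf
  simp only [Complex.I_sq]
  ring

/-- On the other side γ changes sign: (A-1)/(4π) - (A+1)/(4π) = -1/(2π), so the reflection
coefficient cancels. -/
theorem shadow_amplitude (hnα : inner ℝ n α < 0) :
    2 * Real.pi * (Complex.I * (Complex.I / (4 * Real.pi) * (reflCoeff α n Λ - 1) *
      (inner ℝ n α : ℝ)) / (-inner ℝ n α : ℝ) - (reflCoeff α n Λ + 1) / (4 * Real.pi)) = -1 := by
  have h1 : ((inner ℝ n α : ℝ) : ℂ) ≠ 0 := by exact_mod_cast hnα.ne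
  have h2 : (Real.pi : ℂ) ≠ 0 := by exact_mod_cast Real.pi_ne_zero
  push_cast
  field_simp
  ring_nf
  simp only [Complex.I_sq]
  ring

end Kirchhoff

/-! ### Ray zones in coordinates of base and height -/

/-- The point where the ray through `r` with the tangential slope `b` leaves the plane. -/
def rayBase (τ : E2 →ᵃⁱ[ℝ] E3) (ν : E3) (b : E2) (r : E3) : E2 := foot τ r - height τ ν r • b

section Zones

variable {τ : E2 →ᵃⁱ[ℝ] E3} {α ν : E3} {a : E2} {c : ℝ} {d : E3} {t : ℝ} {M₀ : Set E2}

theorem continuous_rayBase (τ : E2 →ᵃⁱ[ℝ] E3) (ν : E3) (b : E2) : Continuous (rayBase τ ν b) :=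
  (continuous_foot τ).sub ((continuous_height τ ν).smul continuous_const)

theorem isOpen_upperSide (τ : E2 →ᵃⁱ[ℝ] E3) (ν : E3) : IsOpen (upperSide τ ν) :=
  isOpen_lt continuous_const (continuous_height τ ν)

theorem height_neg (τ : E2 →ᵃⁱ[ℝ] E3) (ν r : E3) : height τ (-ν) r = -height τ ν r :=
  inner_neg_left _ _

theorem height_image (hF : IsFrame τ α ν a c) (q : E2) : height τ ν (τ q) = 0 := by
  simpa using height_apply hF.norm_normal hF.normal q 0

theorem foot_image (hF : IsFrame τ α ν a c) (q : E2) : foot τ (τ q) = q := by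
  simpa using foot_apply (τ := τ) hF.normal q 0

theorem rayBase_image (hF : IsFrame τ α ν a c) (b q : E2) : rayBase τ ν b (τ q) = q := by
  rw [rayBase, height_image hF, foot_image hF, zero_smul, sub_zero]

theorem IsContinued.direction_eq (hF : IsFrame τ α ν a c) (hd : IsContinued τ α ν a c d t) :
    d = τ.linear a + c • ν := by
  have h := linear_tangentPart hF.norm_normal hF.normal d
  rw [real_inner_comm, hd.normal] at h
  rw [← h]
  congr 2
  refine ext_inner_right ℝ fun v => ?_
  rw [← hd.tangent v]
  conv_rhs => rw [← h]
  rw [inner_add_left, inner_linear, real_inner_smul_left, hF.normal, mul_zero, add_zero]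

theorem add_smul_direction (hF : IsFrame τ α ν a c) (hd : IsContinued τ α ν a c d t) (q : E2)
    (s : ℝ) : τ q + s • d = τ (q + s • a) + (s * c) • ν := by
  rw [hd.direction_eq hF, affineIsometry_apply τ q, affineIsometry_apply τ (q + s • a), map_add,
    map_smul, smul_add, smul_smul]
  abel

/-- The direction is `τ.linear a + c • ν`, so the ray parameter is height/c and the foot moves with
slope a/c per unit of height. -/
theorem rayZone_eq (hF : IsFrame τ α ν a c) (hd : IsContinued τ α ν a c d t) :
    rayZone (τ '' M₀) d = upperSide τ ν ∩ rayBase τ ν (c⁻¹ • a) ⁻¹' M₀ := by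
  have hc := hF.pos
  ext r
  constructor
  · rintro ⟨-, ⟨q, hq, rfl⟩, s, hs, rfl⟩
    rw [add_smul_direction hF hd]
    refine ⟨?_, ?_⟩
    · change 0 < height τ ν _
      rw [height_apply hF.norm_normal hF.normal]
      positivity
    · rw [Set.mem_preimage, rayBase, height_apply hF.norm_normal hF.normal, foot_apply hF.normal,
        smul_smul, mul_assoc, mul_inv_cancel₀ hc.ne', mul_one, add_sub_cancel_right]
      exact hq
  · rintro ⟨h1, h2⟩
    refine ⟨_, ⟨_, h2, rfl⟩, height τ ν r / c, div_pos h1 hc, ?_⟩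
    rw [add_smul_direction hF hd, div_mul_cancel₀ _ hc.ne', rayBase, smul_smul, ← div_eq_mul_inv,
      sub_add_cancel, foot_add_height hF.norm_normal hF.normal]

theorem isOpen_rayZone (hF : IsFrame τ α ν a c) (hd : IsContinued τ α ν a c d t) (hM : IsOpen M₀) :
    IsOpen (rayZone (τ '' M₀) d) := by
  rw [rayZone_eq hF hd]
  exact (isOpen_upperSide τ ν).inter (hM.preimage (continuous_rayBase τ ν _))

/-- Base and height are continuous coordinates with a continuous inverse, in which the zone is the
product of M₀ and a half-line. -/
theorem closure_rayZone (hF : IsFrame τ α ν a c) (hd : IsContinued τ α ν a c d t) :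
    closure (rayZone (τ '' M₀) d) =
      {r | 0 ≤ height τ ν r} ∩ rayBase τ ν (c⁻¹ • a) ⁻¹' closure M₀ := by
  rw [rayZone_eq hF hd]
  refine subset_antisymm (closure_minimal ?_ ?_) ?_
  · exact Set.inter_subset_inter (fun r (hr : 0 < height τ ν r) => hr.le)
      (Set.preimage_mono subset_closure)
  · exact (isClosed_le continuous_const (continuous_height τ ν)).inter
      (isClosed_closure.preimage (continuous_rayBase τ ν _))
  · rintro r ⟨h1, h2⟩
    have hcont : Continuous fun p : E2 × ℝ => τ (p.1 + p.2 • c⁻¹ • a) + p.2 • ν := by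
      have := τ.continuous
      fun_prop
    have hmem : (rayBase τ ν (c⁻¹ • a) r, height τ ν r) ∈ closure (M₀ ×ˢ Set.Ioi (0 : ℝ)) := by
      rw [closure_prod_eq, closure_Ioi]
      exact ⟨h2, h1⟩
    have h := map_mem_closure hcont hmem (t := upperSide τ ν ∩ rayBase τ ν (c⁻¹ • a) ⁻¹' M₀) ?_
    · rwa [rayBase, sub_add_cancel, foot_add_height hF.norm_normal hF.normal] at h
    · rintro ⟨q, s⟩ ⟨hq, hs⟩
      refine ⟨?_, ?_⟩
      · change 0 < height τ ν _
        rw [height_apply hF.norm_normal hF.normal]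
        exact hs
      · rw [Set.mem_preimage, rayBase, height_apply hF.norm_normal hF.normal, foot_apply hF.normal,
          add_sub_cancel_right]
        exact hq

theorem rayZone_subset_upperSide (hF : IsFrame τ α ν a c) (hd : IsContinued τ α ν a c d t) :
    rayZone (τ '' M₀) d ⊆ upperSide τ ν :=
  rayZone_eq (M₀ := M₀) hF hd ▸ Set.inter_subset_left

theorem mem_frontier_rayZone (hF : IsFrame τ α ν a c) (hd : IsContinued τ α ν a c d t)
    (hM : IsOpen M₀) {r : E3} (h₀ : 0 ≤ height τ ν r)
    (hr : rayBase τ ν (c⁻¹ • a) r ∈ frontier M₀) : r ∈ frontier (rayZone (τ '' M₀) d) := by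
  rw [(isOpen_rayZone hF hd hM).frontier_eq, closure_rayZone hF hd]
  refine ⟨⟨h₀, hr.1⟩, fun h => ?_⟩
  rw [rayZone_eq hF hd] at h
  exact (hM.frontier_eq ▸ hr).2 h.2

theorem mem_frontier_rayZone_of_height (hF : IsFrame τ α ν a c) (hd : IsContinued τ α ν a c d t)
    (hM : IsOpen M₀) {r : E3} (h₀ : height τ ν r = 0) (hr : foot τ r ∈ closure M₀) :
    r ∈ frontier (rayZone (τ '' M₀) d) := by
  rw [(isOpen_rayZone hF hd hM).frontier_eq, closure_rayZone hF hd]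
  refine ⟨⟨h₀.ge, ?_⟩, fun h => ?_⟩
  · rwa [Set.mem_preimage, rayBase, h₀, zero_smul, sub_zero]
  · have := rayZone_subset_upperSide hF hd h
    exact this.ne' h₀

theorem mem_closure_upperSide (hF : IsFrame τ α ν a c) {r : E3} (h₀ : 0 ≤ height τ ν r) :
    r ∈ closure (upperSide τ ν) := by
  have hcont : Continuous fun s : ℝ => τ (foot τ r) + s • ν := by fun_prop
  have h := map_mem_closure hcont (show height τ ν r ∈ closure (Set.Ioi 0) by rwa [closure_Ioi])
    (t := upperSide τ ν) fun s hs => by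
      change 0 < height τ ν _
      rw [height_apply hF.norm_normal hF.normal]
      exact hs
  rwa [foot_add_height hF.norm_normal hF.normal] at h

theorem abs_height_le (hF : IsFrame τ α ν a c) (r : E3) : |height τ ν r| ≤ ‖r‖ + ‖τ 0‖ := by
  have h := abs_real_inner_le_norm ν (r - τ 0)
  rw [hF.norm_normal, one_mul] at h
  exact h.trans (norm_sub_le _ _)

theorem norm_foot_le (hF : IsFrame τ α ν a c) (r : E3) : ‖foot τ r‖ ≤ 2 * (‖r‖ + ‖τ 0‖) := by
  have h1 := abs_height_le hF r
  have h2 : τ.linear (foot τ r) = r - τ 0 - height τ ν r • ν := by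
    conv_rhs => rw [← foot_add_height hF.norm_normal hF.normal r]
    rw [height_apply hF.norm_normal hF.normal, affineIsometry_apply τ (foot τ r)]
    abel
  have h3 : ‖τ.linear (foot τ r)‖ = ‖foot τ r‖ := τ.linearIsometry.norm_map _
  rw [← h3, h2]
  have h4 := norm_sub_le (r - τ 0) (height τ ν r • ν)
  rw [norm_smul, hF.norm_normal, mul_one, Real.norm_eq_abs] at h4
  have h5 := norm_sub_le r (τ 0)
  linarith

end Zones

/-! ### The eikonal approximation on the ray zones -/

section Eikonal

variable {τ : E2 →ᵃⁱ[ℝ] E3} {α n : E3} {a : E2} {Λ : ℂ} {M₀ : Set E2} {k : ℝ}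

theorem eikonal_of_mem_shadowZone {r : E3} (hr : r ∈ rayZone (τ '' M₀) α) :
    eikonal τ M₀ α n Λ k r = -1 * phasedWave k α 0 r := by
  rw [eikonal, shadowZone, if_pos hr, phasedWave]
  simp

theorem eikonal_of_mem_reflectedZone (hF : IsFrame τ α n a (-inner ℝ n α)) {r : E3}
    (hr : r ∈ rayZone (τ '' M₀) (reflDir α n)) :
    eikonal τ M₀ α n Λ k r =
      reflCoeff α n Λ * phasedWave k (reflDir α n) (phaseShift τ α n) r := by
  have h1 := rayZone_subset_upperSide hF (isContinued_reflDir hF) hr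
  have h2 : r ∉ rayZone (τ '' M₀) α := fun h => by
    have h3 : 0 < height τ (-n) r := rayZone_subset_upperSide hF.neg (isContinued_self hF) h
    rw [height_neg] at h3
    have h4 : 0 < height τ n r := h1
    linarith
  rw [eikonal, shadowZone, reflectedZone, if_neg h2, if_pos hr, phasedWave, planeWave,
    ← Complex.exp_add, ← mul_add, ← Complex.ofReal_add, mul_add]

theorem eikonal_of_notMem {r : E3} (h₁ : r ∉ rayZone (τ '' M₀) (reflDir α n))
    (h₂ : r ∉ rayZone (τ '' M₀) α) : eikonal τ M₀ α n Λ k r = 0 := by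
  rw [eikonal, shadowZone, reflectedZone, if_neg h₂, if_neg h₁]

end Eikonal

/-! ### Estimates on one side of the plane -/

/-- On the side of `ν`, the function `Φ` is a layer potential with a cut-off density, and `ψ` is the
continued wave with the amplitude `B` in the zone covered by the rays and vanishes elsewhere. -/
structure IsSide (τ : E2 →ᵃⁱ[ℝ] E3) (M₀ : Set E2) (η : ℝ → E2 → ℝ) (α ν : E3) (a : E2) (c : ℝ)
    (d : E3) (t : ℝ) (B : ℂ) (Φ ψ : ℝ → E3 → ℂ) : Prop where
  frame : IsFrame τ α ν a c
  continued : IsContinued τ α ν a c d t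
  exists_field : ∃ β γ : ℂ, B = 2 * Real.pi * (Complex.I * β / c - γ) ∧
    ∀ k, Φ k = field τ α ν β γ k (cutoffExt M₀ η k)
  eq_wave : ∀ k, ∀ r ∈ rayZone (τ '' M₀) d, ψ k r = B * phasedWave k d t r
  eq_zero : ∀ k, ∀ r ∈ upperSide τ ν, r ∉ rayZone (τ '' M₀) d → ψ k r = 0

/-- It is enough to have the inequalities at points of Z that accumulate at r, because the limits
along Z exist. -/
theorem OneSidedClose.of_mem_closure {Z : Set E3} {f g : E3 → ℂ} {r : E3} {A₁ A₂ : ℝ}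
    (hf : ∃ u, Tendsto f (𝓝[Z] r) (𝓝 u)) (hg : ∃ v, Tendsto g (𝓝[Z] r) (𝓝 v))
    (hf' : ∃ U, Tendsto (fderiv ℝ f) (𝓝[Z] r) (𝓝 U))
    (hg' : ∃ V, Tendsto (fderiv ℝ g) (𝓝[Z] r) (𝓝 V))
    (hr : r ∈ closure {s | s ∈ Z ∧ ‖f s - g s‖ ≤ A₁ ∧ ‖fderiv ℝ f s - fderiv ℝ g s‖ ≤ A₂}) :
    OneSidedClose Z f g r A₁ A₂ := by
  obtain ⟨u, hu⟩ := hf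
  obtain ⟨v, hv⟩ := hg
  obtain ⟨U, hU⟩ := hf'
  obtain ⟨V, hV⟩ := hg'
  have hr' : ∃ᶠ s in 𝓝[Z] r, ‖f s - g s‖ ≤ A₁ ∧ ‖fderiv ℝ f s - fderiv ℝ g s‖ ≤ A₂ :=
    frequently_nhdsWithin_iff.2 ((mem_closure_iff_frequently.1 hr).mono fun s hs => ⟨hs.2, hs.1⟩)
  exact ⟨u, v, U, V, hu, hv, hU, hV,
    le_of_tendsto_of_frequently (hu.sub hv).norm (hr'.mono fun s hs => hs.1),
    le_of_tendsto_of_frequently (hU.sub hV).norm (hr'.mono fun s hs => hs.2)⟩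

theorem fderiv_const_mul_phasedWave (B : ℂ) (k : ℝ) (d : E3) (t : ℝ) (r : E3) :
    fderiv ℝ (fun r => B * phasedWave k d t r) r = B • fderiv ℝ (phasedWave k d t) r :=
  fderiv_const_mul ((contDiff_phasedWave k d t).differentiable (by simp) r) B

theorem eventually_two_mul_rpow_lt {δ d₀ : ℝ} (hδ : 0 < δ) (hd₀ : 0 < d₀) :
    ∀ᶠ k : ℝ in atTop, 2 * k ^ (-δ) < d₀ := by
  have h := (tendsto_rpow_neg_atTop hδ).const_mul 2
  rw [mul_zero] at h
  exact h.eventually (gt_mem_nhds hd₀)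

section Side

variable {τ : E2 →ᵃⁱ[ℝ] E3} {M₀ : Set E2} {η : ℝ → E2 → ℝ} {α ν : E3} {a : E2} {c : ℝ}
  {d : E3} {t : ℝ} {B : ℂ} {Φ ψ : ℝ → E3 → ℂ} {δ Q : ℝ}

theorem IsSide.eventuallyEq_wave (hs : IsSide τ M₀ η α ν a c d t B Φ ψ) (hM : IsOpen M₀) (k : ℝ)
    {r : E3} (hr : r ∈ rayZone (τ '' M₀) d) : ψ k =ᶠ[𝓝 r] fun r => B * phasedWave k d t r := by
  filter_upwards [(isOpen_rayZone hs.frame hs.continued hM).mem_nhds hr] with r' hr'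
    using hs.eq_wave k r' hr'

theorem IsSide.differentiableAt_field (hs : IsSide τ M₀ η α ν a c d t B Φ ψ) (hM : IsOpen M₀)
    (hη : IsCutoff δ M₀ η) (hQ : ∀ q ∈ M₀, ‖q‖ ≤ Q) {k : ℝ} (hk : 1 < k) {r : E3}
    (hr : r ∉ τ '' M₀) : DifferentiableAt ℝ (Φ k) r ∧ ContinuousAt (fderiv ℝ (Φ k)) r := by
  obtain ⟨β, γ, -, hΦ⟩ := hs.exists_field
  have hg := isPlaneSymbol_cutoffExt hM hη hQ
  have hr' : r ∉ τ '' tsupport (cutoffExt M₀ η k) :=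
    fun h => hr (Set.image_mono (tsupport_cutoffExt_subset hη hk) h)
  rw [hΦ k]
  obtain ⟨U, hU⟩ := exists_tendsto_fderiv_field_of_notMem (β := β) (γ := γ) (k := k)
    (hg.symbol.smooth k hk) (hg.hasCompactSupport hk) hs.frame hr'
  exact ⟨(hasFDerivAt_field (hg.symbol.smooth k hk) (hg.hasCompactSupport hk) hr').differentiableAt,
    continuousAt_of_tendsto_nhds hU⟩

/-- Once 2k^{-δ} < d₀, a base at distance at least d₀ from the frontier is either in M₀ with the
cut-off equal to 1 near it, or outside the closure, where cut-off and eikonal both vanish locally.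
-/
theorem IsSide.asymp (hs : IsSide τ M₀ η α ν a c d t B Φ ψ) (hM : IsOpen M₀)
    (hη : IsCutoff δ M₀ η) (hQ : ∀ q ∈ M₀, ‖q‖ ≤ Q) (hQ0 : 0 ≤ Q) (hδ : 0 < δ) (hδ₁ : δ < 1 / 2)
    {d₀ ρ : ℝ} (hd₀ : 0 < d₀) (hρ : 0 < ρ) :
    ∃ C : ℝ, ∀ᶠ k : ℝ in atTop, ∀ r ∈ upperSide τ ν, ‖r‖ < ρ →
      d₀ ≤ Metric.infDist (rayBase τ ν (c⁻¹ • a) r) (frontier M₀) →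
      ‖Φ k r - ψ k r‖ ≤ C / √k ∧ ‖fderiv ℝ (Φ k) r - fderiv ℝ (ψ k) r‖ ≤ C * √k := by
  obtain ⟨β, γ, hB, hΦ⟩ := hs.exists_field
  have hF := hs.frame
  have hρ' : 0 < 2 * (ρ + ‖τ 0‖) + 1 := by positivity
  obtain ⟨C, -, hC⟩ := field_asymp hF hs.continued (isPlaneSymbol_cutoffExt hM hη hQ) hδ.le hδ₁
    hQ0 hρ' β γ
  refine ⟨C, ?_⟩
  filter_upwards [eventually_two_mul_rpow_lt hδ hd₀, eventually_gt_atTop 1] with k hkd hk r hr hrρ hd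
  have hnorm := norm_foot_le hF r
  have hheight := abs_height_le hF r
  have key := hC k hk (foot τ r) (by linarith) (height τ ν r)
    ⟨hr, (le_abs_self _).trans_lt (by linarith [norm_nonneg r, norm_nonneg (τ 0)])⟩
  simp only [foot_add_height hF.norm_normal hF.normal r] at key
  rw [hΦ k]
  by_cases hmem : rayBase τ ν (c⁻¹ • a) r ∈ M₀
  · have hψ := hs.eventuallyEq_wave hM k
      (show r ∈ rayZone (τ '' M₀) d from rayZone_eq hF hs.continued ▸ ⟨hr, hmem⟩)
    rw [hψ.fderiv_eq, hψ.eq_of_nhds, fderiv_const_mul_phasedWave]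
    exact key 1 B (cutoffExt_eventuallyEq_one hM hη hk hmem (hkd.trans_le hd)) (by rw [hB, mul_one])
  · have hcl : rayBase τ ν (c⁻¹ • a) r ∉ closure M₀ := fun h => by
      have h' : rayBase τ ν (c⁻¹ • a) r ∈ frontier M₀ := hM.frontier_eq ▸ ⟨h, hmem⟩
      rw [Metric.infDist_zero_of_mem h'] at hd
      linarith
    have hψ : ψ k =ᶠ[𝓝 r] fun r => 0 * phasedWave k d t r := by
      filter_upwards [(isOpen_upperSide τ ν).mem_nhds hr, (isClosed_closure.isOpen_compl.preimage
        (continuous_rayBase τ ν (c⁻¹ • a))).mem_nhds hcl] with r' h1 h2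
      rw [zero_mul]
      refine hs.eq_zero k r' h1 fun h => h2 (subset_closure ?_)
      rw [rayZone_eq hF hs.continued] at h
      exact h.2
    rw [hψ.fderiv_eq, hψ.eq_of_nhds, fderiv_const_mul_phasedWave]
    exact key 0 0 (cutoffExt_eventuallyEq_zero hη hk hmem) (by rw [mul_zero])

theorem IsSide.bounds (hs : IsSide τ M₀ η α ν a c d t B Φ ψ) (hM : IsOpen M₀)
    (hη : IsCutoff δ M₀ η) (hQ : ∀ q ∈ M₀, ‖q‖ ≤ Q) (hQ0 : 0 ≤ Q) (hδ : 0 < δ) (hδ₁ : δ < 1 / 2)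
    {ρ : ℝ} (hρ : 0 < ρ) :
    ∃ C : ℝ, 0 ≤ C ∧ ∀ k : ℝ, 1 < k → ∀ r ∈ upperSide τ ν, ‖r‖ < ρ →
      ‖Φ k r‖ ≤ C ∧ ‖fderiv ℝ (Φ k) r‖ ≤ C * k := by
  obtain ⟨β, γ, -, hΦ⟩ := hs.exists_field
  have hF := hs.frame
  have hρ' : 0 < 2 * (ρ + ‖τ 0‖) + 1 := by positivity
  obtain ⟨C, hC0, hC⟩ := field_bounds hF (isPlaneSymbol_cutoffExt hM hη hQ) hδ.le hδ₁ hQ0 hρ' β γ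
  refine ⟨C, hC0, fun k hk r hr hrρ => ?_⟩
  have hnorm := norm_foot_le hF r
  have hheight := abs_height_le hF r
  have key := hC k hk (foot τ r) (by linarith) (height τ ν r)
    ⟨hr, (le_abs_self _).trans_lt (by linarith [norm_nonneg r, norm_nonneg (τ 0)])⟩
  rw [foot_add_height hF.norm_normal hF.normal r] at key
  rw [hΦ k]
  exact key

theorem IsSide.oneSidedClose (hs : IsSide τ M₀ η α ν a c d t B Φ ψ) (hM : IsOpen M₀)
    (hη : IsCutoff δ M₀ η) (hQ : ∀ q ∈ M₀, ‖q‖ ≤ Q) (hQ0 : 0 ≤ Q) {k : ℝ} (hk : 1 < k) {r : E3}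
    (hr : r ∈ closure (rayZone (τ '' M₀) d)) {A₁ A₂ : ℝ}
    (h : ∀ᶠ s in 𝓝 r, s ∈ rayZone (τ '' M₀) d →
      ‖Φ k s - ψ k s‖ ≤ A₁ ∧ ‖fderiv ℝ (Φ k) s - fderiv ℝ (ψ k) s‖ ≤ A₂) :
    OneSidedClose (rayZone (τ '' M₀) d) (Φ k) (ψ k) r A₁ A₂ := by
  obtain ⟨β, γ, -, hΦ⟩ := hs.exists_field
  have hF := hs.frame
  have hg := isPlaneSymbol_cutoffExt hM hη hQ
  have h₀ : 0 ≤ height τ ν r := (closure_rayZone (M₀ := M₀) hF hs.continued ▸ hr).1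
  have hle := nhdsWithin_mono r (rayZone_subset_upperSide (M₀ := M₀) hF hs.continued)
  have hwave := contDiff_phasedWave k d t
  refine OneSidedClose.of_mem_closure ?_ ?_ ?_ ?_ ?_
  · obtain ⟨u, hu⟩ := exists_tendsto_field (β := β) (γ := γ) (hg.symbol.smooth k hk)
      (hg.hasCompactSupport hk) hQ0 (hg.eq_zero k hk) hF h₀
    rw [hΦ k]
    exact ⟨u, hu.mono_left hle⟩
  · have hB : Continuous fun s => B * phasedWave k d t s := continuous_const.mul hwave.continuous
    refine ⟨_, ((hB.tendsto r).mono_left nhdsWithin_le_nhds).congr' ?_⟩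
    filter_upwards [self_mem_nhdsWithin] with s hs' using (hs.eq_wave k s hs').symm
  · obtain ⟨U, hU⟩ := exists_tendsto_fderiv_field (β := β) (γ := γ) (hg.symbol.smooth k hk)
      (hg.hasCompactSupport hk) hQ0 (hg.eq_zero k hk) hF h₀
    rw [hΦ k]
    exact ⟨U, hU.mono_left hle⟩
  · have hB : Continuous fun s => B • fderiv ℝ (phasedWave k d t) s :=
      (hwave.continuous_fderiv (by simp)).const_smul B
    refine ⟨_, ((hB.tendsto r).mono_left nhdsWithin_le_nhds).congr' ?_⟩
    filter_upwards [self_mem_nhdsWithin] with s hs'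
    rw [(hs.eventuallyEq_wave hM k hs').fderiv_eq, fderiv_const_mul_phasedWave]
  · exact mem_closure_iff_frequently.2
      (((mem_closure_iff_frequently.1 hr).and_eventually h).mono fun s hs' => ⟨hs'.1, hs'.2 hs'.1⟩)

/-- On M itself the ray base is the point's own foot, so compactness bounds its distance to the
frontier from below; nearby points above M keep half of it. Every larger constant is admitted so
that the two sides can share one. -/
theorem IsSide.oneSidedClose_compact (hs : IsSide τ M₀ η α ν a c d t B Φ ψ) (hM : IsOpen M₀)
    (hη : IsCutoff δ M₀ η) (hQ : ∀ q ∈ M₀, ‖q‖ ≤ Q) (hQ0 : 0 ≤ Q) (hδ : 0 < δ) (hδ₁ : δ < 1 / 2)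
    (hfr : (frontier M₀).Nonempty) {K : Set E3} (hK : IsCompact K) (hKM : K ⊆ τ '' M₀) :
    ∃ C : ℝ, ∀ᶠ k : ℝ in atTop, ∀ r ∈ K, ∀ C' ≥ C,
      OneSidedClose (rayZone (τ '' M₀) d) (Φ k) (ψ k) r (C' / √k) (C' * √k) := by
  have hF := hs.frame
  have hcont : Continuous fun r => Metric.infDist (rayBase τ ν (c⁻¹ • a) r) (frontier M₀) :=
    (Metric.continuous_infDist_pt _).comp (continuous_rayBase τ ν _)
  obtain ⟨d₀, hd₀, hK₀⟩ := hK.exists_forall_le' hcont.continuousOn (a := 0) (by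
    intro r hr
    obtain ⟨q, hq, rfl⟩ := hKM hr
    rw [rayBase_image hF]
    refine (isClosed_frontier.notMem_iff_infDist_pos hfr).1 fun h => ?_
    exact (hM.frontier_eq ▸ h).2 hq)
  obtain ⟨ρ, hρ, hKρ⟩ := hK.isBounded.subset_ball_lt 0 0
  obtain ⟨C, hC⟩ := hs.asymp hM hη hQ hQ0 hδ hδ₁ (half_pos hd₀) hρ
  refine ⟨C, ?_⟩
  filter_upwards [hC, eventually_gt_atTop 1] with k hkC hk r hr C' hC'
  have hcl : r ∈ closure (rayZone (τ '' M₀) d) := by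
    obtain ⟨q, hq, rfl⟩ := hKM hr
    rw [closure_rayZone hF hs.continued]
    refine ⟨(height_image hF q).ge, ?_⟩
    rw [Set.mem_preimage, rayBase_image hF]
    exact subset_closure hq
  refine hs.oneSidedClose hM hη hQ hQ0 hk hcl ?_
  filter_upwards [Metric.isOpen_ball.mem_nhds (hKρ hr), hcont.continuousAt.eventually
    (lt_mem_nhds ((half_lt_self hd₀).trans_le (hK₀ r hr)))] with s h1 h2 h3
  obtain ⟨h4, h5⟩ := hkC s (rayZone_subset_upperSide hF hs.continued h3) (by simpa using h1) h2.le
  exact ⟨h4.trans (by gcongr), h5.trans (by gcongr)⟩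

/-- No comparison is needed: Φ and the wave are bounded separately, the wave by |B| and its gradient
by k|B||d|. -/
theorem IsSide.oneSidedClose_bounded (hs : IsSide τ M₀ η α ν a c d t B Φ ψ) (hM : IsOpen M₀)
    (hη : IsCutoff δ M₀ η) (hQ : ∀ q ∈ M₀, ‖q‖ ≤ Q) (hQ0 : 0 ≤ Q) (hδ : 0 < δ) (hδ₁ : δ < 1 / 2)
    {ρ : ℝ} (hρ : 0 < ρ) :
    ∃ C : ℝ, ∀ k : ℝ, 1 < k → ∀ r ∈ closure (rayZone (τ '' M₀) d), ‖r‖ < ρ → ∀ C' ≥ C,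
      OneSidedClose (rayZone (τ '' M₀) d) (Φ k) (ψ k) r C' (k * C') := by
  obtain ⟨C, hC0, hC⟩ := hs.bounds hM hη hQ hQ0 hδ hδ₁ hρ
  refine ⟨C + ‖B‖ * (1 + ‖d‖), fun k hk r hr hrρ C' hC' => ?_⟩
  refine hs.oneSidedClose hM hη hQ hQ0 hk hr ?_
  filter_upwards [continuous_norm.continuousAt.eventually (gt_mem_nhds hrρ)] with s h1 h2
  obtain ⟨h3, h4⟩ := hC k hk s (rayZone_subset_upperSide hs.frame hs.continued h2) h1
  have hψ := hs.eventuallyEq_wave hM k h2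
  rw [hψ.fderiv_eq, hψ.eq_of_nhds, fderiv_const_mul_phasedWave]
  have hB : 0 ≤ ‖B‖ * ‖d‖ := by positivity
  constructor
  · refine (norm_sub_le _ _).trans ?_
    rw [norm_mul, norm_phasedWave]
    nlinarith [norm_nonneg B]
  · refine (norm_sub_le _ _).trans ?_
    rw [norm_smul]
    have h5 := mul_le_mul_of_nonneg_left
      (norm_fderiv_phasedWave_le (k := k) (by linarith) d t s) (norm_nonneg B)
    have h6 := mul_le_mul_of_nonneg_left hC' (show 0 ≤ k by linarith)
    nlinarith [mul_nonneg (show 0 ≤ k by linarith) (norm_nonneg B)]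

end Side

/-! ### Combining the two sides -/

section TwoSides

variable {τ : E2 →ᵃⁱ[ℝ] E3} {M₀ : Set E2} {η : ℝ → E2 → ℝ} {α n : E3} {a : E2} {c : ℝ}
  {d e : E3} {t u : ℝ} {A B : ℂ} {Φ ψ : ℝ → E3 → ℂ} {δ Q : ℝ} {R S : Set E3}

theorem IsSide.notMem_image (hs : IsSide τ M₀ η α n a c d t A Φ ψ) (hM : IsOpen M₀) {r : E3}
    (hr : r ∉ frontier (rayZone (τ '' M₀) d)) : r ∉ τ '' M₀ := by
  rintro ⟨q, hq, rfl⟩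
  refine hr (mem_frontier_rayZone_of_height hs.frame hs.continued hM (height_image hs.frame q) ?_)
  rw [foot_image hs.frame]
  exact subset_closure hq

/-- Both zones have the same tangential slope, so replacing the height by its absolute value gives
one base map that is continuous across the plane. -/
theorem mem_closure_rayZone_union (hR : IsSide τ M₀ η α n a c d t A Φ ψ)
    (hS : IsSide τ M₀ η α (-n) a c e u B Φ ψ) {r : E3}
    (hr : foot τ r - |height τ n r| • c⁻¹ • a ∈ M₀) :
    r ∈ closure (rayZone (τ '' M₀) d ∪ rayZone (τ '' M₀) e) := by
  rw [closure_union, closure_rayZone hR.frame hR.continued, closure_rayZone hS.frame hS.continued]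
  rcases le_total 0 (height τ n r) with h | h
  · rw [abs_of_nonneg h] at hr
    exact Or.inl ⟨h, subset_closure hr⟩
  · rw [abs_of_nonpos h, ← height_neg] at hr
    refine Or.inr ⟨?_, subset_closure hr⟩
    rw [Set.mem_ofPred_eq, height_neg]
    linarith

/-- The two-sided base map sends a point of M to its foot in the open set M₀. A whole neighbourhood
of that point then lies in the closed zones and misses the outer region. -/
theorem notMem_image_of_mem_closure_outer (hR : IsSide τ M₀ η α n a c d t A Φ ψ)
    (hS : IsSide τ M₀ η α (-n) a c e u B Φ ψ) (hM : IsOpen M₀) {r : E3}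
    (hr : r ∈ closure (closure (rayZone (τ '' M₀) d ∪ rayZone (τ '' M₀) e))ᶜ) : r ∉ τ '' M₀ := by
  rintro ⟨q, hq, rfl⟩
  have hcont : Continuous fun r => foot τ r - |height τ n r| • c⁻¹ • a :=
    (continuous_foot τ).sub ((continuous_height τ n).abs.smul continuous_const)
  have hmem : foot τ (τ q) - |height τ n (τ q)| • c⁻¹ • a ∈ M₀ := by
    rwa [height_image hR.frame, foot_image hR.frame, abs_zero, zero_smul, sub_zero]
  obtain ⟨s, hs, hs'⟩ := ((mem_closure_iff_frequently.1 hr).and_eventually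
    (hcont.continuousAt.eventually (hM.mem_nhds hmem))).exists
  exact hs (mem_closure_rayZone_union hR hS hs')

theorem dense_setOf_height_ne (hF : IsFrame τ α n a c) : Dense {r | height τ n r ≠ 0} := by
  intro r
  by_cases h : height τ n r = 0
  · exact closure_mono (fun s hs => ne_of_gt hs) (mem_closure_upperSide hF h.ge)
  · exact subset_closure h

theorem eventuallyEq_zero_of_notMem_closure
    (hψ : ∀ k r, r ∉ R → r ∉ S → ψ k r = 0)
    (k : ℝ) {r : E3} (h₁ : r ∉ closure R) (h₂ : r ∉ closure S) : ψ k =ᶠ[𝓝 r] fun _ => 0 := by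
  filter_upwards [isClosed_closure.isOpen_compl.mem_nhds h₁,
    isClosed_closure.isOpen_compl.mem_nhds h₂] with s h3 h4
  exact hψ k s (fun h => h3 (subset_closure h)) fun h => h4 (subset_closure h)

theorem differentiableAt_of_notMem_frontier (hR : IsSide τ M₀ η α n a c d t A Φ ψ)
    (hS : IsSide τ M₀ η α (-n) a c e u B Φ ψ) (hM : IsOpen M₀) (hη : IsCutoff δ M₀ η)
    (hQ : ∀ q ∈ M₀, ‖q‖ ≤ Q)
    (hψ : ∀ k r, r ∉ rayZone (τ '' M₀) d → r ∉ rayZone (τ '' M₀) e → ψ k r = 0)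
    {k : ℝ} (hk : 1 < k) {r : E3}
    (hr : r ∈ (frontier (rayZone (τ '' M₀) d) ∪ frontier (rayZone (τ '' M₀) e))ᶜ) :
    DifferentiableAt ℝ (Φ k) r ∧ DifferentiableAt ℝ (ψ k) r := by
  have hr₁ : r ∉ frontier (rayZone (τ '' M₀) d) := fun h => hr (Or.inl h)
  have hr₂ : r ∉ frontier (rayZone (τ '' M₀) e) := fun h => hr (Or.inr h)
  refine ⟨(hR.differentiableAt_field hM hη hQ hk (hR.notMem_image hM hr₁)).1, ?_⟩
  by_cases h₁ : r ∈ rayZone (τ '' M₀) d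
  · exact (((contDiff_phasedWave k d t).differentiable (by simp) r).const_mul A).congr_of_eventuallyEq
      (hR.eventuallyEq_wave hM k h₁)
  by_cases h₂ : r ∈ rayZone (τ '' M₀) e
  · exact (((contDiff_phasedWave k e u).differentiable (by simp) r).const_mul B).congr_of_eventuallyEq
      (hS.eventuallyEq_wave hM k h₂)
  rw [(isOpen_rayZone hR.frame hR.continued hM).frontier_eq] at hr₁
  rw [(isOpen_rayZone hS.frame hS.continued hM).frontier_eq] at hr₂
  exact (differentiableAt_const _).congr_of_eventuallyEq
    (eventuallyEq_zero_of_notMem_closure hψ k (fun h => hr₁ ⟨h, h₁⟩) fun h => hr₂ ⟨h, h₂⟩)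

/-- A ray base on ∂M would put the point on the boundary of one of the zones, so compactness keeps
the bases at a positive distance from ∂M on both sides at once. -/
theorem asymp_of_notMem_frontier (hR : IsSide τ M₀ η α n a c d t A Φ ψ)
    (hS : IsSide τ M₀ η α (-n) a c e u B Φ ψ) (hM : IsOpen M₀) (hη : IsCutoff δ M₀ η)
    (hQ : ∀ q ∈ M₀, ‖q‖ ≤ Q) (hQ0 : 0 ≤ Q) (hδ : 0 < δ) (hδ₁ : δ < 1 / 2)
    (hfr : (frontier M₀).Nonempty)
    (hψ : ∀ k r, r ∉ rayZone (τ '' M₀) d → r ∉ rayZone (τ '' M₀) e → ψ k r = 0)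
    {K : Set E3} (hK : IsCompact K)
    (hKr : K ⊆ (frontier (rayZone (τ '' M₀) d) ∪ frontier (rayZone (τ '' M₀) e))ᶜ) :
    ∃ C : ℝ, ∀ᶠ k : ℝ in atTop, ∀ r ∈ K, ‖Φ k r - ψ k r‖ ≤ C / √k ∧
      ‖fderiv ℝ (Φ k) r - fderiv ℝ (ψ k) r‖ ≤ C * √k := by
  have hcont : Continuous fun r =>
      Metric.infDist (foot τ r - |height τ n r| • c⁻¹ • a) (frontier M₀) :=
    (Metric.continuous_infDist_pt _).comp
      ((continuous_foot τ).sub ((continuous_height τ n).abs.smul continuous_const))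
  obtain ⟨d₀, hd₀, hK₀⟩ := hK.exists_forall_le' hcont.continuousOn (a := 0) (by
    intro r hr
    refine (isClosed_frontier.notMem_iff_infDist_pos hfr).1 fun h => ?_
    rcases le_total 0 (height τ n r) with h0 | h0
    · rw [abs_of_nonneg h0] at h
      exact hKr hr (Or.inl (mem_frontier_rayZone hR.frame hR.continued hM h0 h))
    · rw [abs_of_nonpos h0, ← height_neg] at h
      refine hKr hr (Or.inr (mem_frontier_rayZone hS.frame hS.continued hM ?_ h))
      rw [height_neg]
      linarith)
  obtain ⟨ρ, hρ, hKρ⟩ := hK.isBounded.subset_ball_lt 0 0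
  obtain ⟨C₁, hC₁⟩ := hR.asymp hM hη hQ hQ0 hδ hδ₁ (half_pos hd₀) hρ
  obtain ⟨C₂, hC₂⟩ := hS.asymp hM hη hQ hQ0 hδ hδ₁ (half_pos hd₀) hρ
  refine ⟨max C₁ C₂, ?_⟩
  filter_upwards [hC₁, hC₂, eventually_gt_atTop 1] with k hk₁ hk₂ hk r hr
  have hnear : ∀ᶠ s in 𝓝 r, s ∈ upperSide τ n ∪ upperSide τ (-n) →
      ‖Φ k s - ψ k s‖ ≤ max C₁ C₂ / √k ∧
        ‖fderiv ℝ (Φ k) s - fderiv ℝ (ψ k) s‖ ≤ max C₁ C₂ * √k := by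
    filter_upwards [Metric.isOpen_ball.mem_nhds (hKρ hr), hcont.continuousAt.eventually
      (lt_mem_nhds ((half_lt_self hd₀).trans_le (hK₀ r hr)))] with s h1 h2 h3
    have h1' : ‖s‖ < ρ := by simpa using h1
    rcases h3 with h3 | h3
    · have h4 : 0 < height τ n s := h3
      rw [abs_of_pos h4] at h2
      obtain ⟨h5, h6⟩ := hk₁ s h3 h1' h2.le
      exact ⟨h5.trans (by gcongr; exact le_max_left _ _), h6.trans (by gcongr; exact le_max_left _ _)⟩
    · have h4 : 0 < height τ (-n) s := h3
      rw [height_neg] at h4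
      rw [abs_of_neg (by linarith), ← height_neg] at h2
      obtain ⟨h5, h6⟩ := hk₂ s h3 h1' h2.le
      exact ⟨h5.trans (by gcongr; exact le_max_right _ _),
        h6.trans (by gcongr; exact le_max_right _ _)⟩
  rcases lt_trichotomy (height τ n r) 0 with h0 | h0 | h0
  · refine hnear.self_of_nhds (Or.inr ?_)
    change 0 < height τ (-n) r
    rw [height_neg]
    linarith
  -- A plane point outside the closure of M: the layer estimates hold only off the plane, but Φ and
  -- ψ are C¹ here and the inequalities pass to the limit from above.
  · have hr₁ : r ∉ frontier (rayZone (τ '' M₀) d) := fun h => hKr hr (Or.inl h)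
    have hcl : foot τ r ∉ closure M₀ := fun h =>
      hr₁ (mem_frontier_rayZone_of_height hR.frame hR.continued hM h0 h)
    have h0' : height τ (-n) r = 0 := by rw [height_neg, h0, neg_zero]
    have hψr : ψ k =ᶠ[𝓝 r] fun _ => 0 := by
      refine eventuallyEq_zero_of_notMem_closure hψ k (fun h => hcl ?_) fun h => hcl ?_
      · rw [closure_rayZone hR.frame hR.continued] at h
        have h2 := h.2
        rwa [Set.mem_preimage, rayBase, h0, zero_smul, sub_zero] at h2
      · rw [closure_rayZone hS.frame hS.continued] at h
        have h2 := h.2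
        rwa [Set.mem_preimage, rayBase, h0', zero_smul, sub_zero] at h2
    obtain ⟨hΦ, hΦ'⟩ := hR.differentiableAt_field hM hη hQ hk (hR.notMem_image hM hr₁)
    have hψ₁ : ContinuousAt (ψ k) r := continuousAt_const.congr hψr.symm
    have hψ₂ : ContinuousAt (fderiv ℝ (ψ k)) r := by
      have h : fderiv ℝ (ψ k) =ᶠ[𝓝 r] 0 := by simpa using hψr.fderiv (𝕜 := ℝ)
      exact continuousAt_const.congr h.symm
    have hfreq := ((mem_closure_iff_frequently.1
      (mem_closure_upperSide hR.frame h0.ge)).and_eventually hnear)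
    exact ⟨le_of_tendsto_of_frequently (hΦ.continuousAt.sub hψ₁).norm
        (hfreq.mono fun s hs => (hs.2 (Or.inl hs.1)).1),
      le_of_tendsto_of_frequently (hΦ'.sub hψ₂).norm
        (hfreq.mono fun s hs => (hs.2 (Or.inl hs.1)).2)⟩
  · exact hnear.self_of_nhds (Or.inl h0)

/-- In the outer region ψ vanishes, so a bound on Φ suffices. It is known off the plane only, which
is dense, and Φ is C¹ up to the boundary of the region because M is not reached. -/
theorem oneSidedClose_outer (hR : IsSide τ M₀ η α n a c d t A Φ ψ)
    (hS : IsSide τ M₀ η α (-n) a c e u B Φ ψ) (hM : IsOpen M₀) (hη : IsCutoff δ M₀ η)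
    (hQ : ∀ q ∈ M₀, ‖q‖ ≤ Q) (hQ0 : 0 ≤ Q) (hδ : 0 < δ) (hδ₁ : δ < 1 / 2)
    (hψ : ∀ k r, r ∉ rayZone (τ '' M₀) d → r ∉ rayZone (τ '' M₀) e → ψ k r = 0)
    {ρ : ℝ} (hρ : 0 < ρ) :
    ∃ C : ℝ, ∀ k : ℝ, 1 < k →
      ∀ r ∈ closure (closure (rayZone (τ '' M₀) d ∪ rayZone (τ '' M₀) e))ᶜ, ‖r‖ < ρ → ∀ C' ≥ C,
        OneSidedClose (closure (rayZone (τ '' M₀) d ∪ rayZone (τ '' M₀) e))ᶜ (Φ k) (ψ k) r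
          C' (k * C') := by
  set Z := (closure (rayZone (τ '' M₀) d ∪ rayZone (τ '' M₀) e))ᶜ with hZ
  have hZo : IsOpen Z := isClosed_closure.isOpen_compl
  obtain ⟨C₁, hC₁0, hC₁⟩ := hR.bounds hM hη hQ hQ0 hδ hδ₁ hρ
  obtain ⟨C₂, hC₂0, hC₂⟩ := hS.bounds hM hη hQ hQ0 hδ hδ₁ hρ
  refine ⟨C₁ + C₂, fun k hk r hr hrρ C' hC' => ?_⟩
  have hk0 : 0 ≤ k := by linarith
  obtain ⟨hΦ, hΦ'⟩ := hR.differentiableAt_field hM hη hQ hk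
    (notMem_image_of_mem_closure_outer hR hS hM hr)
  have hzero : ∀ s ∈ Z, ψ k =ᶠ[𝓝 s] fun _ => 0 := fun s hs => by
    rw [hZ, closure_union] at hs
    exact eventuallyEq_zero_of_notMem_closure hψ k (fun h => hs (Or.inl h)) fun h => hs (Or.inr h)
  have hzero' : ∀ s ∈ Z, fderiv ℝ (ψ k) s = 0 := fun s hs => by
    rw [(hzero s hs).fderiv_eq, fderiv_fun_const, Pi.zero_apply]
  refine OneSidedClose.of_mem_closure ⟨_, hΦ.continuousAt.tendsto.mono_left nhdsWithin_le_nhds⟩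
    ⟨0, tendsto_const_nhds.congr' ?_⟩ ⟨_, hΦ'.tendsto.mono_left nhdsWithin_le_nhds⟩
    ⟨0, tendsto_const_nhds.congr' ?_⟩ ?_
  · filter_upwards [self_mem_nhdsWithin] with s hs using (hzero s hs).eq_of_nhds.symm
  · filter_upwards [self_mem_nhdsWithin] with s hs using (hzero' s hs).symm
  · have hr' : r ∈ closure (Z ∩ {r | height τ n r ≠ 0}) :=
      closure_minimal ((dense_setOf_height_ne hR.frame).open_subset_closure_inter hZo)
        isClosed_closure hr
    refine mem_closure_iff_frequently.2 (((mem_closure_iff_frequently.1 hr').and_eventually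
      (continuous_norm.continuousAt.eventually (gt_mem_nhds hrρ))).mono ?_)
    rintro s ⟨⟨hs, hs0⟩, hsρ⟩
    refine ⟨hs, ?_⟩
    rw [hzero' s hs, (hzero s hs).eq_of_nhds, sub_zero, sub_zero]
    rcases lt_or_gt_of_ne hs0 with h | h
    · obtain ⟨h1, h2⟩ := hC₂ k hk s (show 0 < height τ (-n) s by rw [height_neg]; linarith) hsρ
      exact ⟨by linarith, by nlinarith⟩
    · obtain ⟨h1, h2⟩ := hC₁ k hk s h hsρ
      exact ⟨by linarith, by nlinarith⟩

end TwoSides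

/-! ### The two sides of the Kirchhoff approximation and the theorem -/

theorem isSide_reflected {τ : E2 →ᵃⁱ[ℝ] E3} {M₀ : Set E2} (hM : IsOpen M₀) (η : ℝ → E2 → ℝ)
    {α n : E3} (hα : ‖α‖ = 1) (hn : ‖n‖ = 1) (hnorm : ∀ v : E2, inner ℝ n (τ.linear v) = 0)
    (hnα : inner ℝ n α < 0) (Λ : ℂ) :
    IsSide τ M₀ η α n (tangentPart τ α) (-inner ℝ n α) (reflDir α n) (phaseShift τ α n)
      (reflCoeff α n Λ) (kirchhoff τ M₀ η α n Λ) (eikonal τ M₀ α n Λ) := by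
  have hF := isFrame_normal hα hn hnorm hnα
  refine ⟨hF, isContinued_reflDir hF, ⟨_, _, (reflected_amplitude hnα).symm,
    fun k => kirchhoff_eq_field hM k⟩, fun k r hr => eikonal_of_mem_reflectedZone hF hr,
    fun k r hr hr' => eikonal_of_notMem hr' fun h => ?_⟩
  have h1 : 0 < height τ n r := hr
  have h2 : 0 < height τ (-n) r := rayZone_subset_upperSide hF.neg (isContinued_self hF) h
  rw [height_neg] at h2
  linarith

theorem isSide_shadow {τ : E2 →ᵃⁱ[ℝ] E3} {M₀ : Set E2} (hM : IsOpen M₀) (η : ℝ → E2 → ℝ)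
    {α n : E3} (hα : ‖α‖ = 1) (hn : ‖n‖ = 1) (hnorm : ∀ v : E2, inner ℝ n (τ.linear v) = 0)
    (hnα : inner ℝ n α < 0) (Λ : ℂ) :
    IsSide τ M₀ η α (-n) (tangentPart τ α) (-inner ℝ n α) α 0 (-1)
      (kirchhoff τ M₀ η α n Λ) (eikonal τ M₀ α n Λ) := by
  have hF := isFrame_normal hα hn hnorm hnα
  refine ⟨hF.neg, isContinued_self hF, ⟨_, _, (shadow_amplitude (Λ := Λ) hnα).symm, fun k => ?_⟩,
    fun k r hr => eikonal_of_mem_shadowZone hr,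
    fun k r hr hr' => eikonal_of_notMem (fun h => ?_) hr'⟩
  · rw [kirchhoff_eq_field hM, ← field_neg_normal, neg_neg]
  · have h1 : 0 < height τ (-n) r := hr
    have h2 : 0 < height τ n r := rayZone_subset_upperSide hF (isContinued_reflDir hF) h
    rw [height_neg] at h1
    linarith

end KirchhoffPolygon

end

theorem mainTheorem5
    (τ : KirchhoffPolygon.E2 →ᵃⁱ[ℝ] KirchhoffPolygon.E3)
    (V : Finset KirchhoffPolygon.E2) (hV : (KirchhoffPolygon.polygon V).Nonempty)
    (α n : KirchhoffPolygon.E3) (hα : ‖α‖ = 1) (hn : ‖n‖ = 1)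
    (hnorm : ∀ v : KirchhoffPolygon.E2, inner ℝ n (τ.linear v) = 0)
    (hnα : inner ℝ n α < 0)
    (Λ : ℂ) (hΛ : 0 ≤ Λ.im)
    (δ : ℝ) (hδ₀ : 0 < δ) (hδ₁ : δ < 1 / 2)
    (η : ℝ → KirchhoffPolygon.E2 → ℝ)
    (hη : KirchhoffPolygon.IsCutoff δ (KirchhoffPolygon.polygon V) η)
    (M S R : Set KirchhoffPolygon.E3) (Φ ψ : ℝ → KirchhoffPolygon.E3 → ℂ)
    (hM : M = τ '' KirchhoffPolygon.polygon V)
    (hS : S = KirchhoffPolygon.shadowZone M α)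
    (hR : R = KirchhoffPolygon.reflectedZone M α n)
    (hΦ : Φ = KirchhoffPolygon.kirchhoff τ (KirchhoffPolygon.polygon V) η α n Λ)
    (hψ : ψ = KirchhoffPolygon.eikonal τ (KirchhoffPolygon.polygon V) α n Λ) :
    -- away from the boundaries of the zones both functions are differentiable
    (∀ k : ℝ, 1 < k → ∀ r ∈ (frontier R ∪ frontier S)ᶜ,
      DifferentiableAt ℝ (Φ k) r ∧ DifferentiableAt ℝ (ψ k) r) ∧
    -- uniform asymptotics on compact subsets of `M`, from both sides of `M`
    (∀ K ⊆ M, IsCompact K → ∃ C : ℝ, ∀ᶠ k : ℝ in atTop, ∀ r ∈ K,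
      KirchhoffPolygon.OneSidedClose R (Φ k) (ψ k) r (C / √k) (C * √k) ∧
      KirchhoffPolygon.OneSidedClose S (Φ k) (ψ k) r (C / √k) (C * √k)) ∧
    -- uniform asymptotics on compact sets that avoid the boundaries of the zones
    (∀ K ⊆ (frontier R ∪ frontier S)ᶜ, IsCompact K →
      ∃ C : ℝ, ∀ᶠ k : ℝ in atTop, ∀ r ∈ K,
        ‖Φ k r - ψ k r‖ ≤ C / √k ∧ ‖fderiv ℝ (Φ k) r - fderiv ℝ (ψ k) r‖ ≤ C * √k) ∧
    -- uniform bounds on bounded sets, with one-sided limits on the boundaries of the zones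
    (∀ ρ : ℝ, 0 < ρ → ∃ C₁ C₂ : ℝ, ∀ᶠ k : ℝ in atTop, ∀ r : KirchhoffPolygon.E3, ‖r‖ < ρ →
      ∀ Z ∈ ({R, S, KirchhoffPolygon.outerZone M α n} : Set (Set KirchhoffPolygon.E3)),
        r ∈ closure Z → KirchhoffPolygon.OneSidedClose Z (Φ k) (ψ k) r C₁ (k * C₂)) := by

  open KirchhoffPolygon in
  subst hM hS hR hΦ hψ
  have hM : IsOpen (polygon V) := isOpen_interior
  have hbdd : Bornology.IsBounded (polygon V) :=
    (isBounded_convexHull.2 V.finite_toSet.isBounded).subset interior_subset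
  obtain ⟨Q, hQ0, hQ⟩ := hbdd.subset_ball_lt 0 0
  have hQ' : ∀ q ∈ polygon V, ‖q‖ ≤ Q := fun q hq =>
    (mem_ball_zero_iff.1 (hQ hq)).le
  -- A positive `infDist` characterizes points off the closed frontier only if the frontier is
  -- non-empty, since the distance to the empty set is 0 by convention.
  have hfr : (frontier (polygon V)).Nonempty :=
    nonempty_frontier_iff.2 ⟨hV, fun h => NormedSpace.unbounded_univ ℝ E2 (h ▸ hbdd)⟩
  have hR := isSide_reflected hM η hα hn hnorm hnα Λ
  have hS := isSide_shadow hM η hα hn hnorm hnα Λ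
  have hψ : ∀ k r, r ∉ rayZone (τ '' polygon V) (reflDir α n) → r ∉ rayZone (τ '' polygon V) α →
      eikonal τ (polygon V) α n Λ k r = 0 := fun k r h₁ h₂ => eikonal_of_notMem h₁ h₂
  refine ⟨fun k hk r hr => differentiableAt_of_notMem_frontier hR hS hM hη hQ' hψ hk hr,
    fun K hKM hK => ?_,
    fun K hKM hK => asymp_of_notMem_frontier hR hS hM hη hQ' hQ0.le hδ₀ hδ₁ hfr hψ hK hKM,
    fun ρ hρ => ?_⟩
  · obtain ⟨C₁, hC₁⟩ := hR.oneSidedClose_compact hM hη hQ' hQ0.le hδ₀ hδ₁ hfr hK hKM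
    obtain ⟨C₂, hC₂⟩ := hS.oneSidedClose_compact hM hη hQ' hQ0.le hδ₀ hδ₁ hfr hK hKM
    refine ⟨max C₁ C₂, ?_⟩
    filter_upwards [hC₁, hC₂] with k h₁ h₂ r hr
    exact ⟨h₁ r hr _ (le_max_left _ _), h₂ r hr _ (le_max_right _ _)⟩
  · obtain ⟨C₁, hC₁⟩ := hR.oneSidedClose_bounded hM hη hQ' hQ0.le hδ₀ hδ₁ hρ
    obtain ⟨C₂, hC₂⟩ := hS.oneSidedClose_bounded hM hη hQ' hQ0.le hδ₀ hδ₁ hρ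
    obtain ⟨C₃, hC₃⟩ := oneSidedClose_outer hR hS hM hη hQ' hQ0.le hδ₀ hδ₁ hψ hρ
    refine ⟨max C₁ (max C₂ C₃), max C₁ (max C₂ C₃), ?_⟩
    filter_upwards [eventually_gt_atTop 1] with k hk r hr Z hZ hrZ
    rcases hZ with rfl | rfl | rfl
    · exact hC₁ k hk r hrZ hr _ (le_max_left _ _)
    · exact hC₂ k hk r hrZ hr _ ((le_max_left _ _).trans (le_max_right _ _))
    · exact hC₃ k hk r hrZ hr _ ((le_max_right _ _).trans (le_max_right _ _))
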